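/- Let $\Omega\subset\mathbb{C}$ be the open unit disc, $2<p<\infty$, $\alpha=1-\frac2p$, and let $\|\cdot\|_p$ be the $L^p(\Omega)$ norm (Lebesgue measure $m$) and $\|f\|_\alpha=\sup_{\overline\Omega}|f|+\sup_{z\ne w}\frac{|f(z)-f(w)|}{|z-w|^\alpha}$ the norm of the Hölder space $C^\alpha(\overline\Omega)$. Define the Cauchy and Beurling operators by $$\mathcal{C}f(z)=\frac1\pi\int_\Omega\frac{f(\xi)}{z-\xi}\,dm(\xi),\quad \overline{\mathcal{C}}f(z)=\frac1\pi\int_\Omega\frac{f(\xi)}{\bar z-\bar\xi}\,dm(\xi),$$ $$\Pi f(z)=-\frac1\pi\,\mathrm{p.v.}\!\int_\Omega\frac{f(\xi)}{(z-\xi)^2}\,dm(\xi),\quad \overline\Pi f(z)=-\frac1\pi\,\mathrm{p.v.}\!\int_\Omega\frac{f(\xi)}{(\bar z-\bar\xi)^2}\,dm(\xi).$$ There are finite constants $C_\alpha,B_p$, depending only on $p$, such that for all $f\in L^p(\Omega)$ the principal values $\Pi f,\overline\Pi f$ exist almost everywhere in $\Omega$ and $$\|\mathcal{C}f\|_\alpha,\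 \|\overline{\mathcal{C}}f\|_\alpha\le C_\alpha\|f\|_p,\qquad \|\Pi f\|_p,\ \|\overline\Pi f\|_p\le B_p\|f\|_p.$$ Fix any such constants. Let $q_1,q_2\in L^p(\Omega)$, $C=400(C_\alpha+11)(C_\alpha+B_p)\max(\|q_1\|_p,\|q_2\|_p)$ and $n_0=\max\bigl(1,(\tfrac12C)^{p(2p+1)/2}\bigr)$. For $z_0\in\Omega$ and real $n>n_0$ put $R(z)=(z-z_0)^2+(\bar z-\bar z_0)^2$ and $$S_{n,z_0}f=-\tfrac14\,\mathcal{C}\bigl(e^{-inR}\,\overline{\mathcal{C}}(e^{inR}q_1f)\bigr),\qquad \overline S_{n,z_0}f=-\tfrac14\,\overline{\mathcal{C}}\bigl(e^{-inR}\,\mathcal{C}(e^{inR}q_2f)\bigr).$$ Then for every real $n>n_0$ and every $z_0\in\Omega$ each of the equations $$f=1+S_{n,z_0}f,\qquad g=1+\overline S_{n,z_0}g$$ has a unique solution in $C^\alpha(\overline\Omega)$. For fixed $n$, the solutions $f=f_{z_0}$ and $g=g_{z_0}$ depend continuously on $z_0$, as maps from $\Omega$ to $C^\alpha(\overline\Omega)$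 with the norm $\|\cdot\|_\alpha$. Moreover, these functions are in $W^{2,p}(\Omega)$, i.e. their distribution derivatives in $\Omega$ up to order $2$ belong to $L^p(\Omega)$. -/

import Mathlib

open MeasureTheory Filter Topology Set
open scoped ENNReal NNReal ComplexConjugate

noncomputable section

namespace BukhgeimDisc

/-- The open unit disc `Ω` of the plane `ℝ² = ℂ`. -/
def disc : Set ℂ := Metric.ball 0 1

/-- The closed unit disc. -/
def closedDisc : Set ℂ := Metric.closedBall 0 1

/-- Lebesgue measure on the unit disc. -/
def discMeasure : Measure ℂ := volume.restrict disc

/-- `f ∈ L^p(Ω)`, for a real exponent `p`. -/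
def MemLpDisc (p : ℝ) (f : ℂ → ℂ) : Prop := MemLp f (ENNReal.ofReal p) discMeasure

/-- The norm of `L^p(Ω)`, as an extended nonnegative number. -/
def lpNorm (p : ℝ) (f : ℂ → ℂ) : ℝ≥0∞ := eLpNorm f (ENNReal.ofReal p) discMeasure

/-- The norm of the Hölder space `C^α` of the closed disc (infinite for functions outside of the
space): the supremum of `|f|` plus the Hölder seminorm of the restriction of `f` to the closed
disc. -/
def holderNorm (α : ℝ) (f : ℂ → ℂ) : ℝ≥0∞ :=
  (⨆ z ∈ closedDisc, ‖f z‖ₑ) + eHolderNorm α.toNNReal (closedDisc.domRestrict f)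

/-- The restriction of `f` to the closed disc belongs to `C^α`. -/
def MemHolderDisc (α : ℝ) (f : ℂ → ℂ) : Prop := holderNorm α f < ⊤

/-- `g` is the weak derivative of `f` in `Ω` in the direction `v`
(used below only for `f` and `g` in `L^p(Ω)`). -/
def HasWeakDeriv (v : ℂ) (f g : ℂ → ℂ) : Prop :=
  ∀ φ : ℂ → ℂ, ContDiff ℝ ((⊤ : ℕ∞) : WithTop ℕ∞) φ → HasCompactSupport φ → tsupport φ ⊆ disc →
    ∫ z in disc, f z * fderiv ℝ φ z v = -∫ z in disc, g z * φ z

/-- `f ∈ W^{k,p}(Ω)`: `f` and its distribution derivatives up to order `k` (iterated in the two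
coordinate directions `1` and `i`) are functions in `L^p(Ω)`. -/
def MemSobolevDisc : ℕ → ℝ → (ℂ → ℂ) → Prop
  | 0, p, f => MemLpDisc p f
  | k + 1, p, f => MemLpDisc p f ∧
      ∀ v ∈ ({1, Complex.I} : Set ℂ), ∃ g : ℂ → ℂ, HasWeakDeriv v f g ∧ MemSobolevDisc k p g

/-- The Cauchy operator `f ↦ (1/π) ∫_Ω f(ξ) / (z - ξ) dm(ξ)`. -/
def cauchy (f : ℂ → ℂ) (z : ℂ) : ℂ :=
  (1 / Real.pi : ℂ) * ∫ ξ in disc, f ξ / (z - ξ)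

/-- The conjugate Cauchy operator `f ↦ (1/π) ∫_Ω f(ξ) / (conj z - conj ξ) dm(ξ)`. -/
def cauchyBar (f : ℂ → ℂ) (z : ℂ) : ℂ :=
  (1 / Real.pi : ℂ) * ∫ ξ in disc, f ξ / (conj z - conj ξ)

/-- The Beurling integral with the disc of radius `ε` about `z` removed. -/
def beurlingTrunc (f : ℂ → ℂ) (z : ℂ) (ε : ℝ) : ℂ :=
  -(1 / Real.pi : ℂ) * ∫ ξ in disc \ Metric.ball z ε, f ξ / (z - ξ) ^ 2

/-- The conjugate Beurling integral with the disc of radius `ε` about `z` removed. -/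
def beurlingBarTrunc (f : ℂ → ℂ) (z : ℂ) (ε : ℝ) : ℂ :=
  -(1 / Real.pi : ℂ) * ∫ ξ in disc \ Metric.ball z ε, f ξ / (conj z - conj ξ) ^ 2

/-- `g` is the Beurling transform of `f` in `Ω`: the principal value integral exists and equals
`g` at almost every point of `Ω`. -/
def IsBeurling (f g : ℂ → ℂ) : Prop :=
  ∀ᵐ z ∂discMeasure, Tendsto (beurlingTrunc f z) (𝓝[>] 0) (𝓝 (g z))

/-- `g` is the conjugate Beurling transform of `f` in `Ω`. -/
def IsBeurlingBar (f g : ℂ → ℂ) : Prop :=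
  ∀ᵐ z ∂discMeasure, Tendsto (beurlingBarTrunc f z) (𝓝[>] 0) (𝓝 (g z))

/-- `Cα` bounds the norms of the two Cauchy operators from `L^p(Ω)` to `C^α`, with
`α = 1 - 2/p`. -/
def IsCauchyBound (p : ℝ) (Cα : ℝ≥0) : Prop :=
  ∀ f : ℂ → ℂ, MemLpDisc p f →
    holderNorm (1 - 2 / p) (cauchy f) ≤ Cα * lpNorm p f ∧
    holderNorm (1 - 2 / p) (cauchyBar f) ≤ Cα * lpNorm p f

/-- The two Beurling operators are defined on `L^p(Ω)`, and `Bp` bounds their norms in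
`L^p(Ω)`. -/
def IsBeurlingBound (p : ℝ) (Bp : ℝ≥0) : Prop :=
  ∀ f : ℂ → ℂ, MemLpDisc p f →
    (∃ g, IsBeurling f g ∧ lpNorm p g ≤ Bp * lpNorm p f) ∧
    (∃ g, IsBeurlingBar f g ∧ lpNorm p g ≤ Bp * lpNorm p f)

/-- The phase `R(z) = (z - z₀)² + (conj z - conj z₀)²`. -/
def phase (z₀ z : ℂ) : ℂ := (z - z₀) ^ 2 + (conj z - conj z₀) ^ 2

/-- The oscillating factor `exp(i n R(z))`. -/
def osc (n : ℝ) (z₀ z : ℂ) : ℂ := Complex.exp (Complex.I * n * phase z₀ z)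

/-- The operator `S_{n,z₀} f = -(1/4) C(e^{-inR} Cbar(e^{inR} q f))`. -/
def opS (q : ℂ → ℂ) (n : ℝ) (z₀ : ℂ) (f : ℂ → ℂ) (z : ℂ) : ℂ :=
  -(1 / 4) * cauchy (fun ξ => osc (-n) z₀ ξ * cauchyBar (fun η => osc n z₀ η * q η * f η) ξ) z

/-- The operator `Sbar_{n,z₀} f = -(1/4) Cbar(e^{-inR} C(e^{inR} q f))`. -/
def opSBar (q : ℂ → ℂ) (n : ℝ) (z₀ : ℂ) (f : ℂ → ℂ) (z : ℂ) : ℂ :=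
  -(1 / 4) * cauchyBar (fun ξ => osc (-n) z₀ ξ * cauchy (fun η => osc n z₀ η * q η * f η) ξ) z

/-- The constant `C = 400 (Cα + 11) (Cα + Bp) max(‖q₁‖_p, ‖q₂‖_p)`. -/
def bigC (p : ℝ) (Cα Bp : ℝ≥0) (q₁ q₂ : ℂ → ℂ) : ℝ :=
  400 * (Cα + 11) * (Cα + Bp) * max (lpNorm p q₁).toReal (lpNorm p q₂).toReal

/-- The threshold `n₀ = max(1, (C/2)^{p(2p+1)/2})`. -/
def threshold (p : ℝ) (Cα Bp : ℝ≥0) (q₁ q₂ : ℂ → ℂ) : ℝ :=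
  max 1 ((bigC p Cα Bp q₁ q₂ / 2) ^ (p * (2 * p + 1) / 2))

/-- `f` is a solution in `C^α` of the closed disc of the equation `f = 1 + T f`. -/
def IsHolderSolution (α : ℝ) (T : (ℂ → ℂ) → ℂ → ℂ) (f : ℂ → ℂ) : Prop :=
  MemHolderDisc α f ∧ ∀ z ∈ closedDisc, f z = 1 + T f z

end BukhgeimDisc

end

open BukhgeimDisc

open MeasureTheory Filter Topology Set
open scoped ENNReal NNReal ComplexConjugate
open BukhgeimDisc


/-! ### Polar coordinates and integrals of powers of the distance. -/

namespace BukhgeimDisc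

/-! Four facts are combined.

Cauchy bound. For `p > 2` the conjugate exponent `q` is below `2`, so `1/(z-ξ)` is in `L^q` of the
disc. Hölder's inequality bounds the supremum of the Cauchy transform, and applied to
`1/((z-ξ)(w-ξ))` it yields the exponent `1 - 2/p` (`edist_cauchy_le`).

Beurling bound. The kernel `conj z/(|z|²+ε²)` has `∂`-derivative equal to minus its square and
`∂̄`-derivative a positive approximate identity. Since `∂φ` and `∂̄φ` have equal `L²` norms, the
smooth Beurling kernel built from its square is an `L²` contraction uniformly in `ε`. A
Calderón–Zygmund decomposition gives weak type (1,1), Marcinkiewicz interpolation the range `1 < q <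
2`, and duality gives `p > 2`. The integral truncated at radius `ε` is exactly the mean of the full
transform over a ball of radius `ε` (`integral_ball_testBeurling`), so principal values exist almost
everywhere by Lebesgue differentiation.

Contraction. By Fubini, `S f` integrates `f` times `e^{inR} q` against an oscillatory double Cauchy
kernel. On a horizontal line the phase is quadratic with constant second derivative: one-dimensional
stationary phase gives decay `|n|^(-1/2)` with too strong a singularity, the trivial estimate gives
a mild singularity and no decay. Interpolating them and integrating over the lines gives the sup
norm bound `420 |n|^(-1/5) ‖q‖_p` for `S` (`enorm_cauchy_osc_mul_cauchyBar_le`). Testing the Cauchy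
bound on the constant `1` shows `Cα ≥ 1/4`, which makes this less than `1` above the threshold
(`contractionConst_lt_one`). Banach's theorem in the continuous functions then gives existence; the
smoothing of the Cauchy operator upgrades continuity to Hölder continuity, and perturbation
estimates give uniqueness and continuous dependence on `z₀`.

Regularity. A solution is `1 - (1/4) C u` with `u` in `W^{1,p}`. Here `∂̄ C u = u`, and `∂ C u = C
∂u + z̄² u - C ∂̄(z̄² u)`, because the boundary terms of `∂u` and `∂̄(z̄² u)` coincide on the unit
circle (`IsSobolev.integral_tangential`). Both derivatives are again in `W^{1,p}`.

The equation for `g` is the complex conjugate of one for `f`, with `conj q₂` in place of `q₁` and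
`-n` in place of `n`. -/

theorem lintegral_norm_eq_polar {G : ℝ → ℝ≥0∞} (hG : Measurable G) :
    ∫⁻ z : ℂ, G ‖z‖ = ENNReal.ofReal (2 * Real.pi) * ∫⁻ r in Ioi (0 : ℝ), ENNReal.ofReal r * G r := by
  rw [← Complex.lintegral_comp_polarCoord_symm, polarCoord_target, Measure.volume_eq_prod,
    ← Measure.prod_restrict]
  have h1 : ∀ x ∈ Ioi (0 : ℝ) ×ˢ Ioo (-Real.pi) Real.pi, ENNReal.ofReal x.1 • G ‖Complex.polarCoord.symm x‖
      = ENNReal.ofReal x.1 * G x.1 := by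
    rintro x ⟨hx, -⟩
    simp only [Complex.norm_polarCoord_symm, smul_eq_mul]
    rw [abs_of_pos hx]
  rw [Measure.prod_restrict, setLIntegral_congr_fun (measurableSet_Ioi.prod measurableSet_Ioo) h1,
    ← Measure.prod_restrict,
    lintegral_prod _ (by fun_prop)]
  simp only [lintegral_const, MeasurableSet.univ, Measure.restrict_apply, univ_inter, Real.volume_Ioo]
  rw [lintegral_mul_const _ (by fun_prop), mul_comm]
  congr 2
  ring

theorem lintegral_Ioo_rpow {a r : ℝ} (ha : -1 < a) (hr : 0 < r) :
    ∫⁻ x in Ioo 0 r, ENNReal.ofReal (x ^ a) = ENNReal.ofReal (r ^ (a + 1) / (a + 1)) := by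
  have hi : IntegrableOn (fun x : ℝ => x ^ a) (Ioo 0 r) := by
    rw [intervalIntegral.integrableOn_Ioo_rpow_iff hr]; exact ha
  rw [← ofReal_integral_eq_lintegral_ofReal hi]
  · rw [← integral_Ioc_eq_integral_Ioo, ← intervalIntegral.integral_of_le hr.le,
      integral_rpow (Or.inl ha), Real.zero_rpow (by linarith), sub_zero]
  · filter_upwards [ae_restrict_mem measurableSet_Ioo] with x hx
    exact Real.rpow_nonneg hx.1.le _

theorem lintegral_Ici_rpow {a r : ℝ} (ha : a < -1) (hr : 0 < r) :
    ∫⁻ x in Ici r, ENNReal.ofReal (x ^ a) = ENNReal.ofReal (r ^ (a + 1) / (-a - 1)) := by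
  rw [setLIntegral_congr Ioi_ae_eq_Ici.symm]
  rw [← ofReal_integral_eq_lintegral_ofReal (integrableOn_Ioi_rpow_of_lt ha hr)]
  · rw [integral_Ioi_rpow_of_lt ha hr, neg_div, ← div_neg]
    congr 2; ring
  · filter_upwards [ae_restrict_mem measurableSet_Ioi] with x hx
    exact Real.rpow_nonneg (hr.trans hx).le _

theorem lintegral_ball_rpow {s r : ℝ} (z : ℂ) (hs : s < 2) (hr : 0 < r) :
    ∫⁻ ξ in Metric.ball z r, ENNReal.ofReal (‖z - ξ‖ ^ (-s)) =
      ENNReal.ofReal (2 * Real.pi * (r ^ (2 - s) / (2 - s))) := by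
  have h1 : ∫⁻ ξ in Metric.ball z r, ENNReal.ofReal (‖z - ξ‖ ^ (-s)) =
      ∫⁻ ξ : ℂ, (Iio r).indicator (fun x => ENNReal.ofReal (x ^ (-s))) ‖z - ξ‖ := by
    rw [← lintegral_indicator measurableSet_ball]
    congr 1 with ξ
    simp [indicator, dist_eq_norm, norm_sub_rev z ξ]
  rw [h1, lintegral_sub_left_eq_self (fun ξ : ℂ => (Iio r).indicator (fun x => ENNReal.ofReal (x ^ (-s))) ‖ξ‖) z,
    lintegral_norm_eq_polar]
  · rw [ENNReal.ofReal_mul (p := 2 * Real.pi) (by positivity)]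
    congr 1
    have : ∀ x ∈ Ioi (0 : ℝ), ENNReal.ofReal x * (Iio r).indicator (fun x => ENNReal.ofReal (x ^ (-s))) x =
        (Iio r).indicator (fun x => ENNReal.ofReal (x ^ (1 - s))) x := by
      intro x hx
      by_cases h : x < r
      · simp only [indicator, mem_Iio, h, if_true]
        rw [← ENNReal.ofReal_mul hx.le, sub_eq_add_neg, Real.rpow_add hx, Real.rpow_one]
      · simp [indicator, h]
    rw [setLIntegral_congr_fun measurableSet_Ioi this, lintegral_indicator measurableSet_Iio,
      Measure.restrict_restrict measurableSet_Iio, inter_comm, Ioi_inter_Iio,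
      lintegral_Ioo_rpow (by linarith) hr]
    ring_nf
  · exact Measurable.indicator (by fun_prop) measurableSet_Iio

theorem lintegral_compl_ball_rpow {s r : ℝ} (z : ℂ) (hs : 2 < s) (hr : 0 < r) :
    ∫⁻ ξ in (Metric.ball z r)ᶜ, ENNReal.ofReal (‖z - ξ‖ ^ (-s)) =
      ENNReal.ofReal (2 * Real.pi * (r ^ (2 - s) / (s - 2))) := by
  have h1 : ∫⁻ ξ in (Metric.ball z r)ᶜ, ENNReal.ofReal (‖z - ξ‖ ^ (-s)) =
      ∫⁻ ξ : ℂ, (Ici r).indicator (fun x => ENNReal.ofReal (x ^ (-s))) ‖z - ξ‖ := by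
    rw [← lintegral_indicator measurableSet_ball.compl]
    congr 1 with ξ
    simp [indicator, dist_eq_norm, norm_sub_rev z ξ]
  rw [h1, lintegral_sub_left_eq_self (fun ξ : ℂ => (Ici r).indicator (fun x => ENNReal.ofReal (x ^ (-s))) ‖ξ‖) z,
    lintegral_norm_eq_polar]
  · rw [ENNReal.ofReal_mul (p := 2 * Real.pi) (by positivity)]
    congr 1
    have : ∀ x ∈ Ioi (0 : ℝ), ENNReal.ofReal x * (Ici r).indicator (fun x => ENNReal.ofReal (x ^ (-s))) x =
        (Ici r).indicator (fun x => ENNReal.ofReal (x ^ (1 - s))) x := by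
      intro x hx
      by_cases h : r ≤ x
      · simp only [indicator, mem_Ici, h, if_true]
        rw [← ENNReal.ofReal_mul hx.le, sub_eq_add_neg, Real.rpow_add hx, Real.rpow_one]
      · simp [indicator, h]
    rw [setLIntegral_congr_fun measurableSet_Ioi this, lintegral_indicator measurableSet_Ici,
      Measure.restrict_restrict measurableSet_Ici, inter_eq_left.2 (Ici_subset_Ioi.2 hr),
      lintegral_Ici_rpow (by linarith) hr]
    congr 1
    ring_nf
  · exact Measurable.indicator (by fun_prop) measurableSet_Ici

theorem enorm_one_div_rpow (z : ℂ) {s : ℝ} (hs : 0 < s) :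
    ‖1 / z‖ₑ ^ s = ENNReal.ofReal (‖z‖ ^ (-s)) := by
  rw [← ofReal_norm, ENNReal.ofReal_rpow_of_nonneg (norm_nonneg _) hs.le, norm_div, norm_one,
    one_div, Real.inv_rpow (norm_nonneg _), Real.rpow_neg (norm_nonneg _)]

/-- The larger factor `b` is at least `d/2` and at least `a`; the first bound is used when `a` is
small, the second otherwise. This eliminates `b`, so that a kernel with two poles at distance `d` is
dominated by functions of the distance to the nearer pole. It serves both in the plane and on the
line. -/
theorem mul_rpow_neg_le {a b d s : ℝ} (ha : 0 < a) (hd : 0 < d) (hab : a ≤ b) (hdab : d ≤ a + b)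
    (hs : 0 < s) :
    (a * b) ^ (-s) ≤ (if a < d / 2 then (d / 2) ^ (-s) * a ^ (-s) else a ^ (-(2 * s))) := by
  have hb : 0 < b := ha.trans_le hab
  rw [Real.mul_rpow ha.le hb.le]
  split_ifs with h
  · rw [mul_comm]
    gcongr ?_ * _
    apply Real.rpow_le_rpow_of_nonpos (by positivity) (by linarith) (by linarith)
  · have : a ^ (-(2 * s)) = a ^ (-s) * a ^ (-s) := by
      rw [← Real.rpow_add ha]; ring_nf
    rw [this]
    gcongr _ * ?_
    apply Real.rpow_le_rpow_of_nonpos (by positivity) (by linarith) (by linarith)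

/-- The constant in `lintegral_two_point_rpow_le`. -/
noncomputable def twoPointConst (s : ℝ) : ℝ :=
  2 * (2 * Real.pi * ((1 / 2) ^ (-s) * ((1 / 2) ^ (2 - s) / (2 - s)) +
    (1 / 2) ^ (2 - 2 * s) / (2 * s - 2)))

/-- Each point is charged to the nearer pole `c`. Inside the ball of radius `d/2` about `c` the
singularity `|c-ξ|^(-s)` is integrable because `s < 2`; outside, `|c-ξ|^(-2s)` is integrable at
infinity because `2s > 2`. Both contributions scale like `d^(2-2s)`. -/
theorem lintegral_two_point_rpow_le {s : ℝ} (hs1 : 1 < s) (hs2 : s < 2) {z w : ℂ} (hzw : z ≠ w) :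
    ∫⁻ ξ : ℂ, ENNReal.ofReal ((‖z - ξ‖ * ‖w - ξ‖) ^ (-s)) ≤
      ENNReal.ofReal (twoPointConst s * ‖z - w‖ ^ (2 - 2 * s)) := by
  set d := ‖z - w‖ with hd
  have hd0 : 0 < d := norm_pos_iff.2 (sub_ne_zero.2 hzw)
  let G : ℂ → ℂ → ℝ≥0∞ := fun c ξ =>
    (Metric.ball c (d / 2)).indicator (fun ξ => ENNReal.ofReal ((d / 2) ^ (-s)) * ENNReal.ofReal (‖c - ξ‖ ^ (-s))) ξ +
    (Metric.ball c (d / 2))ᶜ.indicator (fun ξ => ENNReal.ofReal (‖c - ξ‖ ^ (-(2 * s)))) ξ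
  have hGint : ∀ c, ∫⁻ ξ, G c ξ = ENNReal.ofReal (twoPointConst s * d ^ (2 - 2 * s) / 2) := by
    intro c
    simp only [G]
    rw [lintegral_add_left (Measurable.indicator (by fun_prop) measurableSet_ball),
      lintegral_indicator measurableSet_ball, lintegral_indicator measurableSet_ball.compl,
      lintegral_const_mul _ (by fun_prop), lintegral_ball_rpow c hs2 (by positivity),
      lintegral_compl_ball_rpow c (by linarith) (by positivity),
      ← ENNReal.ofReal_mul (by positivity), ← ENNReal.ofReal_add]
    · congr 1
      have e1 : (d / 2) ^ (-s) = d ^ (-s) * (1 / 2) ^ (-s) := by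
        rw [div_eq_mul_one_div, Real.mul_rpow hd0.le (by positivity)]
      have e2 : (d / 2) ^ (2 - s) = d ^ (2 - s) * (1 / 2) ^ (2 - s) := by
        rw [div_eq_mul_one_div, Real.mul_rpow hd0.le (by positivity)]
      have e3 : (d / 2) ^ (2 - 2 * s) = d ^ (2 - 2 * s) * (1 / 2) ^ (2 - 2 * s) := by
        rw [div_eq_mul_one_div, Real.mul_rpow hd0.le (by positivity)]
      have e4 : d ^ (2 - 2 * s) = d ^ (-s) * d ^ (2 - s) := by
        rw [← Real.rpow_add hd0]; ring_nf
      rw [e1, e2, e3, e4, twoPointConst]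
      ring
    · have : 0 < 2 - s := by linarith
      positivity
    · have : 0 < 2 * s - 2 := by linarith
      positivity
  have hGle : ∀ a b ξ : ℂ, d = ‖a - b‖ → a ≠ ξ → ‖a - ξ‖ ≤ ‖b - ξ‖ →
      ENNReal.ofReal ((‖a - ξ‖ * ‖b - ξ‖) ^ (-s)) ≤ G a ξ := by
    intro a b ξ hab hne hle
    have h0 : 0 < ‖a - ξ‖ := norm_pos_iff.2 (sub_ne_zero.2 hne)
    have htri : d ≤ ‖a - ξ‖ + ‖b - ξ‖ := by
      rw [hab, norm_sub_rev b ξ]; exact norm_sub_le_norm_sub_add_norm_sub _ _ _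
    have := mul_rpow_neg_le h0 hd0 hle htri (by linarith : 0 < s)
    refine (ENNReal.ofReal_le_ofReal this).trans ?_
    by_cases h : ‖a - ξ‖ < d / 2
    · simp [G, indicator, dist_eq_norm, norm_sub_rev ξ a, h, ENNReal.ofReal_mul (show 0 ≤ (d / 2) ^ (-s) by positivity)]
    · simp [G, indicator, dist_eq_norm, norm_sub_rev ξ a, h, not_lt.1 h]
  have hnull : ∀ᵐ ξ : ℂ, ξ ≠ z ∧ ξ ≠ w := by
    filter_upwards [Measure.ae_ne volume z, Measure.ae_ne volume w] with ξ h1 h2 using ⟨h1, h2⟩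
  calc ∫⁻ ξ : ℂ, ENNReal.ofReal ((‖z - ξ‖ * ‖w - ξ‖) ^ (-s)) ≤ ∫⁻ ξ : ℂ, (G z ξ + G w ξ) := by
        apply lintegral_mono_ae
        filter_upwards [hnull] with ξ hξ
        rcases le_total ‖z - ξ‖ ‖w - ξ‖ with h | h
        · exact (hGle z w ξ hd hξ.1.symm h).trans le_self_add
        · rw [mul_comm]
          exact (hGle w z ξ (by rw [hd, norm_sub_rev]) hξ.2.symm h).trans le_add_self
    _ = _ := by
        have hm : Measurable (G z) :=
          (Measurable.indicator (by fun_prop) measurableSet_ball).add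
            (Measurable.indicator (by fun_prop) measurableSet_ball.compl)
        rw [lintegral_add_left hm, hGint, hGint, ← ENNReal.ofReal_add, add_halves] <;>
        · have : 0 < 2 - s := by linarith
          have : 0 < 2 * s - 2 := by linarith
          unfold twoPointConst
          positivity

theorem measurableSet_disc : MeasurableSet disc := measurableSet_ball

theorem lintegral_mul_le_lpNorm_mul {p q : ℝ} (hpq : p.HolderConjugate q) {f : ℂ → ℂ}
    (hf : MemLpDisc p f) {K : ℂ → ℝ≥0∞} (hK : AEMeasurable K discMeasure) :
    ∫⁻ ξ in disc, ‖f ξ‖ₑ * K ξ ≤ lpNorm p f * (∫⁻ ξ in disc, K ξ ^ q) ^ (1 / q) := by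
  refine (ENNReal.lintegral_mul_le_Lp_mul_Lq discMeasure hpq hf.1.enorm hK).trans_eq ?_
  rw [lpNorm, eLpNorm_eq_lintegral_rpow_enorm_toReal (by simpa using hpq.pos) ENNReal.ofReal_ne_top,
    ENNReal.toReal_ofReal hpq.nonneg]
  rfl

end BukhgeimDisc


namespace BukhgeimDisc

/-! ### Complex conjugation -/

/-- Since conjugation preserves all norms in use, this transfers every estimate for one Cauchy
operator to the other. -/
theorem cauchyBar_eq (f : ℂ → ℂ) (z : ℂ) : cauchyBar f z = conj (cauchy (fun ξ => conj (f ξ)) z) := by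
  unfold cauchyBar cauchy
  rw [map_mul, ← integral_conj]
  simp

theorem cauchy_eq (f : ℂ → ℂ) (z : ℂ) : cauchy f z = conj (cauchyBar (fun ξ => conj (f ξ)) z) := by
  rw [cauchyBar_eq]; simp

theorem lpNorm_conj (p : ℝ) (f : ℂ → ℂ) : lpNorm p (fun ξ => conj (f ξ)) = lpNorm p f :=
  eLpNorm_congr_norm_ae (Eventually.of_forall fun x => by simp)

theorem MemLpDisc.conj {p : ℝ} {f : ℂ → ℂ} (hf : MemLpDisc p f) :
    MemLpDisc p (fun ξ => conj (f ξ)) :=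
  hf.of_le (Complex.continuous_conj.comp_aestronglyMeasurable hf.1)
    (Eventually.of_forall fun x => by simp)

theorem holderWith_conj_iff {X : Type*} [PseudoEMetricSpace X] {C r : ℝ≥0} {f : X → ℂ} :
    HolderWith C r (fun z => conj (f z)) ↔ HolderWith C r f := by
  simp only [HolderWith, Complex.isometry_conj.edist_eq]

theorem holderNorm_conj (α : ℝ) (f : ℂ → ℂ) : holderNorm α (fun ξ => conj (f ξ)) = holderNorm α f := by
  have h : eHolderNorm α.toNNReal (closedDisc.domRestrict (fun ξ => conj (f ξ))) =
      eHolderNorm α.toNNReal (closedDisc.domRestrict f) := by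
    exact iInf_congr fun C => iInf_congr_Prop holderWith_conj_iff fun _ => rfl
  unfold holderNorm
  rw [h]
  simp

/-! ### Hölder bounds for the Cauchy transform -/

theorem holderConjugate_lt_two {p q : ℝ} (hp : 2 < p) (hpq : p.HolderConjugate q) : q < 2 := by
  have h := hpq.inv_add_inv_eq_one
  have hq := hpq.symm.pos
  by_contra! h2
  have h1 : p⁻¹ < 2⁻¹ := by gcongr
  have h3 : q⁻¹ ≤ 2⁻¹ := by gcongr
  linarith

/-- The bound for the supremum of the Cauchy transform. -/
noncomputable def cauchySupConst (q : ℝ) : ℝ := (2 * Real.pi * (2 ^ (2 - q) / (2 - q))) ^ (1 / q)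

theorem lintegral_kernel_rpow_le {q : ℝ} (hq0 : 0 < q) (hq2 : q < 2) {z : ℂ} (hz : z ∈ closedDisc) :
    (∫⁻ ξ in disc, ‖1 / (z - ξ)‖ₑ ^ q) ^ (1 / q) ≤ ENNReal.ofReal (cauchySupConst q) := by
  have h2q : 0 < 2 - q := by linarith
  rw [cauchySupConst, ← ENNReal.ofReal_rpow_of_nonneg (by positivity) (by positivity)]
  gcongr
  rw [← lintegral_ball_rpow z hq2 (by norm_num)]
  simp only [enorm_one_div_rpow _ hq0]
  apply lintegral_mono_set
  apply Metric.ball_subset_ball'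
  rw [closedDisc, mem_closedBall_iff_norm, sub_zero] at hz
  rw [dist_comm, dist_eq_norm, sub_zero]; linarith

theorem lintegral_mul_kernel_le {p q : ℝ} (hp : 2 < p) (hpq : p.HolderConjugate q) {f : ℂ → ℂ}
    (hf : MemLpDisc p f) {z : ℂ} (hz : z ∈ closedDisc) :
    ∫⁻ ξ in disc, ‖f ξ / (z - ξ)‖ₑ ≤ lpNorm p f * ENNReal.ofReal (cauchySupConst q) := by
  have := lintegral_mul_le_lpNorm_mul hpq hf (K := fun ξ => ‖1 / (z - ξ)‖ₑ) (by fun_prop)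
  refine le_trans (le_of_eq ?_) (this.trans ?_)
  · congr 1; ext ξ
    rw [← enorm_mul, mul_one_div]
  · gcongr
    exact lintegral_kernel_rpow_le hpq.symm.pos (holderConjugate_lt_two hp hpq) hz

theorem MemLpDisc.integrable_div {p : ℝ} (hp : 2 < p) {f : ℂ → ℂ}
    (hf : MemLpDisc p f) {z : ℂ} (hz : z ∈ closedDisc) :
    Integrable (fun ξ => f ξ / (z - ξ)) discMeasure := by
  have hpq := Real.HolderConjugate.conjExponent (show 1 < p by linarith)
  refine ⟨?_, (lintegral_mul_kernel_le hp hpq hf hz).trans_lt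
    (ENNReal.mul_lt_top hf.2 ENNReal.ofReal_lt_top)⟩
  exact AEStronglyMeasurable.mul hf.1 (by fun_prop : Measurable fun ξ : ℂ => (z - ξ)⁻¹).aestronglyMeasurable

theorem enorm_one_div_pi_le : ‖(1 / Real.pi : ℂ)‖ₑ ≤ 1 := by
  rw [← ofReal_norm, ← ENNReal.ofReal_one]
  apply ENNReal.ofReal_le_ofReal
  rw [norm_div, norm_one, Complex.norm_real, Real.norm_of_nonneg Real.pi_pos.le, div_le_one Real.pi_pos]
  linarith [Real.pi_gt_three]

theorem enorm_cauchy_le {p q : ℝ} (hp : 2 < p) (hpq : p.HolderConjugate q) {f : ℂ → ℂ}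
    (hf : MemLpDisc p f) {z : ℂ} (hz : z ∈ closedDisc) :
    ‖cauchy f z‖ₑ ≤ lpNorm p f * ENNReal.ofReal (cauchySupConst q) := by
  rw [cauchy, enorm_mul]
  calc _ ≤ 1 * ‖∫ ξ in disc, f ξ / (z - ξ)‖ₑ := by gcongr; exact enorm_one_div_pi_le
    _ ≤ _ := by
      rw [one_mul]
      exact (enorm_integral_le_lintegral_enorm _).trans (lintegral_mul_kernel_le hp hpq hf hz)

/-- The difference of the kernels is `(w-z)/((z-ξ)(w-ξ))`. Its `L^q` norm is at most a constant
times `|z-w|` to the power `1 + (2-2q)/q = 2/q - 1`, which equals `1 - 2/p` as the exponents are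
conjugate. -/
theorem edist_cauchy_le {p q : ℝ} (hp : 2 < p) (hpq : p.HolderConjugate q) {f : ℂ → ℂ}
    (hf : MemLpDisc p f) {z w : ℂ} (hz : z ∈ closedDisc) (hw : w ∈ closedDisc) (hzw : z ≠ w) :
    ‖cauchy f z - cauchy f w‖ₑ ≤
      lpNorm p f * ENNReal.ofReal (twoPointConst q ^ (1 / q) * ‖z - w‖ ^ (1 - 2 / p)) := by
  have hq2 := holderConjugate_lt_two hp hpq
  have hq1 : 1 < q := hpq.symm.lt
  have hq0 : 0 < q := by linarith
  have hd : 0 < ‖z - w‖ := norm_pos_iff.2 (sub_ne_zero.2 hzw)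
  have hc : 0 ≤ twoPointConst q := by
    have : 0 < 2 - q := by linarith
    have : 0 < 2 * q - 2 := by linarith
    unfold twoPointConst; positivity
  have hnull : ∀ᵐ ξ ∂discMeasure, ξ ≠ z ∧ ξ ≠ w := by
    refine ae_restrict_of_ae ?_
    filter_upwards [Measure.ae_ne volume z, Measure.ae_ne volume w] with ξ h1 h2 using ⟨h1, h2⟩
  have h1 : cauchy f z - cauchy f w =
      (1 / Real.pi : ℂ) * ((w - z) * ∫ ξ in disc, f ξ * (1 / ((z - ξ) * (w - ξ)))) := by
    unfold cauchy
    rw [← mul_sub, ← integral_sub (μ := volume.restrict disc) (hf.integrable_div hp hz) (hf.integrable_div hp hw),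
      ← integral_const_mul (w - z)]
    congr 1
    apply integral_congr_ae
    filter_upwards [hnull] with ξ hξ
    have e1 : z - ξ ≠ 0 := sub_ne_zero.2 hξ.1.symm
    have e2 : w - ξ ≠ 0 := sub_ne_zero.2 hξ.2.symm
    field_simp
    ring
  have h2 : (∫⁻ ξ in disc, ‖1 / ((z - ξ) * (w - ξ))‖ₑ ^ q) ^ (1 / q) ≤
      ENNReal.ofReal ((twoPointConst q * ‖z - w‖ ^ (2 - 2 * q)) ^ (1 / q)) := by
    rw [← ENNReal.ofReal_rpow_of_nonneg (by positivity) (by positivity)]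
    gcongr
    refine (setLIntegral_le_lintegral _ _).trans ?_
    refine le_trans (le_of_eq ?_) (lintegral_two_point_rpow_le hq1 hq2 hzw)
    congr 1; ext ξ
    rw [enorm_one_div_rpow _ hq0, norm_mul]
  have h3 : ‖z - w‖ * (twoPointConst q * ‖z - w‖ ^ (2 - 2 * q)) ^ (1 / q) =
      twoPointConst q ^ (1 / q) * ‖z - w‖ ^ (1 - 2 / p) := by
    rw [Real.mul_rpow hc (by positivity), ← Real.rpow_mul hd.le, mul_left_comm]
    congr 1
    nth_rw 1 [← Real.rpow_one ‖z - w‖]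
    rw [← Real.rpow_add hd]
    congr 1
    have h := hpq.inv_add_inv_eq_one
    have hp0 : p ≠ 0 := by linarith
    have : p⁻¹ = 1 - q⁻¹ := by linarith
    rw [div_eq_mul_inv 2 p, this]
    field_simp; ring
  rw [h1, enorm_mul, enorm_mul]
  calc _ ≤ 1 * (‖w - z‖ₑ * ∫⁻ ξ in disc, ‖f ξ‖ₑ * ‖1 / ((z - ξ) * (w - ξ))‖ₑ) := by
        gcongr
        · exact enorm_one_div_pi_le
        · refine (enorm_integral_le_lintegral_enorm _).trans (le_of_eq ?_)
          simp only [enorm_mul]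
    _ ≤ ENNReal.ofReal ‖z - w‖ * (lpNorm p f *
          ENNReal.ofReal ((twoPointConst q * ‖z - w‖ ^ (2 - 2 * q)) ^ (1 / q))) := by
        rw [one_mul, ← ofReal_norm, norm_sub_rev w z]
        gcongr
        exact (lintegral_mul_le_lpNorm_mul hpq hf (by fun_prop)).trans (by gcongr)
    _ = _ := by
        rw [mul_left_comm, ← ENNReal.ofReal_mul hd.le, h3]

theorem holderNorm_cauchy_le {p q : ℝ} (hp : 2 < p) (hpq : p.HolderConjugate q) {f : ℂ → ℂ}
    (hf : MemLpDisc p f) :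
    holderNorm (1 - 2 / p) (cauchy f) ≤
      ((cauchySupConst q).toNNReal + (twoPointConst q ^ (1 / q)).toNNReal : ℝ≥0) * lpNorm p f := by
  have hα : 0 ≤ 1 - 2 / p := by
    rw [sub_nonneg, div_le_one (by linarith)]; exact hp.le
  rw [ENNReal.coe_add, add_mul]
  unfold holderNorm
  gcongr
  · refine iSup₂_le fun z hz => ?_
    rw [mul_comm]
    exact enorm_cauchy_le hp hpq hf hz
  · have hlp : lpNorm p f ≠ ⊤ := hf.2.ne
    have : HolderWith ((twoPointConst q ^ (1 / q)).toNNReal * (lpNorm p f).toNNReal)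
        (1 - 2 / p).toNNReal (closedDisc.domRestrict (cauchy f)) := by
      intro z w
      by_cases hzw : z = w
      · simp [hzw]
      · have hzw' : (z : ℂ) ≠ w := fun h => hzw (Subtype.ext h)
        have h := edist_cauchy_le hp hpq hf z.2 w.2 hzw'
        rw [Set.domRestrict_apply, Set.domRestrict_apply, edist_eq_enorm_sub]
        refine h.trans (le_of_eq ?_)
        have hT : 0 ≤ twoPointConst q ^ (1 / q) := by
          apply Real.rpow_nonneg
          have := holderConjugate_lt_two hp hpq
          have := hpq.symm.lt
          have : 0 < 2 - q := by linarith
          have : 0 < 2 * q - 2 := by linarith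
          unfold twoPointConst; positivity
        rw [ENNReal.ofReal_mul hT, ENNReal.coe_mul, ENNReal.coe_toNNReal hlp,
          Subtype.edist_eq, edist_eq_enorm_sub, ← ofReal_norm, Real.coe_toNNReal _ hα,
          ENNReal.ofReal_rpow_of_nonneg (norm_nonneg _) hα]
        change _ = ENNReal.ofReal _ * _ * _
        ring
    refine this.eHolderNorm_le.trans (le_of_eq ?_)
    rw [ENNReal.coe_mul, ENNReal.coe_toNNReal hlp]

theorem exists_isCauchyBound {p : ℝ} (hp : 2 < p) : ∃ C : ℝ≥0, IsCauchyBound p C := by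
  have hpq := Real.HolderConjugate.conjExponent (show 1 < p by linarith)
  refine ⟨_, fun f hf => ⟨holderNorm_cauchy_le hp hpq hf, ?_⟩⟩
  have := holderNorm_cauchy_le hp hpq hf.conj
  rwa [lpNorm_conj, ← holderNorm_conj, ← funext (cauchyBar_eq f)] at this

end BukhgeimDisc


namespace BukhgeimDisc

/-! ### Wirtinger derivatives -/

/-- The Wirtinger derivative `∂`. -/
noncomputable def dz (f : ℂ → ℂ) (z : ℂ) : ℂ :=
  (fderiv ℝ f z 1 - Complex.I * fderiv ℝ f z Complex.I) / 2

/-- The Wirtinger derivative `∂bar`. -/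
noncomputable def dzbar (f : ℂ → ℂ) (z : ℂ) : ℂ :=
  (fderiv ℝ f z 1 + Complex.I * fderiv ℝ f z Complex.I) / 2

/-- The real-linear map `v ↦ a v + b conj v`. -/
noncomputable def wirtingerCLM (a b : ℂ) : ℂ →L[ℝ] ℂ :=
  a • (1 : ℂ →L[ℝ] ℂ) + b • (Complex.conjCLE : ℂ →L[ℝ] ℂ)

@[simp] theorem wirtingerCLM_apply (a b v : ℂ) : wirtingerCLM a b v = a * v + b * conj v := by
  simp [wirtingerCLM]

/-- `f` is differentiable at `z` with Wirtinger derivatives `a` and `b`. -/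
def HasWirtingerAt (f : ℂ → ℂ) (a b z : ℂ) : Prop := HasFDerivAt f (wirtingerCLM a b) z

namespace HasWirtingerAt

variable {f g : ℂ → ℂ} {a b c d z : ℂ}

theorem dz_eq (h : HasWirtingerAt f a b z) : dz f z = a := by
  have hI : Complex.I * Complex.I = -1 := Complex.I_mul_I
  simp only [dz, HasFDerivAt.fderiv h, wirtingerCLM_apply, map_one, Complex.conj_I]
  linear_combination (-a / 2 + b / 2) * hI

theorem dzbar_eq (h : HasWirtingerAt f a b z) : dzbar f z = b := by
  have hI : Complex.I * Complex.I = -1 := Complex.I_mul_I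
  simp only [dzbar, HasFDerivAt.fderiv h, wirtingerCLM_apply, map_one, Complex.conj_I]
  linear_combination (a / 2 - b / 2) * hI

theorem of_differentiableAt (h : DifferentiableAt ℝ f z) : HasWirtingerAt f (dz f z) (dzbar f z) z := by
  have hI : Complex.I * Complex.I = -1 := Complex.I_mul_I
  have h1 := h.hasFDerivAt
  unfold HasWirtingerAt
  convert! h1 using 1
  ext v
  have hv : v = v.re • (1 : ℂ) + v.im • Complex.I := by
    simp [Complex.re_add_im]
  rw [hv, map_add, map_smul, map_smul, map_add, map_smul, map_smul]
  simp only [wirtingerCLM_apply, map_one, Complex.conj_I, dz, dzbar, Complex.real_smul]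
  linear_combination (- v.im * fderiv ℝ f z Complex.I) * hI

theorem add (hf : HasWirtingerAt f a b z) (hg : HasWirtingerAt g c d z) :
    HasWirtingerAt (fun z => f z + g z) (a + c) (b + d) z := by
  unfold HasWirtingerAt at *
  convert! HasFDerivAt.add hf hg using 1
  ext v; simp; ring

theorem mul (hf : HasWirtingerAt f a b z) (hg : HasWirtingerAt g c d z) :
    HasWirtingerAt (fun z => f z * g z) (a * g z + f z * c) (b * g z + f z * d) z := by
  unfold HasWirtingerAt at *
  convert! HasFDerivAt.mul hf hg using 1
  ext v; simp; ring

theorem const (c z : ℂ) : HasWirtingerAt (fun _ => c) 0 0 z := by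
  unfold HasWirtingerAt
  convert! hasFDerivAt_const (𝕜 := ℝ) c z using 1
  ext v; simp

theorem id (z : ℂ) : HasWirtingerAt (fun z => z) 1 0 z := by
  unfold HasWirtingerAt
  convert! hasFDerivAt_id (𝕜 := ℝ) z using 1
  ext v; simp

theorem conj_id (z : ℂ) : HasWirtingerAt (fun z => conj z) 0 1 z := by
  unfold HasWirtingerAt
  convert! (Complex.conjCLE : ℂ →L[ℝ] ℂ).hasFDerivAt (x := z) using 1
  ext v; simp

theorem conj_comp (hf : HasWirtingerAt f a b z) :
    HasWirtingerAt (fun z => conj (f z)) (conj b) (conj a) z := by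
  unfold HasWirtingerAt at *
  convert! (Complex.conjCLE : ℂ →L[ℝ] ℂ).hasFDerivAt.comp z hf using 1
  ext v; simp; ring

theorem comp_holo {F : ℂ → ℂ} {F' : ℂ} (hF : HasDerivAt F F' (f z)) (hf : HasWirtingerAt f a b z) :
    HasWirtingerAt (fun z => F (f z)) (F' * a) (F' * b) z := by
  unfold HasWirtingerAt at *
  convert! (hF.hasFDerivAt.restrictScalars ℝ).comp z hf using 1
  ext v; simp; ring

end HasWirtingerAt

/-! ### Test functions -/

/-- Smooth functions with compact support in the plane. -/
def IsTest (φ : ℂ → ℂ) : Prop := ContDiff ℝ ((⊤ : ℕ∞) : WithTop ℕ∞) φ ∧ HasCompactSupport φ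

theorem contDiff_fderiv_apply {f : ℂ → ℂ} (hf : ContDiff ℝ ((⊤ : ℕ∞) : WithTop ℕ∞) f) (v : ℂ) :
    ContDiff ℝ ((⊤ : ℕ∞) : WithTop ℕ∞) (fun z => fderiv ℝ f z v) :=
  (hf.fderiv_right (by simp)).clm_apply contDiff_const

theorem contDiff_dz {f : ℂ → ℂ} (hf : ContDiff ℝ ((⊤ : ℕ∞) : WithTop ℕ∞) f) :
    ContDiff ℝ ((⊤ : ℕ∞) : WithTop ℕ∞) (dz f) := by
  have h1 := contDiff_fderiv_apply hf 1
  have h2 := contDiff_fderiv_apply hf Complex.I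
  unfold dz
  fun_prop

theorem contDiff_dzbar {f : ℂ → ℂ} (hf : ContDiff ℝ ((⊤ : ℕ∞) : WithTop ℕ∞) f) :
    ContDiff ℝ ((⊤ : ℕ∞) : WithTop ℕ∞) (dzbar f) := by
  have h1 := contDiff_fderiv_apply hf 1
  have h2 := contDiff_fderiv_apply hf Complex.I
  unfold dzbar
  fun_prop

theorem tsupport_dz_subset (f : ℂ → ℂ) : tsupport (dz f) ⊆ tsupport f := by
  refine (closure_mono ?_).trans (tsupport_fderiv_subset ℝ)
  intro z hz h
  apply hz
  simp [dz, h]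

theorem tsupport_dzbar_subset (f : ℂ → ℂ) : tsupport (dzbar f) ⊆ tsupport f := by
  refine (closure_mono ?_).trans (tsupport_fderiv_subset ℝ)
  intro z hz h
  apply hz
  simp [dzbar, h]

namespace IsTest

variable {φ ψ : ℂ → ℂ}

theorem dz (h : IsTest φ) : IsTest (dz φ) :=
  ⟨contDiff_dz h.1, h.2.mono' ((subset_tsupport _).trans (tsupport_dz_subset φ))⟩

theorem dzbar (h : IsTest φ) : IsTest (dzbar φ) :=
  ⟨contDiff_dzbar h.1, h.2.mono' ((subset_tsupport _).trans (tsupport_dzbar_subset φ))⟩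

theorem continuous (h : IsTest φ) : Continuous φ := h.1.continuous

theorem differentiable (h : IsTest φ) : Differentiable ℝ φ := h.1.differentiable (by simp)

theorem integrable (h : IsTest φ) : Integrable φ := h.continuous.integrable_of_hasCompactSupport h.2

theorem exists_bound (h : IsTest φ) : ∃ C, ∀ z, ‖φ z‖ ≤ C :=
  h.2.exists_bound_of_continuous h.continuous

theorem memLp (h : IsTest φ) (p : ℝ≥0∞) : MemLp φ p :=
  h.continuous.memLp_of_hasCompactSupport h.2

theorem mul_left (h : IsTest φ) (hψ : ContDiff ℝ ((⊤ : ℕ∞) : WithTop ℕ∞) ψ) :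
    IsTest (fun z => ψ z * φ z) :=
  ⟨hψ.mul h.1, h.2.mul_left⟩

theorem comp_sub_left (h : IsTest φ) (z : ℂ) : IsTest (fun ξ => φ (z - ξ)) := by
  refine ⟨h.1.comp (by fun_prop), ?_⟩
  exact h.2.comp_homeomorph (Homeomorph.subLeft z)

end IsTest

theorem integral_mul_fderiv_test {φ ψ : ℂ → ℂ} (hφ : IsTest φ) (hψ : ContDiff ℝ 1 ψ) (v : ℂ) :
    ∫ z, ψ z * fderiv ℝ φ z v = -∫ z, fderiv ℝ ψ z v * φ z := by
  have c1 : Continuous fun z => fderiv ℝ φ z v :=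
    (contDiff_fderiv_apply hφ.1 v).continuous
  have c2 : Continuous fun z => fderiv ℝ ψ z v :=
    (hψ.continuous_fderiv one_ne_zero).clm_apply continuous_const
  apply integral_mul_fderiv_eq_neg_fderiv_mul_of_integrable
  · exact (c2.mul hφ.continuous).integrable_of_hasCompactSupport hφ.2.mul_left
  · refine (hψ.continuous.mul c1).integrable_of_hasCompactSupport (HasCompactSupport.mul_left ?_)
    exact hφ.2.fderiv_apply ℝ v
  · exact (hψ.continuous.mul hφ.continuous).integrable_of_hasCompactSupport hφ.2.mul_left
  · exact fun x _ => (hψ.differentiable one_ne_zero) x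
  · exact fun x _ => hφ.differentiable x

theorem integrable_fderiv_mul_test {φ ψ : ℂ → ℂ} (hφ : IsTest φ) (hψ : ContDiff ℝ 1 ψ) (v : ℂ) :
    Integrable (fun z => fderiv ℝ ψ z v * φ z) := by
  have c2 : Continuous fun z => fderiv ℝ ψ z v :=
    (hψ.continuous_fderiv one_ne_zero).clm_apply continuous_const
  exact (c2.mul hφ.continuous).integrable_of_hasCompactSupport hφ.2.mul_left

theorem integrable_mul_fderiv_test {φ ψ : ℂ → ℂ} (hφ : IsTest φ) (hψ : Continuous ψ) (v : ℂ) :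
    Integrable (fun z => ψ z * fderiv ℝ φ z v) := by
  have c1 : Continuous fun z => fderiv ℝ φ z v :=
    (contDiff_fderiv_apply hφ.1 v).continuous
  refine (hψ.mul c1).integrable_of_hasCompactSupport (HasCompactSupport.mul_left ?_)
  exact hφ.2.fderiv_apply ℝ v

theorem integral_mul_dz_test {φ ψ : ℂ → ℂ} (hφ : IsTest φ) (hψ : ContDiff ℝ 1 ψ) :
    ∫ z, ψ z * dz φ z = -∫ z, dz ψ z * φ z := by
  have e1 : ∀ z, ψ z * dz φ z = (1 / 2) * (ψ z * fderiv ℝ φ z 1) +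
      (-Complex.I / 2) * (ψ z * fderiv ℝ φ z Complex.I) := by intro z; unfold dz; ring
  have e2 : ∀ z, dz ψ z * φ z = (1 / 2) * (fderiv ℝ ψ z 1 * φ z) +
      (-Complex.I / 2) * (fderiv ℝ ψ z Complex.I * φ z) := by intro z; unfold dz; ring
  simp only [e1, e2]
  rw [integral_add, integral_add, integral_const_mul, integral_const_mul, integral_const_mul,
    integral_const_mul, integral_mul_fderiv_test hφ hψ, integral_mul_fderiv_test hφ hψ]
  · ring
  · exact (integrable_fderiv_mul_test hφ hψ _).const_mul _
  · exact (integrable_fderiv_mul_test hφ hψ _).const_mul _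
  · exact (integrable_mul_fderiv_test hφ hψ.continuous _).const_mul _
  · exact (integrable_mul_fderiv_test hφ hψ.continuous _).const_mul _

theorem integral_mul_dzbar_test {φ ψ : ℂ → ℂ} (hφ : IsTest φ) (hψ : ContDiff ℝ 1 ψ) :
    ∫ z, ψ z * dzbar φ z = -∫ z, dzbar ψ z * φ z := by
  have e1 : ∀ z, ψ z * dzbar φ z = (1 / 2) * (ψ z * fderiv ℝ φ z 1) +
      (Complex.I / 2) * (ψ z * fderiv ℝ φ z Complex.I) := by intro z; unfold dzbar; ring
  have e2 : ∀ z, dzbar ψ z * φ z = (1 / 2) * (fderiv ℝ ψ z 1 * φ z) +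
      (Complex.I / 2) * (fderiv ℝ ψ z Complex.I * φ z) := by intro z; unfold dzbar; ring
  simp only [e1, e2]
  rw [integral_add, integral_add, integral_const_mul, integral_const_mul, integral_const_mul,
    integral_const_mul, integral_mul_fderiv_test hφ hψ, integral_mul_fderiv_test hφ hψ]
  · ring
  · exact (integrable_fderiv_mul_test hφ hψ _).const_mul _
  · exact (integrable_fderiv_mul_test hφ hψ _).const_mul _
  · exact (integrable_mul_fderiv_test hφ hψ.continuous _).const_mul _
  · exact (integrable_mul_fderiv_test hφ hψ.continuous _).const_mul _

/-! ### Convolutions with test functions -/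

/-- The convolution of the kernel `k` and `φ`. -/
noncomputable def kconv (k φ : ℂ → ℂ) (z : ℂ) : ℂ := ∫ ξ, k ξ * φ (z - ξ)

theorem kconv_eq (k φ : ℂ → ℂ) (z : ℂ) : kconv k φ z = ∫ ξ, k (z - ξ) * φ ξ := by
  unfold kconv
  rw [← integral_sub_left_eq_self _ _ z]
  simp

theorem kconv_eq_convolution (k φ : ℂ → ℂ) :
    kconv k φ = convolution k φ (ContinuousLinearMap.mul ℝ ℂ) volume := rfl

theorem contDiff_kconv {k φ : ℂ → ℂ} (hk : LocallyIntegrable k) (hφ : IsTest φ) :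
    ContDiff ℝ ((⊤ : ℕ∞) : WithTop ℕ∞) (kconv k φ) :=
  hφ.2.contDiff_convolution_right (ContinuousLinearMap.mul ℝ ℂ) hk hφ.1

theorem fderiv_kconv {k φ : ℂ → ℂ} (hk : LocallyIntegrable k) (hφ : IsTest φ) (z v : ℂ) :
    fderiv ℝ (kconv k φ) z v = kconv k (fun ξ => fderiv ℝ φ ξ v) z := by
  have h := hφ.2.hasFDerivAt_convolution_right (ContinuousLinearMap.mul ℝ ℂ) hk
    (hφ.1.of_le (by simp)) z
  rw [kconv_eq_convolution, h.fderiv, kconv_eq_convolution]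
  exact convolution_precompR_apply _ hk (hφ.2.fderiv ℝ) (hφ.1.continuous_fderiv (by simp)) _ _

theorem integrable_kconv {k φ : ℂ → ℂ} (hk : LocallyIntegrable k) (hφ : Continuous φ)
    (hc : HasCompactSupport φ) (z : ℂ) : Integrable (fun ξ => k ξ * φ (z - ξ)) :=
  (hc.convolutionExists_right (ContinuousLinearMap.mul ℝ ℂ) hk hφ) z

theorem dz_kconv {k φ : ℂ → ℂ} (hk : LocallyIntegrable k) (hφ : IsTest φ) :
    dz (kconv k φ) = kconv k (dz φ) := by
  ext z
  have i (v : ℂ) := integrable_kconv hk (contDiff_fderiv_apply hφ.1 v).continuous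
    (hφ.2.fderiv_apply ℝ v) z
  have e : ∀ ξ, k ξ * dz φ (z - ξ) = (1 / 2) * (k ξ * fderiv ℝ φ (z - ξ) 1) +
      (-Complex.I / 2) * (k ξ * fderiv ℝ φ (z - ξ) Complex.I) := by intro z; unfold dz; ring
  rw [dz, fderiv_kconv hk hφ, fderiv_kconv hk hφ]
  simp only [kconv, e]
  rw [integral_add ((i _).const_mul _) ((i _).const_mul _), integral_const_mul, integral_const_mul]
  ring

theorem dzbar_kconv {k φ : ℂ → ℂ} (hk : LocallyIntegrable k) (hφ : IsTest φ) :
    dzbar (kconv k φ) = kconv k (dzbar φ) := by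
  ext z
  have i (v : ℂ) := integrable_kconv hk (contDiff_fderiv_apply hφ.1 v).continuous
    (hφ.2.fderiv_apply ℝ v) z
  have e : ∀ ξ, k ξ * dzbar φ (z - ξ) = (1 / 2) * (k ξ * fderiv ℝ φ (z - ξ) 1) +
      (Complex.I / 2) * (k ξ * fderiv ℝ φ (z - ξ) Complex.I) := by intro z; unfold dzbar; ring
  rw [dzbar, fderiv_kconv hk hφ, fderiv_kconv hk hφ]
  simp only [kconv, e]
  rw [integral_add ((i _).const_mul _) ((i _).const_mul _), integral_const_mul, integral_const_mul]
  ring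

theorem fderiv_comp_sub_left (φ : ℂ → ℂ) (z ξ v : ℂ) :
    fderiv ℝ (fun ξ => φ (z - ξ)) ξ v = - fderiv ℝ φ (z - ξ) v := by
  have h := (ContinuousLinearEquiv.neg ℝ (M := ℂ)).comp_right_fderiv (f := fun y => φ (z + y)) (x := ξ)
  rw [fderiv_comp_add_left] at h
  have e : (fun y => φ (z + y)) ∘ (ContinuousLinearEquiv.neg ℝ (M := ℂ)) = fun ξ => φ (z - ξ) := by
    ext y; simp [sub_eq_add_neg]
  rw [e] at h
  rw [h]; simp [sub_eq_add_neg]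

theorem dz_comp_sub_left (φ : ℂ → ℂ) (z ξ : ℂ) :
    dz (fun ξ => φ (z - ξ)) ξ = - dz φ (z - ξ) := by
  simp only [dz, fderiv_comp_sub_left]; ring

theorem dzbar_comp_sub_left (φ : ℂ → ℂ) (z ξ : ℂ) :
    dzbar (fun ξ => φ (z - ξ)) ξ = - dzbar φ (z - ξ) := by
  simp only [dzbar, fderiv_comp_sub_left]; ring

theorem kconv_dz {k φ : ℂ → ℂ} (hk : ContDiff ℝ 1 k) (hφ : IsTest φ) :
    kconv k (dz φ) = kconv (dz k) φ := by
  ext z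
  have := integral_mul_dz_test (hφ.comp_sub_left z) hk
  simp only [dz_comp_sub_left, mul_neg, integral_neg, neg_inj] at this
  exact this

theorem kconv_dzbar {k φ : ℂ → ℂ} (hk : ContDiff ℝ 1 k) (hφ : IsTest φ) :
    kconv k (dzbar φ) = kconv (dzbar k) φ := by
  ext z
  have := integral_mul_dzbar_test (hφ.comp_sub_left z) hk
  simp only [dzbar_comp_sub_left, mul_neg, integral_neg, neg_inj] at this
  exact this

end BukhgeimDisc


namespace BukhgeimDisc

/-! ### The regularized Cauchy kernel -/

/-- The regularized Cauchy kernel `conj z / (|z|² + ε²)`. -/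
noncomputable def regCauchy (ε : ℝ) (z : ℂ) : ℂ := conj z / ((‖z‖ ^ 2 + ε ^ 2 : ℝ) : ℂ)

/-- The kernel `ε² / (|z|² + ε²)²`, an approximate identity of mass `π`. -/
noncomputable def bump (ε : ℝ) (z : ℂ) : ℝ := ε ^ 2 / (‖z‖ ^ 2 + ε ^ 2) ^ 2

theorem bump_nonneg (ε : ℝ) (z : ℂ) : 0 ≤ bump ε z := by unfold bump; positivity

theorem regCauchy_den (ε : ℝ) (z : ℂ) :
    ((‖z‖ ^ 2 + ε ^ 2 : ℝ) : ℂ) = z * conj z + (ε : ℂ) ^ 2 := by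
  rw [Complex.mul_conj, Complex.normSq_eq_norm_sq]; push_cast; rfl

theorem regCauchy_den_ne {ε : ℝ} (hε : 0 < ε) (z : ℂ) : z * conj z + (ε : ℂ) ^ 2 ≠ 0 := by
  rw [← regCauchy_den]
  exact Complex.ofReal_ne_zero.2 (by positivity)

/-- These two derivatives are the reason for this regularization: `∂` reproduces minus the square of
the kernel, hence a smooth version of the Beurling kernel, while `∂̄` produces a positive function
of fixed mass `π`, convolution with which is harmless in every norm. -/
theorem hasWirtingerAt_regCauchy {ε : ℝ} (hε : 0 < ε) (z : ℂ) :
    HasWirtingerAt (regCauchy ε) (-(regCauchy ε z) ^ 2) (bump ε z) z := by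
  have hne := regCauchy_den_ne hε z
  have h1 : HasWirtingerAt (fun z => z * conj z + (ε : ℂ) ^ 2) (conj z) z z := by
    convert! ((HasWirtingerAt.id z).mul (HasWirtingerAt.conj_id z)).add
      (HasWirtingerAt.const ((ε : ℂ) ^ 2) z) using 1 <;> simp
  have h2 := HasWirtingerAt.comp_holo (f := fun z => z * conj z + (ε : ℂ) ^ 2) (hasDerivAt_inv hne) h1
  have h3 := (HasWirtingerAt.conj_id z).mul h2
  have e : regCauchy ε = fun z => conj z * (z * conj z + (ε : ℂ) ^ 2)⁻¹ := by
    ext w; rw [regCauchy, regCauchy_den, div_eq_mul_inv]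
  rw [e]
  convert! h3 using 1
  · field_simp; simp [neg_div]
  · unfold bump
    push_cast
    have := regCauchy_den ε z
    push_cast at this
    rw [this]
    field_simp; ring

theorem contDiff_regCauchy {ε : ℝ} (hε : 0 < ε) :
    ContDiff ℝ ((⊤ : ℕ∞) : WithTop ℕ∞) (regCauchy ε) := by
  have e : regCauchy ε = fun z => conj z / (z * conj z + (ε : ℂ) ^ 2) := by
    ext w; rw [regCauchy, regCauchy_den]
  rw [e]
  have hc : ContDiff ℝ ((⊤ : ℕ∞) : WithTop ℕ∞) (fun z : ℂ => conj z) :=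
    (Complex.conjCLE : ℂ →L[ℝ] ℂ).contDiff
  simp only [div_eq_mul_inv]
  exact hc.mul (((contDiff_id.mul hc).add contDiff_const).inv (regCauchy_den_ne hε))

theorem continuous_regCauchy {ε : ℝ} (hε : 0 < ε) : Continuous (regCauchy ε) :=
  (contDiff_regCauchy hε).continuous

theorem norm_regCauchy {ε : ℝ} (z : ℂ) : ‖regCauchy ε z‖ = ‖z‖ / (‖z‖ ^ 2 + ε ^ 2) := by
  rw [regCauchy, norm_div, Complex.norm_conj, Complex.norm_real, Real.norm_of_nonneg (by positivity)]

theorem norm_regCauchy_le {ε : ℝ} (z : ℂ) : ‖regCauchy ε z‖ ≤ ‖z‖⁻¹ := by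
  rw [norm_regCauchy]
  rcases eq_or_ne z 0 with rfl | h
  · simp
  · have h0 := norm_pos_iff.2 h
    rw [div_le_iff₀ (by positivity), inv_mul_eq_div, le_div_iff₀ h0]
    nlinarith [sq_nonneg ε]

theorem norm_regCauchy_le_inv {ε : ℝ} (hε : 0 < ε) (z : ℂ) : ‖regCauchy ε z‖ ≤ ε⁻¹ := by
  rw [norm_regCauchy, div_le_iff₀ (by positivity), inv_mul_eq_div, le_div_iff₀ hε]
  nlinarith [sq_nonneg (‖z‖ - ε), sq_nonneg ‖z‖]

/-- The bound is the one valid for `1/z`, with no loss in `ε`; this makes the Calderón–Zygmund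
constants uniform in `ε`. -/
theorem norm_regCauchy_sub_le {ε : ℝ} (hε : 0 < ε) {z w : ℂ} (hz : z ≠ 0) (hw : w ≠ 0) :
    ‖regCauchy ε z - regCauchy ε w‖ ≤ ‖z - w‖ / (‖z‖ * ‖w‖) := by
  have h1 := regCauchy_den_ne hε z
  have h2 := regCauchy_den_ne hε w
  have e : regCauchy ε z - regCauchy ε w =
      (conj z * conj w * (w - z) + (ε : ℂ) ^ 2 * conj (z - w)) /
        (((‖z‖ ^ 2 + ε ^ 2 : ℝ) : ℂ) * ((‖w‖ ^ 2 + ε ^ 2 : ℝ) : ℂ)) := by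
    rw [regCauchy, regCauchy, regCauchy_den, regCauchy_den, map_sub,
      div_sub_div _ _ h1 h2]
    congr 1; ring
  have hz0 := norm_pos_iff.2 hz
  have hw0 := norm_pos_iff.2 hw
  rw [e, norm_div, norm_mul, Complex.norm_real, Complex.norm_real, Real.norm_of_nonneg (by positivity),
    Real.norm_of_nonneg (by positivity)]
  have hnum : ‖conj z * conj w * (w - z) + (ε : ℂ) ^ 2 * conj (z - w)‖ ≤
      (‖z‖ * ‖w‖ + ε ^ 2) * ‖z - w‖ := by
    refine (norm_add_le _ _).trans (le_of_eq ?_)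
    simp only [norm_mul, Complex.norm_conj, norm_pow, Complex.norm_real, norm_sub_rev w z]
    rw [Real.norm_of_nonneg hε.le]
    ring
  rw [div_le_div_iff₀ (by positivity) (by positivity)]
  calc _ ≤ (‖z‖ * ‖w‖ + ε ^ 2) * ‖z - w‖ * (‖z‖ * ‖w‖) := by gcongr
    _ ≤ (‖z‖ * ‖w‖ + ε ^ 2) * ‖z - w‖ * (‖z‖ * ‖w‖ + ε ^ 2) := by
      gcongr; linarith [sq_nonneg ε]
    _ = ‖z - w‖ * (‖z‖ * ‖w‖ + ε ^ 2) ^ 2 := by ring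
    _ ≤ _ := by
      gcongr
      -- `(|z|²+ε²)(|w|²+ε²) - (|z||w|+ε²)² = ε²(|z|-|w|)²`.
      nlinarith [sq_nonneg (ε * (‖z‖ - ‖w‖))]

theorem tendsto_regCauchy (z : ℂ) : Tendsto (fun ε : ℝ => regCauchy ε z) (𝓝[>] 0) (𝓝 z⁻¹) := by
  rcases eq_or_ne z 0 with rfl | h
  · simp [regCauchy]
  · have h0 := norm_pos_iff.2 h
    have hc : ContinuousAt (fun ε : ℝ => regCauchy ε z) 0 := by
      unfold regCauchy
      apply ContinuousAt.div continuousAt_const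
      · fun_prop
      · exact Complex.ofReal_ne_zero.2 (by positivity)
    have : regCauchy 0 z = z⁻¹ := by
      rw [regCauchy, regCauchy_den]
      have : conj z ≠ 0 := by simpa using h
      field_simp
      simp
    rw [← this]
    exact hc.tendsto.mono_left nhdsWithin_le_nhds

theorem continuous_bump {ε : ℝ} (hε : 0 < ε) : Continuous (bump ε) := by
  unfold bump
  exact continuous_const.div (by fun_prop) (fun z => by positivity)

theorem lintegral_bump {ε : ℝ} (hε : 0 < ε) :
    ∫⁻ z, ENNReal.ofReal (bump ε z) = ENNReal.ofReal Real.pi := by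
  have hm : Measurable fun r : ℝ => ENNReal.ofReal (ε ^ 2 / (r ^ 2 + ε ^ 2) ^ 2) := by fun_prop
  have hd : ∀ x : ℝ, HasDerivAt (fun r : ℝ => -(ε ^ 2 / 2) * (r ^ 2 + ε ^ 2)⁻¹)
      (x * (ε ^ 2 / (x ^ 2 + ε ^ 2) ^ 2)) x := by
    intro x
    have h1 : HasDerivAt (fun r : ℝ => r ^ 2 + ε ^ 2) (2 * x) x := by
      simpa using (hasDerivAt_pow 2 x).add_const (ε ^ 2)
    have h2 := (h1.inv (by positivity)).const_mul (-(ε ^ 2 / 2))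
    convert! h2 using 1
    ring
  have ht : Tendsto (fun r : ℝ => -(ε ^ 2 / 2) * (r ^ 2 + ε ^ 2)⁻¹) atTop (𝓝 0) := by
    have h : Tendsto (fun r : ℝ => (r ^ 2 + ε ^ 2)⁻¹) atTop (𝓝 0) := by
      apply tendsto_inv_atTop_zero.comp
      exact tendsto_atTop_add_const_right _ _ (tendsto_pow_atTop two_ne_zero)
    simpa using h.const_mul (-(ε ^ 2 / 2))
  have hpos : ∀ x ∈ Ioi (0 : ℝ), 0 ≤ x * (ε ^ 2 / (x ^ 2 + ε ^ 2) ^ 2) := by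
    intro x hx
    have : 0 < x := hx
    positivity
  have hint := integrableOn_Ioi_deriv_of_nonneg' (fun x _ => hd x) hpos ht
  have hval := integral_Ioi_of_hasDerivAt_of_nonneg' (fun x _ => hd x) hpos ht
  have := lintegral_norm_eq_polar hm
  unfold bump
  rw [this]
  have e : ∫⁻ r in Ioi (0 : ℝ), ENNReal.ofReal r * ENNReal.ofReal (ε ^ 2 / (r ^ 2 + ε ^ 2) ^ 2) =
      ENNReal.ofReal (1 / 2) := by
    rw [setLIntegral_congr_fun measurableSet_Ioi (fun r hr => (ENNReal.ofReal_mul (le_of_lt hr)).symm),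
      ← ofReal_integral_eq_lintegral_ofReal hint, hval]
    · congr 1
      field_simp
      simp
    · exact (ae_restrict_mem measurableSet_Ioi).mono hpos
  rw [e, ← ENNReal.ofReal_mul (by positivity)]
  congr 1; ring

theorem integrable_bump {ε : ℝ} (hε : 0 < ε) : Integrable (bump ε) := by
  refine ⟨(continuous_bump hε).aestronglyMeasurable, ?_⟩
  rw [hasFiniteIntegral_iff_ofReal (Eventually.of_forall (bump_nonneg ε)), lintegral_bump hε]
  exact ENNReal.ofReal_lt_top

theorem integral_bump {ε : ℝ} (hε : 0 < ε) : ∫ z, bump ε z = Real.pi := by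
  rw [integral_eq_lintegral_of_nonneg_ae (Eventually.of_forall (bump_nonneg ε))
    (continuous_bump hε).aestronglyMeasurable, lintegral_bump hε, ENNReal.toReal_ofReal Real.pi_pos.le]

theorem bump_smul {ε : ℝ} (hε : 0 < ε) (z : ℂ) : bump ε (ε • z) = (ε ^ 2)⁻¹ * bump 1 z := by
  unfold bump
  rw [norm_smul, Real.norm_of_nonneg hε.le]
  field_simp

theorem locallyIntegrable_inv : LocallyIntegrable (fun z : ℂ => z⁻¹) := by
  rw [locallyIntegrable_iff]
  intro K hK
  obtain ⟨r, hr0, hr⟩ := hK.isBounded.subset_ball_lt 0 0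
  refine IntegrableOn.mono_set ⟨by fun_prop, ?_⟩ hr
  have h := lintegral_ball_rpow (s := 1) 0 (by norm_num) hr0
  rw [hasFiniteIntegral_iff_enorm]
  refine lt_of_le_of_lt (le_of_eq ?_) (h.trans_lt ENNReal.ofReal_lt_top)
  congr 1; ext ξ
  rw [zero_sub, norm_neg, Real.rpow_neg_one, ← norm_inv, ofReal_norm]

/-! ### The Cauchy transform in the plane -/

/-- The Cauchy transform in the plane. -/
noncomputable def planeCauchy (φ : ℂ → ℂ) (z : ℂ) : ℂ := (1 / Real.pi : ℂ) * kconv (fun z => z⁻¹) φ z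

theorem tendsto_kconv_regCauchy {φ : ℂ → ℂ} (hφ : IsTest φ) (z : ℂ) :
    Tendsto (fun ε => kconv (regCauchy ε) φ z) (𝓝[>] 0) (𝓝 (kconv (fun z => z⁻¹) φ z)) := by
  have hi := integrable_kconv locallyIntegrable_inv hφ.continuous hφ.2 z
  apply tendsto_integral_filter_of_dominated_convergence (fun ξ => ‖ξ⁻¹ * φ (z - ξ)‖) _ _ hi.norm
  · refine Eventually.of_forall fun ξ => ?_
    exact (tendsto_regCauchy ξ).mul_const _
  · filter_upwards [self_mem_nhdsWithin] with ε hε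
    have := hφ.continuous
    have := continuous_regCauchy hε
    exact Continuous.aestronglyMeasurable (by fun_prop)
  · filter_upwards with ε
    refine Eventually.of_forall fun ξ => ?_
    rw [norm_mul, norm_mul, norm_inv]
    gcongr
    exact norm_regCauchy_le ξ

theorem tendsto_kconv_bump {φ : ℂ → ℂ} (hφ : IsTest φ) (z : ℂ) :
    Tendsto (fun ε => kconv (fun z => (bump ε z : ℂ)) φ z) (𝓝[>] 0) (𝓝 (Real.pi * φ z)) := by
  have h1 : ∀ ε ∈ Ioi (0 : ℝ), kconv (fun z => (bump ε z : ℂ)) φ z = ∫ ξ, (bump 1 ξ : ℂ) * φ (z - ε • ξ) := by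
    intro ε hε
    have hε0 : (0 : ℝ) < ε := hε
    have h := Measure.integral_comp_smul volume (fun ξ : ℂ => (bump ε ξ : ℂ) * φ (z - ξ)) ε
    have e : ∀ ξ : ℂ, (bump ε (ε • ξ) : ℂ) * φ (z - ε • ξ) =
        ((ε ^ 2)⁻¹ : ℝ) • ((bump 1 ξ : ℂ) * φ (z - ε • ξ)) := by
      intro ξ
      rw [bump_smul hε0]; simp only [Complex.real_smul]; push_cast; ring
    simp only [e] at h
    rw [integral_smul, Complex.finrank_real_complex, abs_of_nonneg (by positivity)] at h
    exact (smul_right_injective ℂ (by positivity : (ε ^ 2)⁻¹ ≠ 0) h).symm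
  refine Tendsto.congr' (eventually_nhdsWithin_of_forall fun ε hε => (h1 ε hε).symm) ?_
  have h2 : (Real.pi * φ z : ℂ) = ∫ ξ, (bump 1 ξ : ℂ) * φ z := by
    rw [integral_mul_const, integral_complex_ofReal, integral_bump one_pos]
  rw [h2]
  obtain ⟨C, hC⟩ := hφ.exists_bound
  apply tendsto_integral_filter_of_dominated_convergence (fun ξ => bump 1 ξ * C)
  · filter_upwards with ε
    have := continuous_bump one_pos
    have := hφ.continuous
    exact Continuous.aestronglyMeasurable (by fun_prop)
  · filter_upwards with ε
    refine Eventually.of_forall fun ξ => ?_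
    rw [norm_mul, Complex.norm_real, Real.norm_of_nonneg (bump_nonneg _ _)]
    gcongr
    · exact bump_nonneg _ _
    · exact hC _
  · exact (integrable_bump one_pos).mul_const _
  · refine Eventually.of_forall fun ξ => Tendsto.const_mul _ ?_
    have : Continuous fun ε : ℝ => φ (z - ε • ξ) := by
      have := hφ.continuous; fun_prop
    have h := this.tendsto 0
    simp only [zero_smul, sub_zero] at h
    exact h.mono_left nhdsWithin_le_nhds

theorem kconv_regCauchy_dzbar {φ : ℂ → ℂ} (hφ : IsTest φ) {ε : ℝ} (hε : 0 < ε) :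
    kconv (regCauchy ε) (dzbar φ) = kconv (fun z => (bump ε z : ℂ)) φ := by
  rw [kconv_dzbar ((contDiff_regCauchy hε).of_le (by simp)) hφ]
  congr 1; ext z
  exact (hasWirtingerAt_regCauchy hε z).dzbar_eq

theorem kconv_regCauchy_dz {φ : ℂ → ℂ} (hφ : IsTest φ) {ε : ℝ} (hε : 0 < ε) :
    kconv (regCauchy ε) (dz φ) = kconv (fun z => -(regCauchy ε z) ^ 2) φ := by
  rw [kconv_dz ((contDiff_regCauchy hε).of_le (by simp)) hφ]
  congr 1; ext z
  exact (hasWirtingerAt_regCauchy hε z).dz_eq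

/-- The Cauchy–Pompeiu formula. For `ε > 0`, moving `∂̄` onto the regularized kernel turns it into
the approximate identity `bump ε`; then `ε` tends to `0` on both sides. -/
theorem planeCauchy_dzbar {φ : ℂ → ℂ} (hφ : IsTest φ) : planeCauchy (dzbar φ) = φ := by
  ext z
  have h1 := tendsto_kconv_regCauchy hφ.dzbar z
  have h2 := tendsto_kconv_bump hφ z
  have h3 : kconv (fun z => z⁻¹) (dzbar φ) z = Real.pi * φ z := by
    refine tendsto_nhds_unique h1 (h2.congr' ?_)
    filter_upwards [self_mem_nhdsWithin] with ε hε
    rw [kconv_regCauchy_dzbar hφ hε]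
  rw [planeCauchy, h3]
  have : (Real.pi : ℂ) ≠ 0 := Complex.ofReal_ne_zero.2 Real.pi_ne_zero
  field_simp

theorem contDiff_planeCauchy {φ : ℂ → ℂ} (hφ : IsTest φ) :
    ContDiff ℝ ((⊤ : ℕ∞) : WithTop ℕ∞) (planeCauchy φ) :=
  contDiff_const.mul (contDiff_kconv locallyIntegrable_inv hφ)

theorem fderiv_const_mul_apply {f : ℂ → ℂ} (c z v : ℂ) (hf : Differentiable ℝ f) :
    fderiv ℝ (fun z => c * f z) z v = c * fderiv ℝ f z v := by
  rw [fderiv_const_mul (hf z)]; simp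

theorem dz_planeCauchy {φ : ℂ → ℂ} (hφ : IsTest φ) : dz (planeCauchy φ) = planeCauchy (dz φ) := by
  have hd := (contDiff_kconv locallyIntegrable_inv hφ).differentiable (by simp)
  ext z
  rw [planeCauchy, ← dz_kconv locallyIntegrable_inv hφ]
  unfold dz planeCauchy
  rw [fderiv_const_mul_apply _ _ _ hd, fderiv_const_mul_apply _ _ _ hd]
  ring

theorem dzbar_planeCauchy {φ : ℂ → ℂ} (hφ : IsTest φ) : dzbar (planeCauchy φ) = φ := by
  have hd := (contDiff_kconv locallyIntegrable_inv hφ).differentiable (by simp)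
  rw [← planeCauchy_dzbar hφ]
  -- The preceding rewriting expands both occurrences of `φ`. The one under the derivative is folded
  -- back, so that it remains to commute `∂̄` with the transform.
  nth_rw 1 [planeCauchy_dzbar hφ]
  ext z
  rw [planeCauchy, ← dzbar_kconv locallyIntegrable_inv hφ]
  unfold dzbar planeCauchy
  rw [fderiv_const_mul_apply _ _ _ hd, fderiv_const_mul_apply _ _ _ hd]
  ring

end BukhgeimDisc


namespace BukhgeimDisc

/-! ### The `L²` bound for the regularized Beurling transform -/

theorem dz_dzbar_comm {f : ℂ → ℂ} (hf : ContDiff ℝ ((⊤ : ℕ∞) : WithTop ℕ∞) f) :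
    dz (dzbar f) = dzbar (dz f) := by
  have h2 : (2 : WithTop ℕ∞) ≤ ((⊤ : ℕ∞) : WithTop ℕ∞) :=
    WithTop.coe_le_coe.2 (le_top : (2 : ℕ∞) ≤ ⊤)
  ext z
  have hd : DifferentiableAt ℝ (fderiv ℝ f) z :=
    ((hf.fderiv_right (m := 1) (by simpa [one_add_one_eq_two] using h2)).differentiable one_ne_zero) z
  have hs : IsSymmSndFDerivAt ℝ f z := hf.contDiffAt.isSymmSndFDerivAt (by
    rw [minSmoothness_of_isRCLikeNormedField]; exact h2)
  have e : ∀ v w : ℂ, fderiv ℝ (fun z => fderiv ℝ f z v) z w = fderiv ℝ (fderiv ℝ f) z w v := by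
    intro v w
    rw [fderiv_clm_apply hd (differentiableAt_const v)]
    simp
  have d1 : ∀ v : ℂ, DifferentiableAt ℝ (fun z => fderiv ℝ f z v) z := fun v =>
    hd.clm_apply (differentiableAt_const v)
  have ez : ∀ w, fderiv ℝ (dz f) z w = (fderiv ℝ (fderiv ℝ f) z w 1 - Complex.I * fderiv ℝ (fderiv ℝ f) z w Complex.I) / 2 := by
    intro w
    have : dz f = fun z => (1 / 2 : ℂ) * (fderiv ℝ f z 1 - Complex.I * fderiv ℝ f z Complex.I) := by
      ext; unfold dz; ring
    rw [this, fderiv_const_mul (by have := d1 1; have := d1 Complex.I; fun_prop),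
      fderiv_fun_sub (d1 1) ((d1 _).const_mul _), fderiv_const_mul (d1 _)]
    simp [e]; ring
  have ezb : ∀ w, fderiv ℝ (dzbar f) z w = (fderiv ℝ (fderiv ℝ f) z w 1 + Complex.I * fderiv ℝ (fderiv ℝ f) z w Complex.I) / 2 := by
    intro w
    have : dzbar f = fun z => (1 / 2 : ℂ) * (fderiv ℝ f z 1 + Complex.I * fderiv ℝ f z Complex.I) := by
      ext; unfold dzbar; ring
    rw [this, fderiv_const_mul (by have := d1 1; have := d1 Complex.I; fun_prop),
      fderiv_fun_add (d1 1) ((d1 _).const_mul _), fderiv_const_mul (d1 _)]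
    simp [e]; ring
  rw [dz, dzbar, ez, ez, ezb, ezb, hs.eq 1 Complex.I]
  ring

theorem dz_conj {f : ℂ → ℂ} (hf : Differentiable ℝ f) (z : ℂ) :
    dz (fun z => conj (f z)) z = conj (dzbar f z) :=
  ((HasWirtingerAt.of_differentiableAt (hf z)).conj_comp).dz_eq

theorem dzbar_conj {f : ℂ → ℂ} (hf : Differentiable ℝ f) (z : ℂ) :
    dzbar (fun z => conj (f z)) z = conj (dz f z) :=
  ((HasWirtingerAt.of_differentiableAt (hf z)).conj_comp).dzbar_eq

theorem IsTest.conj_comp {φ : ℂ → ℂ} (hφ : IsTest φ) : IsTest (fun z => conj (φ z)) :=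
  ⟨(Complex.conjCLE : ℂ →L[ℝ] ℂ).contDiff.comp hφ.1, hφ.2.comp_left (g := conj) (map_zero _)⟩

theorem eLpNorm_two_eq {f g : ℂ → ℂ} (hf : MemLp f 2) (hg : MemLp g 2)
    (h : ∫ z, f z * conj (f z) = ∫ z, g z * conj (g z)) : eLpNorm f 2 = eLpNorm g 2 := by
  have key : ∀ {f : ℂ → ℂ}, MemLp f 2 → eLpNorm f 2 ^ 2 = ENNReal.ofReal (∫ z, f z * conj (f z)).re := by
    intro f hf
    have h1 : ∀ z, f z * conj (f z) = ((‖f z‖ ^ 2 : ℝ) : ℂ) := by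
      intro z; rw [Complex.mul_conj, Complex.normSq_eq_norm_sq]
    simp only [h1]
    rw [integral_complex_ofReal, Complex.ofReal_re, ofReal_integral_eq_lintegral_ofReal]
    · rw [eLpNorm_eq_lintegral_rpow_enorm_toReal (by simp) (by simp), ← ENNReal.rpow_natCast,
        ← ENNReal.rpow_mul]
      simp only [ENNReal.toReal_ofNat]
      norm_num
    · exact (memLp_two_iff_integrable_sq_norm hf.1).1 hf
    · exact Eventually.of_forall fun z => by positivity
  have := (key hf).trans ((congrArg (fun z : ℂ => ENNReal.ofReal z.re) h).trans (key hg).symm)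
  exact (ENNReal.pow_right_strictMono two_ne_zero).injective this

/-- One integration by parts turns both squared norms into minus the integral of `∂∂̄φ` times `conj
φ`. This replaces Plancherel as the source of the `L²` bound. -/
theorem eLpNorm_dz_eq {φ : ℂ → ℂ} (hφ : IsTest φ) : eLpNorm (dz φ) 2 = eLpNorm (dzbar φ) 2 := by
  apply eLpNorm_two_eq (hφ.dz.memLp 2) (hφ.dzbar.memLp 2)
  have h1 := integral_mul_dzbar_test hφ.conj_comp (hφ.dz.1.of_le (by simp) : ContDiff ℝ 1 (dz φ))
  have h2 := integral_mul_dz_test hφ.conj_comp (hφ.dzbar.1.of_le (by simp) : ContDiff ℝ 1 (dzbar φ))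
  simp only [dzbar_conj hφ.differentiable] at h1
  simp only [dz_conj hφ.differentiable] at h2
  rw [h1, h2, dz_dzbar_comm hφ.1]

/-- Cauchy–Schwarz with respect to the probability density `b(z-·)` moves the square inside the
integral; Tonelli and translation invariance finish. -/
theorem lintegral_young {b g : ℂ → ℝ≥0∞} (hb : Measurable b) (hg : Measurable g) (h1 : ∫⁻ z, b z = 1) :
    ∫⁻ z, (∫⁻ ξ, b (z - ξ) * g ξ) ^ (2 : ℝ) ≤ ∫⁻ ξ, g ξ ^ (2 : ℝ) := by
  have step : ∀ z, (∫⁻ ξ, b (z - ξ) * g ξ) ^ (2 : ℝ) ≤ ∫⁻ ξ, b (z - ξ) * g ξ ^ (2 : ℝ) := by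
    intro z
    have hbz : ∫⁻ ξ, b (z - ξ) = 1 := by rw [lintegral_sub_left_eq_self b z, h1]
    have h := ENNReal.lintegral_mul_le_Lp_mul_Lq volume Real.HolderConjugate.two_two
      (f := fun ξ => b (z - ξ) ^ (1 / 2 : ℝ)) (g := fun ξ => b (z - ξ) ^ (1 / 2 : ℝ) * g ξ)
      (by fun_prop) (by fun_prop)
    have e1 : ∀ x : ℝ≥0∞, x ^ (1 / 2 : ℝ) * x ^ (1 / 2 : ℝ) = x := by
      intro x
      rw [← ENNReal.rpow_add_of_nonneg _ _ (by norm_num) (by norm_num)]; norm_num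
    have e2 : ∀ x : ℝ≥0∞, (x ^ (1 / 2 : ℝ)) ^ (2 : ℝ) = x := by
      intro x; rw [← ENNReal.rpow_mul]; norm_num
    simp only [Pi.mul_apply, ← mul_assoc, e1, e2, hbz, ENNReal.one_rpow, one_mul,
      ENNReal.mul_rpow_of_nonneg _ _ (by norm_num : (0 : ℝ) ≤ 2)] at h
    calc _ ≤ ((∫⁻ ξ, b (z - ξ) * g ξ ^ (2 : ℝ)) ^ (1 / 2 : ℝ)) ^ (2 : ℝ) := by gcongr
      _ = _ := e2 _
  calc _ ≤ ∫⁻ z, ∫⁻ ξ, b (z - ξ) * g ξ ^ (2 : ℝ) := lintegral_mono step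
    _ = ∫⁻ ξ, ∫⁻ z, b (z - ξ) * g ξ ^ (2 : ℝ) := lintegral_lintegral_swap (by fun_prop)
    _ = _ := by
      congr 1; ext ξ
      rw [lintegral_mul_const _ (by fun_prop), lintegral_sub_right_eq_self b ξ, h1, one_mul]

/-- A smooth cutoff function with values in `[0, 1]`, equal to `1` on the unit ball and vanishing
off the ball of radius `2`. -/
theorem exists_cutoff : ∃ χ : ℂ → ℝ, ContDiff ℝ ((⊤ : ℕ∞) : WithTop ℕ∞) χ ∧ (∀ z, 0 ≤ χ z ∧ χ z ≤ 1) ∧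
    (∀ z, ‖z‖ ≤ 1 → χ z = 1) ∧ ∀ z, 2 ≤ ‖z‖ → χ z = 0 := by
  let χ : ContDiffBump (0 : ℂ) := ⟨1, 2, one_pos, one_lt_two⟩
  refine ⟨χ, χ.contDiff, fun z => ⟨χ.nonneg, χ.le_one⟩, fun z hz => ?_, fun z hz => ?_⟩
  · exact χ.one_of_mem_closedBall (by simpa [χ] using hz)
  · exact χ.zero_of_le_dist (by simpa [χ] using hz)

end BukhgeimDisc


/-! ### Comparison of `∂F` and `∂̄F` in `L²` for functions decaying at infinity. -/

namespace BukhgeimDisc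

theorem HasWirtingerAt.comp_mul_real {f : ℂ → ℂ} {a b z : ℂ} (c : ℝ) (hf : HasWirtingerAt f a b (c * z)) :
    HasWirtingerAt (fun z => f (c * z)) (c * a) (c * b) z := by
  have h : HasFDerivAt (fun z : ℂ => (c : ℂ) * z) ((c : ℂ) • (1 : ℂ →L[ℝ] ℂ)) z :=
    (hasFDerivAt_id z).const_mul (c : ℂ)
  unfold HasWirtingerAt at *
  convert! HasFDerivAt.comp z hf h using 1
  ext v; simp; ring

theorem eLpNorm_le_of_bound_ball {g : ℂ → ℂ} {c r : ℝ} (hc : 0 ≤ c) (hr : 0 ≤ r)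
    (h : ∀ z, ‖g z‖ ≤ c) (h0 : ∀ z, r < ‖z‖ → g z = 0) :
    eLpNorm g 2 ≤ ENNReal.ofReal (c * (2 * r)) := by
  have h1 : ∀ z, ‖g z‖ ≤ ‖(Metric.closedBall (0 : ℂ) r).indicator (fun _ => c) z‖ := by
    intro z
    by_cases hz : ‖z‖ ≤ r
    · rw [indicator_of_mem (by simpa using hz), Real.norm_of_nonneg hc]; exact h z
    · rw [h0 z (not_le.1 hz)]; simp
  refine (eLpNorm_mono h1).trans ?_
  rw [eLpNorm_indicator_const Metric.isClosed_closedBall.measurableSet two_ne_zero (by simp)]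
  rw [Complex.volume_closedBall, ENNReal.mul_rpow_of_nonneg _ _ (by simp), ← ENNReal.rpow_natCast,
    ← ENNReal.rpow_mul, ENNReal.ofReal_mul hc, Real.enorm_of_nonneg hc, mul_comm 2 r,
    ENNReal.ofReal_mul hr]
  simp only [ENNReal.toReal_ofNat, Nat.cast_ofNat]
  norm_num
  gcongr
  calc (NNReal.pi : ℝ≥0∞) ^ (1 / 2 : ℝ) ≤ (4 : ℝ≥0∞) ^ (1 / 2 : ℝ) := by
        gcongr
        rw [show (4 : ℝ≥0∞) = ((4 : ℝ≥0) : ℝ≥0∞) by norm_num]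
        exact ENNReal.coe_le_coe.2 Real.pi_le_four
    _ = 2 := by
        rw [show (4 : ℝ≥0∞) = 2 ^ (2 : ℝ) by norm_num, ← ENNReal.rpow_mul]; norm_num

theorem dz_eq_zero_of_eventually_const {f : ℂ → ℂ} {z c : ℂ} (h : ∀ᶠ w in 𝓝 z, f w = c) :
    dz f z = 0 ∧ dzbar f z = 0 := by
  have : fderiv ℝ f z = 0 := by
    rw [(show f =ᶠ[𝓝 z] fun _ => c from h).fderiv_eq]; simp
  simp [dz, dzbar, this]

/-- Cutoff functions with derivatives that are `O(1/R)`. -/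
theorem exists_cutoff_family : ∃ C : ℝ, 0 ≤ C ∧ ∀ R : ℝ, 0 < R → ∃ χ : ℂ → ℂ, IsTest χ ∧
    (∀ z, ‖χ z‖ ≤ 1) ∧ (∀ z, ‖z‖ ≤ R → χ z = 1) ∧
    (∀ z, ‖dz χ z‖ ≤ C / R ∧ ‖dzbar χ z‖ ≤ C / R) ∧
    ∀ z, (‖z‖ < R ∨ 2 * R < ‖z‖) → dz χ z = 0 ∧ dzbar χ z = 0 := by
  obtain ⟨χ, hs, h01, hone, hzero⟩ := exists_cutoff
  have ht : IsTest (fun z => (χ z : ℂ)) := by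
    refine ⟨Complex.ofRealCLM.contDiff.comp hs, ?_⟩
    refine HasCompactSupport.of_support_subset_isCompact (isCompact_closedBall (0 : ℂ) 2) ?_
    intro z hz
    by_contra h
    rw [mem_closedBall_zero_iff, not_le] at h
    exact hz (by simp [hzero z h.le])
  obtain ⟨C1, hC1⟩ := ht.dz.exists_bound
  obtain ⟨C2, hC2⟩ := ht.dzbar.exists_bound
  have hC10 : 0 ≤ C1 := (norm_nonneg _).trans (hC1 0)
  refine ⟨max C1 C2, hC10.trans (le_max_left _ _), fun R hR => ?_⟩
  have hn : ∀ z : ℂ, ‖((R⁻¹ : ℝ) : ℂ) * z‖ = ‖z‖ / R := by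
    intro z; rw [norm_mul, Complex.norm_real, Real.norm_of_nonneg (by positivity)]; field_simp
  have hw : ∀ z, HasWirtingerAt (fun z => (χ (((R⁻¹ : ℝ) : ℂ) * z) : ℂ)) _ _ z := fun z =>
    (HasWirtingerAt.of_differentiableAt (ht.differentiable (((R⁻¹ : ℝ) : ℂ) * z))).comp_mul_real R⁻¹
  refine ⟨fun z => (χ (((R⁻¹ : ℝ) : ℂ) * z) : ℂ), ⟨?_, ?_⟩, ?_, ?_, ?_, ?_⟩
  · exact ht.1.comp (contDiff_const.mul contDiff_id)
  · refine HasCompactSupport.of_support_subset_isCompact (isCompact_closedBall (0 : ℂ) (2 * R)) ?_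
    intro z hz
    by_contra h
    rw [mem_closedBall_zero_iff, not_le] at h
    refine hz ?_
    have : χ (((R⁻¹ : ℝ) : ℂ) * z) = 0 := hzero _ (by rw [hn, le_div_iff₀ hR]; exact h.le)
    exact congrArg Complex.ofReal this
  · intro z
    rw [Complex.norm_real, Real.norm_of_nonneg (h01 _).1]
    exact (h01 _).2
  · intro z hz
    exact congrArg Complex.ofReal (hone _ (by rw [hn, div_le_one hR]; exact hz))
  · intro z
    rw [(hw z).dz_eq, (hw z).dzbar_eq, norm_mul, norm_mul, Complex.norm_real,
      Real.norm_of_nonneg (by positivity), div_eq_inv_mul]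
    constructor
    · gcongr; exact (hC1 _).trans (le_max_left _ _)
    · gcongr; exact (hC2 _).trans (le_max_right _ _)
  · rintro z (hz | hz)
    · apply dz_eq_zero_of_eventually_const (c := 1)
      have : Metric.ball (0 : ℂ) R ∈ 𝓝 z := Metric.isOpen_ball.mem_nhds (by simpa using hz)
      filter_upwards [this] with w hw
      rw [hone _ (by rw [hn, div_le_one hR]; exact (mem_ball_zero_iff.1 hw).le)]; simp
    · apply dz_eq_zero_of_eventually_const (c := 0)
      have : {w : ℂ | 2 * R < ‖w‖} ∈ 𝓝 z :=
        (isOpen_lt continuous_const continuous_norm).mem_nhds hz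
      filter_upwards [this] with w hw
      rw [hzero _ (by rw [hn, le_div_iff₀ hR]; exact le_of_lt hw)]; simp

/-- Convolutions with the Cauchy kernel decay only like `1/|z|`, so they are cut off at radius `R`.
The error, a derivative of the cutoff times `F`, is `O(R⁻²)` on a region of area `O(R²)`, hence
`O(1/R)` in `L²`. Fatou's lemma gives the limit. -/
theorem eLpNorm_dz_le_of_decay {F : ℂ → ℂ} (hF : ContDiff ℝ ((⊤ : ℕ∞) : WithTop ℕ∞) F) {C ρ : ℝ}
    (hd : ∀ z, ρ ≤ ‖z‖ → ‖F z‖ ≤ C / ‖z‖) : eLpNorm (dz F) 2 ≤ eLpNorm (dzbar F) 2 := by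
  obtain ⟨C0, hC0, hχ⟩ := exists_cutoff_family
  have hFd : Differentiable ℝ F := hF.differentiable (by simp)
  choose χ hχt hχ1 hχ2 hχ3 hχ4 using fun n : ℕ => hχ ((n : ℝ) + 1) (by positivity)
  have hlim : ∀ z, Tendsto (fun n : ℕ => χ n z * dz F z) atTop (𝓝 (dz F z)) := by
    intro z
    obtain ⟨N, hN⟩ := exists_nat_ge ‖z‖
    refine tendsto_const_nhds.congr' ?_
    filter_upwards [eventually_ge_atTop N] with n hn
    have : (N : ℝ) ≤ n := by exact_mod_cast hn
    rw [hχ2 n z (by linarith), one_mul]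
  have hcont : ∀ n, Continuous fun z => χ n z * dz F z := fun n =>
    (hχt n).continuous.mul (contDiff_dz hF).continuous
  refine (Lp.eLpNorm_lim_le_liminf_eLpNorm (fun n => (hcont n).aestronglyMeasurable) _
    (Eventually.of_forall hlim)).trans ?_
  have hbound : ∀ᶠ n : ℕ in atTop, eLpNorm (fun z => χ n z * dz F z) 2 volume ≤
      eLpNorm (dzbar F) 2 volume + ENNReal.ofReal (8 * |C| * C0 * ((n : ℝ) + 1)⁻¹) := by
    obtain ⟨N, hN⟩ := exists_nat_ge ρ
    filter_upwards [eventually_ge_atTop N] with n hn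
    have hnN : (N : ℝ) ≤ n := by exact_mod_cast hn
    set R := (n : ℝ) + 1 with hR
    have hR0 : 0 < R := by positivity
    have hFR : ∀ z, R ≤ ‖z‖ → ‖F z‖ ≤ |C| / R := by
      intro z hz
      refine (hd z (by linarith)).trans ?_
      gcongr
      exact le_abs_self C
    have hw : ∀ z, HasWirtingerAt (fun z => χ n z * F z) _ _ z := fun z =>
      (HasWirtingerAt.of_differentiableAt ((hχt n).differentiable z)).mul
        (HasWirtingerAt.of_differentiableAt (hFd z))
    have herr : ∀ D : ℂ → ℂ, (∀ z, ‖D z‖ ≤ C0 / R) → (∀ z, (‖z‖ < R ∨ 2 * R < ‖z‖) → D z = 0) →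
        eLpNorm (fun z => D z * F z) 2 volume ≤ ENNReal.ofReal (4 * |C| * C0 * R⁻¹) := by
      intro D hD1 hD2
      refine (eLpNorm_le_of_bound_ball (c := C0 / R * (|C| / R)) (r := 2 * R) (by positivity) (by positivity) ?_ ?_).trans_eq ?_
      · intro z
        rcases lt_or_ge ‖z‖ R with h | h
        · rw [hD2 z (Or.inl h)]; simp; positivity
        · rw [norm_mul]
          have := hFR z h
          have := hD1 z
          gcongr
      · intro z hz
        rw [hD2 z (Or.inr hz), zero_mul]
      · congr 1; field_simp; ring
    have ht : IsTest (fun z => χ n z * F z) := by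
      have := (hχt n).mul_left hF
      simpa only [mul_comm] using this
    have e1 : (fun z => χ n z * dz F z) = dz (fun z => χ n z * F z) - fun z => dz (χ n) z * F z := by
      ext z; rw [Pi.sub_apply, (hw z).dz_eq]; ring
    have e2 : dzbar (fun z => χ n z * F z) = (fun z => χ n z * dzbar F z) + fun z => dzbar (χ n) z * F z := by
      ext z; rw [Pi.add_apply, (hw z).dzbar_eq]; ring
    have m1 : AEStronglyMeasurable (fun z => dz (χ n) z * F z) :=
      ((contDiff_dz (hχt n).1).continuous.mul hF.continuous).aestronglyMeasurable
    have m2 : AEStronglyMeasurable (fun z => dzbar (χ n) z * F z) :=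
      ((contDiff_dzbar (hχt n).1).continuous.mul hF.continuous).aestronglyMeasurable
    have m3 : AEStronglyMeasurable (fun z => χ n z * dzbar F z) :=
      ((hχt n).continuous.mul (contDiff_dzbar hF).continuous).aestronglyMeasurable
    have b1 := herr (dz (χ n)) (fun z => (hχ3 n z).1) (fun z hz => (hχ4 n z hz).1)
    have b2 := herr (dzbar (χ n)) (fun z => (hχ3 n z).2) (fun z hz => (hχ4 n z hz).2)
    have b3 : eLpNorm (fun z => χ n z * dzbar F z) 2 volume ≤ eLpNorm (dzbar F) 2 volume := by
      apply eLpNorm_mono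
      intro z
      rw [norm_mul]
      exact mul_le_of_le_one_left (norm_nonneg _) (hχ1 n z)
    calc _ ≤ eLpNorm (dz (fun z => χ n z * F z)) 2 volume + eLpNorm (fun z => dz (χ n) z * F z) 2 volume := by
          rw [e1]
          exact eLpNorm_sub_le ht.dz.continuous.aestronglyMeasurable m1 one_le_two
      _ ≤ (eLpNorm (dzbar F) 2 volume + ENNReal.ofReal (4 * |C| * C0 * R⁻¹)) +
          ENNReal.ofReal (4 * |C| * C0 * R⁻¹) := by
          rw [eLpNorm_dz_eq ht, e2]
          gcongr
          exact (eLpNorm_add_le m3 m2 one_le_two).trans (by gcongr)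
      _ = _ := by
          rw [add_assoc, ← ENNReal.ofReal_add (by positivity) (by positivity)]
          ring_nf
  refine (liminf_le_liminf hbound).trans_eq ?_
  apply Tendsto.liminf_eq
  have : Tendsto (fun n : ℕ => ENNReal.ofReal (8 * |C| * C0 * ((n : ℝ) + 1)⁻¹)) atTop (𝓝 0) := by
    rw [← ENNReal.ofReal_zero]
    apply ENNReal.tendsto_ofReal
    have := (tendsto_one_div_add_atTop_nhds_zero_nat (𝕜 := ℝ)).const_mul (8 * |C| * C0)
    simpa [one_div] using this
  simpa using this.const_add (eLpNorm (dzbar F) 2 volume)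

end BukhgeimDisc


namespace BukhgeimDisc

/-! ### The regularized Beurling transform -/

/-- The regularized Beurling kernel. -/
noncomputable def beurlingKer (ε : ℝ) (z : ℂ) : ℂ := -(1 / Real.pi : ℂ) * regCauchy ε z ^ 2

/-- The regularized Beurling transform in the plane. -/
noncomputable def regBeurling (ε : ℝ) (f : ℂ → ℂ) (z : ℂ) : ℂ := ∫ ξ, beurlingKer ε (z - ξ) * f ξ

theorem norm_one_div_pi_le : ‖(1 / Real.pi : ℂ)‖ ≤ 1 := by
  rw [norm_div, norm_one, Complex.norm_real, Real.norm_of_nonneg Real.pi_pos.le, div_le_one Real.pi_pos]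
  linarith [Real.pi_gt_three]

theorem norm_beurlingKer_le_sq (ε : ℝ) (z : ℂ) : ‖beurlingKer ε z‖ ≤ ‖regCauchy ε z‖ ^ 2 := by
  rw [beurlingKer, norm_mul, norm_neg, norm_pow]
  exact mul_le_of_le_one_left (by positivity) norm_one_div_pi_le

theorem norm_beurlingKer_le {ε : ℝ} (hε : 0 < ε) (z : ℂ) : ‖beurlingKer ε z‖ ≤ ε⁻¹ ^ 2 := by
  refine (norm_beurlingKer_le_sq ε z).trans ?_
  gcongr
  exact norm_regCauchy_le_inv hε z

theorem continuous_beurlingKer {ε : ℝ} (hε : 0 < ε) : Continuous (beurlingKer ε) := by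
  have := continuous_regCauchy hε
  unfold beurlingKer
  fun_prop

theorem beurlingKer_neg (ε : ℝ) (z : ℂ) : beurlingKer ε (-z) = beurlingKer ε z := by
  simp [beurlingKer, regCauchy, neg_div]

/-- Hörmander's smoothness condition, uniformly in `ε`: the difference of squares factors, and
`1/|a| ≤ 2/|b|` gives the constant `6 = 2·(2+1)`. -/
theorem norm_beurlingKer_sub_le {ε : ℝ} (hε : 0 < ε) {a b : ℂ} (hb : b ≠ 0) (hab : ‖b‖ / 2 ≤ ‖a‖) :
    ‖beurlingKer ε a - beurlingKer ε b‖ ≤ 6 * ‖a - b‖ / ‖b‖ ^ 3 := by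
  have hb0 := norm_pos_iff.2 hb
  have ha0 : 0 < ‖a‖ := by linarith
  have ha : a ≠ 0 := norm_pos_iff.1 ha0
  have e : beurlingKer ε a - beurlingKer ε b =
      -(1 / Real.pi : ℂ) * ((regCauchy ε a - regCauchy ε b) * (regCauchy ε a + regCauchy ε b)) := by
    unfold beurlingKer; ring
  have h1 : ‖a‖⁻¹ ≤ 2 * ‖b‖⁻¹ := by
    rw [inv_le_comm₀ ha0 (by positivity), mul_inv, inv_inv]; linarith
  rw [e, norm_mul, norm_neg, norm_mul]
  calc _ ≤ 1 * (‖a - b‖ / (‖a‖ * ‖b‖) * (‖a‖⁻¹ + ‖b‖⁻¹)) := by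
        gcongr
        · exact norm_one_div_pi_le
        · exact norm_regCauchy_sub_le hε ha hb
        · exact (norm_add_le _ _).trans (add_le_add (norm_regCauchy_le a) (norm_regCauchy_le b))
    _ = ‖a - b‖ * ‖a‖⁻¹ * ‖b‖⁻¹ * (‖a‖⁻¹ + ‖b‖⁻¹) := by
        rw [one_mul, div_eq_mul_inv, mul_inv]; ring
    _ ≤ ‖a - b‖ * (2 * ‖b‖⁻¹) * ‖b‖⁻¹ * (2 * ‖b‖⁻¹ + ‖b‖⁻¹) := by gcongr
    _ = _ := by field_simp; ring

theorem memLp_two_beurlingKer {ε : ℝ} (hε : 0 < ε) : MemLp (beurlingKer ε) 2 := by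
  rw [memLp_two_iff_integrable_sq_norm (continuous_beurlingKer hε).aestronglyMeasurable]
  refine ((integrable_bump hε).mul_const ((ε ^ 2)⁻¹)).mono'
    ((continuous_beurlingKer hε).norm.pow 2).aestronglyMeasurable (Eventually.of_forall fun z => ?_)
  rw [Real.norm_of_nonneg (by positivity)]
  calc _ ≤ (‖regCauchy ε z‖ ^ 2) ^ 2 := by gcongr; exact norm_beurlingKer_le_sq ε z
    _ = (‖z‖ ^ 2) ^ 2 / (‖z‖ ^ 2 + ε ^ 2) ^ 4 := by rw [norm_regCauchy]; field_simp
    _ ≤ (‖z‖ ^ 2 + ε ^ 2) ^ 2 / (‖z‖ ^ 2 + ε ^ 2) ^ 4 := by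
        gcongr; linarith [sq_nonneg ε]
    _ = _ := by unfold bump; field_simp

theorem memLp_two_beurlingKer_sub {ε : ℝ} (hε : 0 < ε) (z : ℂ) :
    MemLp (fun ξ => beurlingKer ε (z - ξ)) 2 :=
  (memLp_two_beurlingKer hε).comp_measurePreserving (Measure.measurePreserving_sub_left volume z)

theorem integrable_regBeurling_two {ε : ℝ} (hε : 0 < ε) {f : ℂ → ℂ} (hf : MemLp f 2) (z : ℂ) :
    Integrable (fun ξ => beurlingKer ε (z - ξ) * f ξ) :=
  (memLp_two_beurlingKer_sub hε z).integrable_mul hf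

theorem integrable_regBeurling {ε : ℝ} (hε : 0 < ε) {f : ℂ → ℂ} (hf : Integrable f) (z : ℂ) :
    Integrable (fun ξ => beurlingKer ε (z - ξ) * f ξ) := by
  have := continuous_beurlingKer hε
  exact hf.bdd_mul (c := ε⁻¹ ^ 2) (Continuous.aestronglyMeasurable (by fun_prop))
    (Eventually.of_forall fun ξ => norm_beurlingKer_le hε _)

theorem regBeurling_add {ε : ℝ} (hε : 0 < ε) {f g : ℂ → ℂ} (hf : Integrable f) (hg : Integrable g) (z : ℂ) :
    regBeurling ε (fun ξ => f ξ + g ξ) z = regBeurling ε f z + regBeurling ε g z := by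
  unfold regBeurling
  rw [← integral_add (integrable_regBeurling hε hf z) (integrable_regBeurling hε hg z)]
  simp only [mul_add]

theorem regBeurling_sub {ε : ℝ} (hε : 0 < ε) {f g : ℂ → ℂ} (hf : Integrable f) (hg : Integrable g) (z : ℂ) :
    regBeurling ε (fun ξ => f ξ - g ξ) z = regBeurling ε f z - regBeurling ε g z := by
  unfold regBeurling
  rw [← integral_sub (integrable_regBeurling hε hf z) (integrable_regBeurling hε hg z)]
  simp only [mul_sub]

theorem regBeurling_eq_kconv {ε : ℝ} {φ : ℂ → ℂ} (hφ : IsTest φ) (hε : 0 < ε) (z : ℂ) :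
    regBeurling ε φ z = (1 / Real.pi : ℂ) * kconv (regCauchy ε) (dz φ) z := by
  rw [kconv_regCauchy_dz hφ hε, kconv_eq, ← integral_const_mul, regBeurling]
  congr 1; ext ξ
  rw [beurlingKer]; ring

theorem eLpNorm_bump_le {ε : ℝ} (hε : 0 < ε) {φ : ℂ → ℂ} (hφ : IsTest φ) :
    eLpNorm (fun z => (1 / Real.pi : ℂ) * kconv (fun z => (bump ε z : ℂ)) φ z) 2 ≤ eLpNorm φ 2 := by
  have hb : Measurable fun z => ENNReal.ofReal (bump ε z / Real.pi) := by
    have := (continuous_bump hε).measurable; fun_prop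
  have h1 : ∫⁻ z, ENNReal.ofReal (bump ε z / Real.pi) = 1 := by
    have : ∀ z, ENNReal.ofReal (bump ε z / Real.pi) = ENNReal.ofReal (bump ε z) * ENNReal.ofReal (Real.pi⁻¹) := by
      intro z; rw [div_eq_mul_inv, ENNReal.ofReal_mul (bump_nonneg _ _)]
    simp only [this]
    rw [lintegral_mul_const _ (by have := (continuous_bump hε).measurable; fun_prop), lintegral_bump hε,
      ← ENNReal.ofReal_mul Real.pi_pos.le, mul_inv_cancel₀ Real.pi_ne_zero, ENNReal.ofReal_one]
  have hy := lintegral_young hb hφ.continuous.enorm.measurable h1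
  rw [eLpNorm_eq_lintegral_rpow_enorm_toReal (by simp) (by simp),
    eLpNorm_eq_lintegral_rpow_enorm_toReal (by simp) (by simp)]
  simp only [ENNReal.toReal_ofNat]
  gcongr ?_ ^ _
  refine le_trans (lintegral_mono fun z => ?_) hy
  gcongr
  rw [kconv_eq, ← integral_const_mul]
  refine (enorm_integral_le_lintegral_enorm _).trans (lintegral_mono fun ξ => le_of_eq ?_)
  rw [← mul_assoc, enorm_mul]
  congr 1
  rw [← ofReal_norm]
  congr 1
  rw [norm_mul, norm_div, norm_one, Complex.norm_real, Complex.norm_real, Real.norm_of_nonneg Real.pi_pos.le,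
    Real.norm_of_nonneg (bump_nonneg _ _)]
  ring

theorem norm_kconv_regCauchy_le {ε : ℝ} {φ : ℂ → ℂ} (hφ : IsTest φ) :
    ∃ C ρ : ℝ, ∀ z, ρ ≤ ‖z‖ → ‖kconv (regCauchy ε) φ z‖ ≤ C / ‖z‖ := by
  obtain ⟨r, hr0, hr⟩ := hφ.2.isBounded.subset_ball_lt 0 0
  refine ⟨2 * ∫ ξ, ‖φ ξ‖, 2 * r, fun z hz => ?_⟩
  have hz0 : 0 < ‖z‖ := by linarith
  rw [kconv_eq]
  have : 2 * (∫ ξ, ‖φ ξ‖) / ‖z‖ = ∫ ξ, 2 / ‖z‖ * ‖φ ξ‖ := by rw [integral_const_mul]; ring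
  rw [this]
  refine norm_integral_le_of_norm_le (hφ.integrable.norm.const_mul _) (Eventually.of_forall fun ξ => ?_)
  rw [norm_mul]
  by_cases h : φ ξ = 0
  · simp [h]
  · have hξ : ‖ξ‖ < r := by simpa using hr (subset_tsupport φ h)
    gcongr
    refine (norm_regCauchy_le _).trans ?_
    have h2 : ‖z‖ / 2 ≤ ‖z - ξ‖ := by
      have := norm_sub_norm_le z ξ; linarith
    rw [show 2 / ‖z‖ = (‖z‖ / 2)⁻¹ by field_simp]
    gcongr

/-- For `F` the regularized Cauchy transform of `φ`, `∂F` is the regularized Beurling transform and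
`∂̄F` is an average of `φ`. The comparison of `∂F` with `∂̄F` and Young's inequality give norm at
most `1`. -/
theorem eLpNorm_regBeurling_test {ε : ℝ} (hε : 0 < ε) {φ : ℂ → ℂ} (hφ : IsTest φ) :
    eLpNorm (regBeurling ε φ) 2 ≤ eLpNorm φ 2 := by
  set F : ℂ → ℂ := fun z => (1 / Real.pi : ℂ) * kconv (regCauchy ε) φ z with hF
  have hk : LocallyIntegrable (regCauchy ε) := (continuous_regCauchy hε).locallyIntegrable
  have hs : ContDiff ℝ ((⊤ : ℕ∞) : WithTop ℕ∞) (kconv (regCauchy ε) φ) := contDiff_kconv hk hφ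
  have hd := hs.differentiable (by simp)
  have e1 : dz F = regBeurling ε φ := by
    ext z
    rw [regBeurling_eq_kconv hφ hε, ← dz_kconv hk hφ]
    unfold dz
    rw [hF, fderiv_const_mul_apply _ _ _ hd, fderiv_const_mul_apply _ _ _ hd]
    ring
  have e2 : dzbar F = fun z => (1 / Real.pi : ℂ) * kconv (fun z => (bump ε z : ℂ)) φ z := by
    ext z
    rw [← kconv_regCauchy_dzbar hφ hε, ← dzbar_kconv hk hφ]
    unfold dzbar
    rw [hF, fderiv_const_mul_apply _ _ _ hd, fderiv_const_mul_apply _ _ _ hd]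
    ring
  obtain ⟨C, ρ, hC⟩ := norm_kconv_regCauchy_le (ε := ε) hφ
  have := eLpNorm_dz_le_of_decay (F := F) (contDiff_const.mul hs) (C := C) (ρ := ρ) (fun z hz => by
    rw [hF]; dsimp only; rw [norm_mul]
    exact (mul_le_of_le_one_left (norm_nonneg _) norm_one_div_pi_le).trans (hC z hz))
  rw [e1, e2] at this
  exact this.trans (eLpNorm_bump_le hε hφ)

/-- Test functions approximating an `L^p` function. -/
theorem exists_test_seq {p : ℝ≥0∞} (hp : p ≠ ⊤) (hp1 : 1 ≤ p) {f : ℂ → ℂ} (hf : MemLp f p) :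
    ∃ φ : ℕ → ℂ → ℂ, (∀ n, IsTest (φ n)) ∧ Tendsto (fun n => eLpNorm (f - φ n) p) atTop (𝓝 0) := by
  choose φ h1 h2 h3 using fun n : ℕ => hf.exist_eLpNorm_sub_le hp hp1 (ε := 1 / ((n : ℝ) + 1)) (by positivity)
  refine ⟨φ, fun n => ⟨h2 n, h1 n⟩, ?_⟩
  refine tendsto_of_tendsto_of_tendsto_of_le_of_le tendsto_const_nhds ?_ (fun n => zero_le) h3
  rw [← ENNReal.ofReal_zero]
  exact ENNReal.tendsto_ofReal tendsto_one_div_add_atTop_nhds_zero_nat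

theorem tendsto_eLpNorm_of_sub {p : ℝ≥0∞} (hp1 : 1 ≤ p) {f : ℂ → ℂ} (hf : MemLp f p)
    {φ : ℕ → ℂ → ℂ} (hφ : ∀ n, IsTest (φ n)) (h : Tendsto (fun n => eLpNorm (f - φ n) p) atTop (𝓝 0)) :
    Tendsto (fun n => eLpNorm (φ n) p) atTop (𝓝 (eLpNorm f p)) := by
  have hfin : eLpNorm f p volume ≠ ⊤ := hf.2.ne
  apply tendsto_of_tendsto_of_tendsto_of_le_of_le (g := fun n => eLpNorm f p volume - eLpNorm (f - φ n) p volume)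
    (h := fun n => eLpNorm f p volume + eLpNorm (f - φ n) p volume)
  · simpa using ENNReal.Tendsto.sub tendsto_const_nhds h (Or.inl hfin)
  · simpa using h.const_add (eLpNorm f p volume)
  · intro n
    rw [tsub_le_iff_right]
    have := eLpNorm_add_le ((hφ n).memLp p).1 (hf.1.sub ((hφ n).memLp p).1) hp1
    rwa [add_sub_cancel] at this
  · intro n
    have := eLpNorm_sub_le hf.1 (hf.1.sub ((hφ n).memLp p).1) hp1
    rwa [sub_sub_cancel] at this

/-- The good part of a Calderón–Zygmund decomposition is discontinuous, so the bound is needed on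
all of `L²`. The kernel being in `L²`, `L²` approximation gives pointwise convergence of the
transforms, and Fatou's lemma applies. -/
theorem eLpNorm_two_regBeurling {ε : ℝ} (hε : 0 < ε) {f : ℂ → ℂ} (hf : MemLp f 2) :
    eLpNorm (regBeurling ε f) 2 ≤ eLpNorm f 2 := by
  obtain ⟨φ, hφ, hlim⟩ := exists_test_seq (by simp) one_le_two hf
  have hptw : ∀ z, Tendsto (fun n => regBeurling ε (φ n) z) atTop (𝓝 (regBeurling ε f z)) := by
    intro z
    have hK := memLp_two_beurlingKer_sub hε z
    rw [tendsto_iff_edist_tendsto_0]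
    have : Tendsto (fun n => eLpNorm (fun ξ => beurlingKer ε (z - ξ)) 2 volume * eLpNorm (f - φ n) 2 volume)
        atTop (𝓝 0) := by
      simpa using ENNReal.Tendsto.const_mul hlim (Or.inr hK.2.ne)
    refine tendsto_of_tendsto_of_tendsto_of_le_of_le tendsto_const_nhds this (fun n => zero_le) fun n => ?_
    rw [edist_comm, edist_eq_enorm_sub, regBeurling, regBeurling,
      ← integral_sub (integrable_regBeurling_two hε hf z) (integrable_regBeurling_two hε ((hφ n).memLp 2) z)]
    simp only [← mul_sub]
    refine (enorm_integral_le_lintegral_enorm _).trans ?_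
    have hh := ENNReal.lintegral_mul_le_Lp_mul_Lq volume Real.HolderConjugate.two_two
      hK.1.enorm (hf.1.sub ((hφ n).memLp 2).1).enorm
    rw [eLpNorm_eq_lintegral_rpow_enorm_toReal (by simp) (by simp),
      eLpNorm_eq_lintegral_rpow_enorm_toReal (by simp) (by simp)]
    simp only [Pi.mul_apply, enorm_mul, ENNReal.toReal_ofNat] at hh ⊢
    exact hh
  have hmeas : ∀ n, AEStronglyMeasurable (regBeurling ε (φ n)) := by
    intro n
    have : regBeurling ε (φ n) = fun z => (1 / Real.pi : ℂ) * kconv (regCauchy ε) (dz (φ n)) z :=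
      funext (regBeurling_eq_kconv (hφ n) hε)
    rw [this]
    have := (contDiff_kconv (continuous_regCauchy hε).locallyIntegrable (hφ n).dz).continuous
    exact Continuous.aestronglyMeasurable (by fun_prop)
  refine (Lp.eLpNorm_lim_le_liminf_eLpNorm hmeas _ (Eventually.of_forall hptw)).trans ?_
  refine (liminf_le_liminf (Eventually.of_forall fun n => eLpNorm_regBeurling_test hε (hφ n))).trans_eq ?_
  exact (tendsto_eLpNorm_of_sub one_le_two hf hφ hlim).liminf_eq

end BukhgeimDisc


namespace BukhgeimDisc

/-! ### The Calderón–Zygmund decomposition and the weak type bound -/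

theorem continuous_regBeurling {ε : ℝ} (hε : 0 < ε) {f : ℂ → ℂ} (hf : Integrable f) :
    Continuous (regBeurling ε f) := by
  have hK := continuous_beurlingKer hε
  refine continuous_of_dominated (bound := fun ξ => ε⁻¹ ^ 2 * ‖f ξ‖) (fun z => ?_) (fun z => ?_)
    (hf.norm.const_mul _) (Eventually.of_forall fun ξ => by fun_prop)
  · exact (integrable_regBeurling hε hf z).1
  · refine Eventually.of_forall fun ξ => ?_
    rw [norm_mul]; gcongr; exact norm_beurlingKer_le hε _

/-- The half-open square with lower left corner `a` and side `s`. -/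
def square (a : ℂ) (s : ℝ) : Set ℂ := Ico a.re (a.re + s) ×ℂ Ico a.im (a.im + s)

theorem measurableSet_square (a : ℂ) (s : ℝ) : MeasurableSet (square a s) :=
  (measurableSet_Ico.preimage Complex.measurable_re).inter
    (measurableSet_Ico.preimage Complex.measurable_im)

theorem mem_square {a z : ℂ} {s : ℝ} : z ∈ square a s ↔
    (a.re ≤ z.re ∧ z.re < a.re + s) ∧ (a.im ≤ z.im ∧ z.im < a.im + s) := Iff.rfl

theorem volume_square (a : ℂ) (s : ℝ) : volume (square a s) = ENNReal.ofReal s ^ 2 := by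
  have h : square a s = Complex.measurableEquivRealProd ⁻¹' (Ico a.re (a.re + s) ×ˢ Ico a.im (a.im + s)) := by
    ext z; simp [square, Complex.mem_reProdIm]
  rw [h, Complex.volume_preserving_equiv_real_prod.measure_preimage
    (measurableSet_Ico.prod measurableSet_Ico).nullMeasurableSet, Measure.volume_eq_prod, Measure.prod_prod,
    Real.volume_Ico, Real.volume_Ico, sq]
  simp

theorem norm_sub_le_of_mem_square {a z w : ℂ} {s : ℝ} (hz : z ∈ square a s) (hw : w ∈ square a s) :
    ‖z - w‖ ≤ 2 * s := by
  rw [mem_square] at hz hw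
  refine (Complex.norm_le_abs_re_add_abs_im _).trans ?_
  have h1 : |(z - w).re| ≤ s := by rw [Complex.sub_re, abs_le]; constructor <;> linarith
  have h2 : |(z - w).im| ≤ s := by rw [Complex.sub_im, abs_le]; constructor <;> linarith
  linarith

theorem corner_mem_square (a : ℂ) {s : ℝ} (hs : 0 < s) : a ∈ square a s := by
  rw [mem_square]; refine ⟨⟨le_rfl, ?_⟩, le_rfl, ?_⟩ <;> linarith

/-- `S` admits a decomposition of `f` at height `l` into a bounded part `g` and a remainder whose
transform is integrable off a small set `E`. -/
def HasCZDecomp (ε : ℝ) (f : ℂ → ℂ) (l : ℝ) (S : Set ℂ) : Prop :=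
  ∃ (g : ℂ → ℂ) (E : Set ℂ), Measurable g ∧ MeasurableSet E ∧ (∀ z ∉ S, g z = 0) ∧ (∀ z, ‖g z‖ ≤ 4 * l) ∧
    ∫⁻ z, ‖g z‖ₑ ≤ ∫⁻ z in S, ‖f z‖ₑ ∧
    ENNReal.ofReal l * volume E ≤ 64 * ∫⁻ z in S, ‖f z‖ₑ ∧
    ∫⁻ z in Eᶜ, ‖regBeurling ε (fun ξ => S.indicator f ξ - g ξ) z‖ₑ ≤ 48 * ∫⁻ z in S, ‖f z‖ₑ

/-- The good parts have disjoint supports, so their sum keeps the pointwise bound, and every other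
estimate is additive in the set. This permits a decomposition to be assembled square by square. -/
theorem HasCZDecomp.union {ε : ℝ} (hε : 0 < ε) {f : ℂ → ℂ} (hf : Integrable f) {l : ℝ} {S₁ S₂ : Set ℂ}
    (hS₁ : MeasurableSet S₁) (hS₂ : MeasurableSet S₂) (hd : Disjoint S₁ S₂)
    (h₁ : HasCZDecomp ε f l S₁) (h₂ : HasCZDecomp ε f l S₂) : HasCZDecomp ε f l (S₁ ∪ S₂) := by
  obtain ⟨g₁, E₁, gm₁, Em₁, gs₁, gb₁, gi₁, Ev₁, T₁⟩ := h₁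
  obtain ⟨g₂, E₂, gm₂, Em₂, gs₂, gb₂, gi₂, Ev₂, T₂⟩ := h₂
  have hfin : ∀ S : Set ℂ, ∫⁻ z in S, ‖f z‖ₑ < ⊤ := fun S =>
    (setLIntegral_le_lintegral _ _).trans_lt hf.2
  have i₁ : Integrable g₁ := ⟨gm₁.aestronglyMeasurable, gi₁.trans_lt (hfin _)⟩
  have i₂ : Integrable g₂ := ⟨gm₂.aestronglyMeasurable, gi₂.trans_lt (hfin _)⟩
  refine ⟨fun z => g₁ z + g₂ z, E₁ ∪ E₂, gm₁.add gm₂, Em₁.union Em₂, ?_, ?_, ?_, ?_, ?_⟩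
  · intro z hz
    rw [mem_union, not_or] at hz
    change g₁ z + g₂ z = 0
    rw [gs₁ z hz.1, gs₂ z hz.2, add_zero]
  · intro z
    change ‖g₁ z + g₂ z‖ ≤ _
    by_cases h : z ∈ S₁
    · rw [gs₂ z (disjoint_left.1 hd h), add_zero]; exact gb₁ z
    · rw [gs₁ z h, zero_add]; exact gb₂ z
  · rw [lintegral_union hS₂ hd]
    refine le_trans (lintegral_mono fun z => enorm_add_le _ _) ?_
    rw [lintegral_add_left gm₁.enorm]
    exact add_le_add gi₁ gi₂
  · rw [lintegral_union hS₂ hd, mul_add]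
    refine le_trans (mul_le_mul_right (measure_union_le _ _) _) ?_
    rw [mul_add]
    exact add_le_add Ev₁ Ev₂
  · rw [lintegral_union hS₂ hd, mul_add]
    have e : ∀ z, regBeurling ε (fun ξ => (S₁ ∪ S₂).indicator f ξ - (g₁ ξ + g₂ ξ)) z =
        regBeurling ε (fun ξ => S₁.indicator f ξ - g₁ ξ) z + regBeurling ε (fun ξ => S₂.indicator f ξ - g₂ ξ) z := by
      intro z
      rw [← regBeurling_add hε (f := fun ξ => S₁.indicator f ξ - g₁ ξ)
        (g := fun ξ => S₂.indicator f ξ - g₂ ξ) ((hf.indicator hS₁).sub i₁) ((hf.indicator hS₂).sub i₂)]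
      congr 1; ext ξ
      rw [indicator_union_of_disjoint hd]; ring
    have m₁ : Measurable fun z => ‖regBeurling ε (fun ξ => S₁.indicator f ξ - g₁ ξ) z‖ₑ :=
      (continuous_regBeurling hε ((hf.indicator hS₁).sub i₁)).measurable.enorm
    calc _ ≤ ∫⁻ z in (E₁ ∪ E₂)ᶜ, (‖regBeurling ε (fun ξ => S₁.indicator f ξ - g₁ ξ) z‖ₑ +
          ‖regBeurling ε (fun ξ => S₂.indicator f ξ - g₂ ξ) z‖ₑ) := by
          refine lintegral_mono fun z => ?_
          rw [e]; exact enorm_add_le _ _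
      _ = _ := lintegral_add_left m₁ _
      _ ≤ _ := add_le_add
          ((lintegral_mono_set (compl_subset_compl.2 subset_union_left)).trans T₁)
          ((lintegral_mono_set (compl_subset_compl.2 subset_union_right)).trans T₂)

theorem hasCZDecomp_of_bounded {ε : ℝ} {f : ℂ → ℂ} (hf : Continuous f) {l : ℝ} (hl : 0 < l) {S : Set ℂ}
    (hS : MeasurableSet S) (h : ∀ z ∈ S, ‖f z‖ ≤ 2 * l) : HasCZDecomp ε f l S := by
  refine ⟨S.indicator f, ∅, hf.measurable.indicator hS, MeasurableSet.empty,
    fun z hz => indicator_of_notMem hz f, fun z => ?_, ?_, ?_, ?_⟩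
  · by_cases hz : z ∈ S
    · rw [indicator_of_mem hz]; linarith [h z hz]
    · rw [indicator_of_notMem hz]; simp; linarith
  · simp only [enorm_indicator_eq_indicator_enorm]
    rw [lintegral_indicator hS]
  · simp
  · simp [regBeurling]

/-- A selected square, on which the mean of `|f|` lies between `l` and `4l`. The good part is the
mean of `f`; the remainder has mean zero, so its transform decays like `|z-a|⁻³` away from the
square and is integrable off the ball `E` of radius `4s` about the corner. -/
theorem hasCZDecomp_of_large {ε : ℝ} (hε : 0 < ε) {f : ℂ → ℂ} (hf : Integrable f) {l : ℝ} (hl : 0 < l)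
    {a : ℂ} {s : ℝ} (hs : 0 < s)
    (h1 : ENNReal.ofReal l * ENNReal.ofReal s ^ 2 ≤ ∫⁻ z in square a s, ‖f z‖ₑ)
    (h2 : ∫⁻ z in square a s, ‖f z‖ₑ ≤ 4 * (ENNReal.ofReal l * ENNReal.ofReal s ^ 2)) :
    HasCZDecomp ε f l (square a s) := by
  have hQ := measurableSet_square a s
  set Q := square a s with hQdef
  have hvol : volume Q = ENNReal.ofReal (s ^ 2) := by
    rw [hQdef, volume_square, ENNReal.ofReal_pow hs.le]
  set I := ∫⁻ z in Q, ‖f z‖ₑ with hI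
  have hIfin : I < ⊤ := (setLIntegral_le_lintegral _ _).trans_lt hf.2
  set m : ℂ := ((s ^ 2 : ℝ) : ℂ)⁻¹ * ∫ z in Q, f z with hm
  have hm_norm : ‖m‖ₑ * ENNReal.ofReal (s ^ 2) ≤ I := by
    have : ‖m‖ₑ * ENNReal.ofReal (s ^ 2) = ‖∫ z in Q, f z‖ₑ := by
      have hs2 : ENNReal.ofReal (s ^ 2) = ‖((s ^ 2 : ℝ) : ℂ)‖ₑ := by
        rw [← ofReal_norm, Complex.norm_real, Real.norm_of_nonneg (by positivity)]
      rw [hs2, ← enorm_mul]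
      congr 1
      rw [hm]
      have : ((s ^ 2 : ℝ) : ℂ) ≠ 0 := Complex.ofReal_ne_zero.2 (by positivity)
      field_simp
    rw [this]
    exact enorm_integral_le_lintegral_enorm _
  have hgint : ∫⁻ z, ‖Q.indicator (fun _ => m) z‖ₑ ≤ I := by
    simp only [enorm_indicator_eq_indicator_enorm]
    rw [lintegral_indicator hQ]
    simpa [hvol] using hm_norm
  have hgm : Measurable (Q.indicator (fun _ => m)) := measurable_const.indicator hQ
  have hgi : Integrable (Q.indicator (fun _ => m)) := ⟨hgm.aestronglyMeasurable, hgint.trans_lt hIfin⟩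
  refine ⟨Q.indicator (fun _ => m), Metric.ball a (4 * s), hgm, measurableSet_ball,
    fun z hz => indicator_of_notMem hz _, ?_, hgint, ?_, ?_⟩
  · have hmle : ‖m‖ ≤ 4 * l := by
      have h3 : ‖m‖ₑ * ENNReal.ofReal (s ^ 2) ≤ ENNReal.ofReal (4 * l) * ENNReal.ofReal (s ^ 2) := by
        refine hm_norm.trans (h2.trans_eq ?_)
        rw [ENNReal.ofReal_mul (by norm_num), ENNReal.ofReal_pow hs.le, ENNReal.ofReal_ofNat, mul_assoc]
      rw [ENNReal.mul_le_mul_iff_left (by simpa using hs.ne') (by simp), ← ofReal_norm,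
        ENNReal.ofReal_le_ofReal_iff (by positivity)] at h3
      exact h3
    intro z
    by_cases hz : z ∈ Q
    · rw [indicator_of_mem hz]; exact hmle
    · rw [indicator_of_notMem hz]; simp; linarith
  -- The area of `E` is `16πs² ≤ 64s²`, and `l s² ≤ I`.
  · rw [Complex.volume_ball, ENNReal.ofReal_mul (by norm_num), mul_pow]
    calc _ ≤ ENNReal.ofReal l * (ENNReal.ofReal 4 ^ 2 * ENNReal.ofReal s ^ 2 * 4) := by
          gcongr
          rw [show (4 : ℝ≥0∞) = ((4 : ℝ≥0) : ℝ≥0∞) by norm_num]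
          exact ENNReal.coe_le_coe.2 Real.pi_le_four
      _ = 64 * (ENNReal.ofReal l * ENNReal.ofReal s ^ 2) := by
          rw [ENNReal.ofReal_ofNat]; ring
      _ ≤ 64 * I := by gcongr
  · set b : ℂ → ℂ := fun ξ => Q.indicator f ξ - Q.indicator (fun _ => m) ξ with hb
    have hfi : Integrable (Q.indicator f) := hf.indicator hQ
    have hbi : Integrable b := hfi.sub hgi
    have hb0 : ∫ ξ, b ξ = 0 := by
      rw [hb, integral_sub hfi hgi, integral_indicator hQ, integral_indicator hQ, setIntegral_const]
      rw [Measure.real, hvol, ENNReal.toReal_ofReal (by positivity), hm, Complex.real_smul]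
      have : ((s ^ 2 : ℝ) : ℂ) ≠ 0 := Complex.ofReal_ne_zero.2 (by positivity)
      field_simp; ring
    have hbn : ∫⁻ ξ, ‖b ξ‖ₑ ≤ 2 * I := by
      refine (lintegral_mono fun ξ => enorm_sub_le).trans ?_
      rw [lintegral_add_right _ hgm.enorm, two_mul]
      gcongr
      simp only [enorm_indicator_eq_indicator_enorm]
      rw [lintegral_indicator hQ]
    -- As `b` has mean zero, the kernel at the corner may be subtracted. Points of the square are
    -- within `2s ≤ |z-a|/2` of the corner, so the smoothness bound applies with factor `6·2s =
    -- 12s`.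
    have hpt : ∀ z ∈ (Metric.ball a (4 * s))ᶜ, ‖regBeurling ε b z‖ₑ ≤
        ENNReal.ofReal (12 * s) * ENNReal.ofReal (‖a - z‖ ^ (-3 : ℝ)) * (2 * I) := by
      intro z hz
      have hz4 : 4 * s ≤ ‖z - a‖ := by simpa [dist_eq_norm] using hz
      have hza : z - a ≠ 0 := norm_pos_iff.1 (by linarith)
      have e : regBeurling ε b z = ∫ ξ, (beurlingKer ε (z - ξ) - beurlingKer ε (z - a)) * b ξ := by
        simp only [sub_mul]
        rw [integral_sub (integrable_regBeurling hε hbi z) (hbi.const_mul _), integral_const_mul, hb0,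
          mul_zero, sub_zero, regBeurling]
      rw [e]
      refine (enorm_integral_le_lintegral_enorm _).trans ?_
      calc _ ≤ ∫⁻ ξ, ENNReal.ofReal (12 * s) * ENNReal.ofReal (‖a - z‖ ^ (-3 : ℝ)) * ‖b ξ‖ₑ := by
            refine lintegral_mono fun ξ => ?_
            by_cases hξ : ξ ∈ Q
            · rw [enorm_mul, ← ENNReal.ofReal_mul (by positivity)]
              gcongr
              rw [← ofReal_norm]
              apply ENNReal.ofReal_le_ofReal
              have hd := norm_sub_le_of_mem_square (corner_mem_square a hs) hξ
              have htri : ‖z - a‖ ≤ ‖z - ξ‖ + ‖a - ξ‖ := by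
                rw [norm_sub_rev a ξ]; exact norm_sub_le_norm_sub_add_norm_sub _ _ _
              refine (norm_beurlingKer_sub_le hε hza (by linarith)).trans ?_
              rw [norm_sub_rev a z, show (-3 : ℝ) = -((3 : ℕ) : ℝ) by norm_num, Real.rpow_neg (norm_nonneg _),
                Real.rpow_natCast, div_eq_mul_inv]
              refine mul_le_mul_of_nonneg_right ?_ (by positivity)
              rw [sub_sub_sub_cancel_left]
              linarith
            · simp [hb, indicator_of_notMem hξ]
        _ = ENNReal.ofReal (12 * s) * ENNReal.ofReal (‖a - z‖ ^ (-3 : ℝ)) * ∫⁻ ξ, ‖b ξ‖ₑ :=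
            lintegral_const_mul' _ _ (by finiteness)
        _ ≤ _ := by gcongr
    -- The integral of `12s|z-a|⁻³` off the ball is `12s·2π/(4s) = 6π ≤ 24`; with the norm `2I` of
    -- `b` this is the constant `48`.
    calc _ ≤ ∫⁻ z in (Metric.ball a (4 * s))ᶜ,
          ENNReal.ofReal (12 * s) * ENNReal.ofReal (‖a - z‖ ^ (-3 : ℝ)) * (2 * I) :=
          setLIntegral_mono' measurableSet_ball.compl hpt
      _ = ENNReal.ofReal (12 * s) * ENNReal.ofReal (2 * Real.pi * ((4 * s) ^ (2 - 3 : ℝ) / (3 - 2))) * (2 * I) := by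
          rw [lintegral_mul_const' _ _ (by finiteness), lintegral_const_mul' _ _ (by finiteness),
            lintegral_compl_ball_rpow a (by norm_num : (2 : ℝ) < 3) (by positivity)]
      _ ≤ 24 * (2 * I) := by
          gcongr
          rw [← ENNReal.ofReal_mul (by positivity), ← ENNReal.ofReal_ofNat]
          apply ENNReal.ofReal_le_ofReal
          norm_num
          rw [Real.rpow_neg_one]
          have : 12 * s * (2 * Real.pi * (4 * s)⁻¹) = 6 * Real.pi := by field_simp; norm_num
          rw [this]
          linarith [Real.pi_le_four]
      _ = _ := by ring

end BukhgeimDisc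


/-! ### Subdivision into squares and weak type (1,1). -/

namespace BukhgeimDisc

theorem square_eq_union (a : ℂ) (s : ℝ) : square a s =
    (square a (s / 2) ∪ square (a + (s / 2 : ℝ)) (s / 2)) ∪
      (square (a + (s / 2 : ℝ) * Complex.I) (s / 2) ∪
        square (a + (s / 2 : ℝ) + (s / 2 : ℝ) * Complex.I) (s / 2)) := by
  ext z
  simp only [mem_union, mem_square, Complex.add_re, Complex.add_im, Complex.ofReal_re, Complex.ofReal_im,
    Complex.mul_re, Complex.mul_im, Complex.I_re, Complex.I_im]
  constructor
  · rintro ⟨⟨h1, h2⟩, h3, h4⟩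
    rcases lt_or_ge z.re (a.re + s / 2) with h5 | h5 <;> rcases lt_or_ge z.im (a.im + s / 2) with h6 | h6
    · left; left; refine ⟨⟨?_, ?_⟩, ?_, ?_⟩ <;> linarith
    · right; left; refine ⟨⟨?_, ?_⟩, ?_, ?_⟩ <;> linarith
    · left; right; refine ⟨⟨?_, ?_⟩, ?_, ?_⟩ <;> linarith
    · right; right; refine ⟨⟨?_, ?_⟩, ?_, ?_⟩ <;> linarith
  · rintro ((⟨⟨h1, h2⟩, h3, h4⟩ | ⟨⟨h1, h2⟩, h3, h4⟩) | (⟨⟨h1, h2⟩, h3, h4⟩ | ⟨⟨h1, h2⟩, h3, h4⟩)) <;>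
      refine ⟨⟨?_, ?_⟩, ?_, ?_⟩ <;> linarith

/-- Uniform continuity makes the stopping-time argument finite: once a square has diameter below
`δ`, a mean at most `l` forces `|f| ≤ 2l` on it and nothing remains to be removed. `N` bounds the
number of halvings needed to reach that scale. -/
theorem hasCZDecomp_square {ε : ℝ} (hε : 0 < ε) {f : ℂ → ℂ} (hfc : Continuous f) (hf : Integrable f) {l δ : ℝ}
    (hl : 0 < l) (hδ : ∀ z w : ℂ, ‖z - w‖ < δ → ‖f z - f w‖ ≤ l) (N : ℕ) :
    ∀ (a : ℂ) (s : ℝ), 0 < s → 2 * s < δ * 2 ^ N →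
      ∫⁻ z in square a s, ‖f z‖ₑ ≤ ENNReal.ofReal l * ENNReal.ofReal s ^ 2 →
      HasCZDecomp ε f l (square a s) := by
  induction N with
  | zero =>
    intro a s hs hsδ hle
    refine hasCZDecomp_of_bounded hfc hl (measurableSet_square a s) fun z hz => ?_
    by_contra! hlt
    have h1 : ∀ w ∈ square a s, ENNReal.ofReal (‖f z‖ - l) ≤ ‖f w‖ₑ := by
      intro w hw
      rw [← ofReal_norm]
      apply ENNReal.ofReal_le_ofReal
      have h2 := hδ z w (lt_of_le_of_lt (norm_sub_le_of_mem_square hz hw) (by simpa using hsδ))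
      have h3 := norm_sub_norm_le (f z) (f w)
      linarith
    have h2 := setLIntegral_mono' (measurableSet_square a s) (μ := volume) h1
    rw [setLIntegral_const, volume_square] at h2
    have h3 := h2.trans hle
    have hs2 : ENNReal.ofReal s ^ 2 ≠ 0 := by simpa using hs
    rw [ENNReal.mul_le_mul_iff_left hs2 (by finiteness), ENNReal.ofReal_le_ofReal_iff hl.le] at h3
    linarith
  | succ N ih =>
    intro a s hs hsδ hle
    have hs2 : 0 < s / 2 := by linarith
    have child : ∀ c : ℂ, square c (s / 2) ⊆ square a s → HasCZDecomp ε f l (square c (s / 2)) := by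
      intro c hc
      rcases le_total (∫⁻ z in square c (s / 2), ‖f z‖ₑ) (ENNReal.ofReal l * ENNReal.ofReal (s / 2) ^ 2) with h | h
      · refine ih c (s / 2) hs2 ?_ h
        rw [pow_succ] at hsδ; linarith
      -- The first square in the subdivision with mean above `l`: its parent has mean at most `l`
      -- and four times its area, so its own mean is at most `4l`.
      · refine hasCZDecomp_of_large hε hf hl hs2 h ?_
        refine (lintegral_mono_set hc).trans (hle.trans_eq ?_)
        rw [← ENNReal.ofReal_pow hs.le, ← ENNReal.ofReal_pow hs2.le, mul_left_comm]
        congr 1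
        rw [← ENNReal.ofReal_ofNat, ← ENNReal.ofReal_mul (by norm_num)]
        congr 1; ring
    have hU := square_eq_union a s
    have m := fun c : ℂ => measurableSet_square c (s / 2)
    have disj : ∀ c d : ℂ, (c.re + s / 2 ≤ d.re ∨ c.im + s / 2 ≤ d.im) →
        Disjoint (square c (s / 2)) (square d (s / 2)) := by
      intro c d h
      rw [Set.disjoint_left]
      intro z hz hz'
      rw [mem_square] at hz hz'
      rcases h with h | h <;> linarith
    rw [hU]
    refine ((child _ ?_).union hε hf (m _) (m _) ?_ (child _ ?_)).union hε hf ((m _).union (m _))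
      ((m _).union (m _)) ?_ ((child _ ?_).union hε hf (m _) (m _) ?_ (child _ ?_))
    · rw [hU]; exact fun z hz => Or.inl (Or.inl hz)
    · exact disj _ _ (Or.inl (by simp))
    · rw [hU]; exact fun z hz => Or.inl (Or.inr hz)
    · rw [disjoint_union_left, disjoint_union_right, disjoint_union_right]
      refine ⟨⟨disj _ _ (Or.inr ?_), disj _ _ (Or.inr ?_)⟩, disj _ _ (Or.inr ?_), disj _ _ (Or.inr ?_)⟩ <;> simp
    · rw [hU]; exact fun z hz => Or.inr (Or.inl hz)
    · exact disj _ _ (Or.inl (by simp))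
    · rw [hU]; exact fun z hz => Or.inr (Or.inr hz)

theorem hasCZDecomp {ε : ℝ} (hε : 0 < ε) {f : ℂ → ℂ} (hfc : Continuous f) (hc : HasCompactSupport f) {l : ℝ}
    (hl : 0 < l) : ∃ S, MeasurableSet S ∧ S.indicator f = f ∧ HasCZDecomp ε f l S := by
  have hf : Integrable f := hfc.integrable_of_hasCompactSupport hc
  obtain ⟨δ, hδ0, hδ⟩ := Metric.uniformContinuous_iff.1 (hc.uniformContinuous_of_continuous hfc) l hl
  obtain ⟨r, hr0, hr⟩ := hc.isBounded.subset_ball_lt 0 0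
  obtain ⟨s, hs1, hs2⟩ : ∃ s : ℝ, 2 * r ≤ s ∧ ∫⁻ z, ‖f z‖ₑ ≤ ENNReal.ofReal l * ENNReal.ofReal s ^ 2 := by
    set J := (∫⁻ z, ‖f z‖ₑ).toReal with hJ
    have hJ0 : 0 ≤ J := ENNReal.toReal_nonneg
    -- Side `2r` covers the support; `s ≥ 1` and `s ≥ J/l` give `l s² ≥ l s ≥ J`, so the initial
    -- mean is at most `l`.
    refine ⟨max (max (2 * r) 1) (J / l), (le_max_left _ _).trans (le_max_left _ _), ?_⟩
    set s := max (max (2 * r) 1) (J / l)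
    have hs1 : 1 ≤ s := (le_max_right _ _).trans (le_max_left _ _)
    have hs2 : J / l ≤ s := le_max_right _ _
    rw [← ENNReal.ofReal_toReal hf.2.ne, ← ENNReal.ofReal_pow (by linarith), ← ENNReal.ofReal_mul hl.le]
    apply ENNReal.ofReal_le_ofReal
    rw [div_le_iff₀ hl] at hs2
    change J ≤ _
    nlinarith
  have hs0 : 0 < s := by linarith
  obtain ⟨N, hN⟩ := pow_unbounded_of_one_lt (2 * s / δ) one_lt_two
  set a : ℂ := ⟨-(s / 2), -(s / 2)⟩ with ha
  refine ⟨square a s, measurableSet_square a s, ?_, hasCZDecomp_square hε hfc hf hl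
    (fun z w h => by rw [← dist_eq_norm] at h ⊢; exact (hδ h).le) N a s hs0 ?_ ?_⟩
  · rw [indicator_eq_self]
    intro z hz
    have h1 : ‖z‖ < r := by simpa using hr (subset_tsupport f hz)
    have h2 := (abs_lt.1 ((Complex.abs_re_le_norm z).trans_lt h1))
    have h3 := (abs_lt.1 ((Complex.abs_im_le_norm z).trans_lt h1))
    rw [mem_square]
    refine ⟨⟨?_, ?_⟩, ?_, ?_⟩ <;> simp only [ha] <;> linarith
  · rw [div_lt_iff₀ hδ0] at hN; linarith
  · exact (setLIntegral_le_lintegral _ _).trans hs2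

theorem lintegral_sq_regBeurling_le {ε : ℝ} (hε : 0 < ε) {f : ℂ → ℂ} (hf : MemLp f 2) :
    ∫⁻ z, ‖regBeurling ε f z‖ₑ ^ 2 ≤ ∫⁻ z, ‖f z‖ₑ ^ 2 := by
  have h := eLpNorm_two_regBeurling hε hf
  rw [eLpNorm_eq_lintegral_rpow_enorm_toReal (by simp) (by simp),
    eLpNorm_eq_lintegral_rpow_enorm_toReal (by simp) (by simp),
    ENNReal.rpow_le_rpow_iff (by simp)] at h
  simpa using h

theorem meas_lt_regBeurling_le_two {ε : ℝ} (hε : 0 < ε) {f : ℂ → ℂ} (hf : MemLp f 2) (hfi : Integrable f) (l : ℝ) :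
    ENNReal.ofReal l ^ 2 * volume {z | l < ‖regBeurling ε f z‖} ≤ ∫⁻ z, ‖f z‖ₑ ^ 2 := by
  refine le_trans ?_ (lintegral_sq_regBeurling_le hε hf)
  have hm := (continuous_regBeurling hε hfi).measurable
  refine le_trans ?_ (mul_meas_ge_le_lintegral₀ (f := fun z => ‖regBeurling ε f z‖ₑ ^ 2)
    (by fun_prop) (ENNReal.ofReal l ^ 2))
  refine mul_le_mul_right (measure_mono fun z hz => ?_) _
  have hz' : l < ‖regBeurling ε f z‖ := hz
  change _ ≤ ‖regBeurling ε f z‖ₑ ^ 2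
  rw [← ofReal_norm]
  gcongr

/-- The constant is `116 = 64 + 48 + 4`: the exceptional set, Chebyshev for the bad part off it, and
the `L²` bound for the good part, whose squared norm is at most `4l` times the `L¹` norm of `f`. -/
theorem weak_type_regBeurling {ε : ℝ} (hε : 0 < ε) {f : ℂ → ℂ} (hfc : Continuous f) (hc : HasCompactSupport f) {l : ℝ}
    (hl : 0 < l) :
    ENNReal.ofReal l * volume {z | 2 * l < ‖regBeurling ε f z‖} ≤ 116 * ∫⁻ z, ‖f z‖ₑ := by
  have hf : Integrable f := hfc.integrable_of_hasCompactSupport hc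
  obtain ⟨S, hS, hSf, g, E, gm, Em, -, gb, gi, Ev, hT⟩ := hasCZDecomp hε hfc hc hl
  rw [hSf] at hT
  set I := ∫⁻ z, ‖f z‖ₑ with hI
  have hSI : ∫⁻ z in S, ‖f z‖ₑ ≤ I := setLIntegral_le_lintegral _ _
  have hgi : Integrable g := ⟨gm.aestronglyMeasurable, (gi.trans hSI).trans_lt hf.2⟩
  have hl0 : ENNReal.ofReal l ≠ 0 := by simpa using hl
  have hg2 : ∫⁻ z, ‖g z‖ₑ ^ 2 ≤ ENNReal.ofReal (4 * l) * I := by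
    calc _ ≤ ∫⁻ z, ENNReal.ofReal (4 * l) * ‖g z‖ₑ := by
          refine lintegral_mono fun z => ?_
          rw [sq]
          gcongr
          rw [← ofReal_norm]
          exact ENNReal.ofReal_le_ofReal (gb z)
      _ ≤ _ := by
          rw [lintegral_const_mul' _ _ (by finiteness)]
          gcongr
          exact gi.trans hSI
  have hgL : MemLp g 2 := by
    refine ⟨gm.aestronglyMeasurable, ?_⟩
    rw [eLpNorm_lt_top_iff_lintegral_rpow_enorm_lt_top (by simp) (by simp)]
    have : ∫⁻ z, ‖g z‖ₑ ^ 2 < ⊤ := hg2.trans_lt (ENNReal.mul_lt_top ENNReal.ofReal_lt_top hf.2)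
    simpa using this
  have h2 : ENNReal.ofReal l * volume {z | l < ‖regBeurling ε g z‖} ≤ 4 * I := by
    have h := (meas_lt_regBeurling_le_two hε hgL hgi l).trans hg2
    rw [ENNReal.ofReal_mul (by norm_num), sq, mul_assoc, mul_comm (ENNReal.ofReal 4), mul_assoc,
      ENNReal.mul_le_mul_iff_right hl0 (by finiteness), ENNReal.ofReal_ofNat] at h
    exact h
  have h3 : ENNReal.ofReal l * volume ({z | l < ‖regBeurling ε (fun ξ => f ξ - g ξ) z‖} ∩ Eᶜ) ≤ 48 * I := by
    have hm := (continuous_regBeurling hε (hf.sub hgi)).measurable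
    refine le_trans ?_ (hT.trans (by gcongr))
    refine le_trans ?_ (mul_meas_ge_le_lintegral₀ (μ := volume.restrict Eᶜ)
      (f := fun z => ‖regBeurling ε (fun ξ => f ξ - g ξ) z‖ₑ) hm.enorm.aemeasurable (ENNReal.ofReal l))
    rw [Measure.restrict_apply' Em.compl]
    refine mul_le_mul_right (measure_mono (inter_subset_inter_left _ fun z hz => ?_)) _
    have hz' : l < ‖regBeurling ε (fun ξ => f ξ - g ξ) z‖ := hz
    change _ ≤ ‖regBeurling ε (fun ξ => f ξ - g ξ) z‖ₑ
    rw [← ofReal_norm]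
    gcongr
  have hsub : {z | 2 * l < ‖regBeurling ε f z‖} ⊆ E ∪ (({z | l < ‖regBeurling ε (fun ξ => f ξ - g ξ) z‖} ∩ Eᶜ) ∪
      {z | l < ‖regBeurling ε g z‖}) := by
    intro z hz
    by_contra hcon
    simp only [mem_union, mem_inter_iff, mem_ofPred_eq, mem_compl_iff, not_or, not_and, not_lt] at hcon hz
    obtain ⟨hE, h4, h5⟩ := hcon
    have h6 : ‖regBeurling ε (fun ξ => f ξ - g ξ) z‖ ≤ l := by
      by_contra! h; exact h4 h hE
    rw [regBeurling_sub hε hf hgi] at h6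
    have := norm_sub_norm_le (regBeurling ε f z) (regBeurling ε g z)
    linarith
  calc _ ≤ ENNReal.ofReal l * (volume E + (volume ({z | l < ‖regBeurling ε (fun ξ => f ξ - g ξ) z‖} ∩ Eᶜ) +
      volume {z | l < ‖regBeurling ε g z‖})) := by
        gcongr
        exact (measure_mono hsub).trans ((measure_union_le _ _).trans (by gcongr; exact measure_union_le _ _))
    _ ≤ 64 * I + (48 * I + 4 * I) := by
        rw [mul_add, mul_add]
        exact add_le_add (Ev.trans (mul_le_mul_right hSI _)) (add_le_add h3 h2)
    _ = _ := by ring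

end BukhgeimDisc


namespace BukhgeimDisc

/-! ### Interpolation -/

/-- The density of the Marcinkiewicz interpolation argument. -/
noncomputable def marcDensity (q t a : ℝ) : ℝ≥0∞ :=
  116 * (Iio a).indicator (fun t => ENNReal.ofReal (a * t ^ (q - 2))) t +
    ENNReal.ofReal (min t a ^ 2 * t ^ (q - 3))

theorem measurable_marcDensity (q : ℝ) : Measurable fun x : ℝ × ℝ => marcDensity q x.1 x.2 := by
  have h : ∀ x : ℝ × ℝ, marcDensity q x.1 x.2 =
      116 * ({x : ℝ × ℝ | x.1 < x.2}.indicator (fun x => ENNReal.ofReal (x.2 * x.1 ^ (q - 2))) x) +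
      ENNReal.ofReal (min x.1 x.2 ^ 2 * x.1 ^ (q - 3)) := by
    intro x
    unfold marcDensity
    congr 2
  simp only [h]
  refine Measurable.add (Measurable.const_mul (Measurable.indicator (by fun_prop) ?_) _) (by fun_prop)
  exact measurableSet_lt measurable_fst measurable_snd

/-- The term with `q-1` comes from the part treated by the weak bound and converges at `0` because
`q > 1`; the other two come from the `L²` part for `t < a` and `t ≥ a`, the latter converging at
infinity because `q < 2`. -/
theorem lintegral_marcDensity {q : ℝ} (hq1 : 1 < q) (hq2 : q < 2) {a : ℝ} (ha : 0 ≤ a) :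
    ∫⁻ t in Ioi (0 : ℝ), marcDensity q t a =
      ENNReal.ofReal (116 / (q - 1) + 1 / q + 1 / (2 - q)) * ENNReal.ofReal (a ^ q) := by
  rcases ha.eq_or_lt with rfl | ha
  · have : ∀ t ∈ Ioi (0 : ℝ), marcDensity q t 0 = 0 := by
      intro t ht
      have ht0 : (0 : ℝ) < t := ht
      simp [marcDensity, min_eq_right ht0.le]
    rw [setLIntegral_congr_fun measurableSet_Ioi this, Real.zero_rpow (by linarith)]
    simp
  · have i1 : ∫⁻ t in Ioi (0 : ℝ), (Iio a).indicator (fun t => ENNReal.ofReal (a * t ^ (q - 2))) t =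
        ENNReal.ofReal (a ^ q / (q - 1)) := by
      rw [lintegral_indicator measurableSet_Iio, Measure.restrict_restrict measurableSet_Iio, inter_comm,
        Ioi_inter_Iio]
      simp only [ENNReal.ofReal_mul ha.le]
      rw [lintegral_const_mul' _ _ (by finiteness), lintegral_Ioo_rpow (by linarith) ha,
        ← ENNReal.ofReal_mul ha.le]
      congr 1
      have : a ^ q = a * a ^ (q - 2 + 1) := by
        nth_rw 2 [← Real.rpow_one a]
        rw [← Real.rpow_add ha]; ring_nf
      rw [this]; ring
    have i2 : ∫⁻ t in Ioi (0 : ℝ), ENNReal.ofReal (min t a ^ 2 * t ^ (q - 3)) =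
        ENNReal.ofReal (a ^ q / q) + ENNReal.ofReal (a ^ q / (2 - q)) := by
      rw [← Ioo_union_Ici_eq_Ioi ha, lintegral_union measurableSet_Ici
        (disjoint_left.2 fun x h1 h2 => absurd h1.2 (not_lt.2 h2))]
      congr 1
      · have : ∀ t ∈ Ioo 0 a, ENNReal.ofReal (min t a ^ 2 * t ^ (q - 3)) = ENNReal.ofReal (t ^ (q - 1)) := by
          intro t ht
          rw [min_eq_left ht.2.le, ← Real.rpow_natCast, ← Real.rpow_add ht.1]
          congr 2; push_cast; ring
        rw [setLIntegral_congr_fun measurableSet_Ioo this, lintegral_Ioo_rpow (by linarith) ha]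
        simp
      · have : ∀ t ∈ Ici a, ENNReal.ofReal (min t a ^ 2 * t ^ (q - 3)) =
            ENNReal.ofReal (a ^ 2) * ENNReal.ofReal (t ^ (q - 3)) := by
          intro t ht
          rw [min_eq_right ht, ENNReal.ofReal_mul (by positivity)]
        rw [setLIntegral_congr_fun measurableSet_Ici this, lintegral_const_mul' _ _ (by finiteness),
          lintegral_Ici_rpow (by linarith) ha, ← ENNReal.ofReal_mul (by positivity)]
        congr 1
        have e : a ^ q = a ^ 2 * a ^ (q - 3 + 1) := by
          rw [← Real.rpow_natCast, ← Real.rpow_add ha]; congr 1; push_cast; ring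
        rw [e, show -(q - 3) - 1 = 2 - q by ring]; ring
    unfold marcDensity
    rw [lintegral_add_right _ (by fun_prop), lintegral_const_mul' _ _ (by simp), i1, i2]
    have h1 : 0 < q - 1 := by linarith
    have h2 : 0 < 2 - q := by linarith
    have h3 : 0 < q := by linarith
    rw [← ENNReal.ofReal_ofNat, ← ENNReal.ofReal_mul (by norm_num), ← ENNReal.ofReal_add (by positivity) (by positivity),
      ← ENNReal.ofReal_add (by positivity) (by positivity), ← ENNReal.ofReal_mul (by positivity)]
    congr 1
    ring

/-- The constant of `lintegral_rpow_regBeurling_le`. -/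
noncomputable def marcConst (q : ℝ) : ℝ := 3 ^ q * q * (116 / (q - 1) + 1 / q + 1 / (2 - q))

/-- The function is split at height `t`. The division by `3` matches the levels `2t` for the large
part (weak type) and `t` for the small part (`L²` and Chebyshev). -/
theorem meas_regBeurling_le {ε : ℝ} (hε : 0 < ε) {f : ℂ → ℂ} (hfc : Continuous f) (hc : HasCompactSupport f)
    {q t : ℝ} (ht : 0 < t) :
    volume {z | t < ‖regBeurling ε f z‖ / 3} * ENNReal.ofReal (t ^ (q - 1)) ≤ ∫⁻ z, marcDensity q t ‖f z‖ := by
  have hf : Integrable f := hfc.integrable_of_hasCompactSupport hc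
  have hpos : ∀ z, 0 < max t ‖f z‖ := fun z => lt_max_of_lt_left ht
  -- Truncating the modulus rather than restricting to a level set keeps both pieces continuous with
  -- compact support, as the weak type bound requires.
  set f₂ : ℂ → ℂ := fun z => ((t / max t ‖f z‖ : ℝ) : ℂ) * f z with hf₂
  set f₁ : ℂ → ℂ := fun z => f z - f₂ z with hf₁
  have c2 : Continuous f₂ := by
    refine (Complex.continuous_ofReal.comp ?_).mul hfc
    exact continuous_const.div (by fun_prop) fun z => (hpos z).ne'
  have c1 : Continuous f₁ := hfc.sub c2
  have s2 : HasCompactSupport f₂ := hc.mul_left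
  have s1 : HasCompactSupport f₁ := hc.sub s2
  have n2 : ∀ z, ‖f₂ z‖ = min t ‖f z‖ := by
    intro z
    rw [hf₂]
    simp only [norm_mul, Complex.norm_real]
    rw [Real.norm_of_nonneg (by have := hpos z; positivity)]
    rcases le_total t ‖f z‖ with h | h
    · rw [max_eq_right h, min_eq_left h]
      have : ‖f z‖ ≠ 0 := by linarith
      field_simp
    · rw [max_eq_left h, min_eq_right h, div_self ht.ne', one_mul]
  have n1 : ∀ z, ‖f₁ z‖ₑ ≤ (Iio ‖f z‖).indicator (fun _ => ENNReal.ofReal ‖f z‖) t := by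
    intro z
    by_cases h : t < ‖f z‖
    · rw [indicator_of_mem (by exact h), ← ofReal_norm]
      apply ENNReal.ofReal_le_ofReal
      have e : f₁ z = ((1 - t / max t ‖f z‖ : ℝ) : ℂ) * f z := by
        simp only [hf₁, hf₂]; push_cast; ring
      have h1 : t / max t ‖f z‖ ≤ 1 := (div_le_one (hpos z)).2 (le_max_left _ _)
      have h2 : 0 ≤ t / max t ‖f z‖ := div_nonneg ht.le (hpos z).le
      rw [e, norm_mul, Complex.norm_real, Real.norm_of_nonneg (by linarith)]
      exact mul_le_of_le_one_left (norm_nonneg _) (by linarith)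
    · have e : f₁ z = 0 := by
        simp only [hf₁, hf₂, max_eq_left (not_lt.1 h), div_self ht.ne']
        simp
      simp [e]
  have i1 : Integrable f₁ := c1.integrable_of_hasCompactSupport s1
  have i2 : Integrable f₂ := c2.integrable_of_hasCompactSupport s2
  have w1 := weak_type_regBeurling hε c1 s1 ht
  have w2 := meas_lt_regBeurling_le_two hε (c2.memLp_of_hasCompactSupport s2) i2 t
  have hsub : {z | t < ‖regBeurling ε f z‖ / 3} ⊆
      {z | 2 * t < ‖regBeurling ε f₁ z‖} ∪ {z | t < ‖regBeurling ε f₂ z‖} := by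
    intro z hz
    by_contra hcon
    simp only [mem_union, mem_ofPred_eq, not_or, not_lt] at hcon hz
    have e : regBeurling ε f₁ z = regBeurling ε f z - regBeurling ε f₂ z := regBeurling_sub hε hf i2 z
    rw [e] at hcon
    have := norm_sub_norm_le (regBeurling ε f z) (regBeurling ε f₂ z)
    linarith [hcon.1, hcon.2]
  have p1 : ENNReal.ofReal (t ^ (q - 1)) = ENNReal.ofReal (t ^ (q - 2)) * ENNReal.ofReal t := by
    rw [← ENNReal.ofReal_mul (by positivity)]
    congr 1
    nth_rw 3 [← Real.rpow_one t]
    rw [← Real.rpow_add ht]; ring_nf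
  have p2 : ENNReal.ofReal (t ^ (q - 1)) = ENNReal.ofReal (t ^ (q - 3)) * ENNReal.ofReal t ^ 2 := by
    rw [← ENNReal.ofReal_pow ht.le, ← ENNReal.ofReal_mul (by positivity)]
    congr 1
    rw [← Real.rpow_natCast, ← Real.rpow_add ht]; congr 1; push_cast; ring
  calc _ ≤ (volume {z | 2 * t < ‖regBeurling ε f₁ z‖} + volume {z | t < ‖regBeurling ε f₂ z‖}) *
        ENNReal.ofReal (t ^ (q - 1)) := by
        gcongr
        exact (measure_mono hsub).trans (measure_union_le _ _)
    _ = ENNReal.ofReal (t ^ (q - 2)) * (ENNReal.ofReal t * volume {z | 2 * t < ‖regBeurling ε f₁ z‖}) +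
        ENNReal.ofReal (t ^ (q - 3)) * (ENNReal.ofReal t ^ 2 * volume {z | t < ‖regBeurling ε f₂ z‖}) := by
        rw [add_mul]
        nth_rw 1 [p1]
        rw [p2]; ring
    _ ≤ ENNReal.ofReal (t ^ (q - 2)) * (116 * ∫⁻ z, ‖f₁ z‖ₑ) +
        ENNReal.ofReal (t ^ (q - 3)) * ∫⁻ z, ‖f₂ z‖ₑ ^ 2 := by gcongr
    _ = ∫⁻ z, (ENNReal.ofReal (t ^ (q - 2)) * (116 * ‖f₁ z‖ₑ) + ENNReal.ofReal (t ^ (q - 3)) * ‖f₂ z‖ₑ ^ 2) := by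
        rw [lintegral_add_left (by fun_prop), lintegral_const_mul' _ _ (by finiteness),
          lintegral_const_mul' _ _ (by finiteness), lintegral_const_mul' _ _ (by finiteness)]
    _ ≤ _ := by
        refine lintegral_mono fun z => ?_
        unfold marcDensity
        gcongr ?_ + ?_
        · rw [mul_left_comm]
          gcongr
          refine (mul_le_mul_right (n1 z) _).trans (le_of_eq ?_)
          by_cases h : t < ‖f z‖
          · rw [indicator_of_mem (by exact h), indicator_of_mem (by exact h), mul_comm,
              ← ENNReal.ofReal_mul (norm_nonneg _)]
          · rw [indicator_of_notMem (by exact h), indicator_of_notMem (by exact h), mul_zero]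
        · rw [← ofReal_norm, n2, ← ENNReal.ofReal_pow (by positivity), mul_comm, ← ENNReal.ofReal_mul (by positivity)]

/-- Marcinkiewicz interpolation: the layer cake formula for a third of the transform, the
distributional bound at each height, and Tonelli. -/
theorem lintegral_rpow_regBeurling_le {ε : ℝ} (hε : 0 < ε) {q : ℝ} (hq1 : 1 < q) (hq2 : q < 2) {f : ℂ → ℂ}
    (hfc : Continuous f) (hc : HasCompactSupport f) :
    ∫⁻ z, ‖regBeurling ε f z‖ₑ ^ q ≤ ENNReal.ofReal (marcConst q) * ∫⁻ z, ‖f z‖ₑ ^ q := by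
  have hf : Integrable f := hfc.integrable_of_hasCompactSupport hc
  have hq0 : 0 < q := by linarith
  have hcont := continuous_regBeurling hε hf
  have hcake := lintegral_rpow_eq_lintegral_meas_lt_mul volume (f := fun z => ‖regBeurling ε f z‖ / 3)
    (Eventually.of_forall fun z => by positivity) (by fun_prop) hq0
  have e1 : ∀ z, ENNReal.ofReal ((‖regBeurling ε f z‖ / 3) ^ q) =
      ENNReal.ofReal ((3 ^ q)⁻¹) * ‖regBeurling ε f z‖ₑ ^ q := by
    intro z
    rw [Real.div_rpow (norm_nonneg _) (by norm_num), div_eq_inv_mul, ENNReal.ofReal_mul (by positivity),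
      ← ofReal_norm, ENNReal.ofReal_rpow_of_nonneg (norm_nonneg _) hq0.le]
  simp only [e1] at hcake
  rw [lintegral_const_mul' _ _ (by finiteness)] at hcake
  have h3 : ENNReal.ofReal (3 ^ q) * ENNReal.ofReal ((3 ^ q)⁻¹) = 1 := by
    rw [← ENNReal.ofReal_mul (by positivity), mul_inv_cancel₀ (by positivity), ENNReal.ofReal_one]
  have hm : Measurable fun x : ℝ × ℂ => marcDensity q x.1 ‖f x.2‖ :=
    (measurable_marcDensity q).comp (measurable_fst.prodMk (hfc.measurable.norm.comp measurable_snd))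
  calc ∫⁻ z, ‖regBeurling ε f z‖ₑ ^ q =
      ENNReal.ofReal (3 ^ q) * (ENNReal.ofReal ((3 ^ q)⁻¹) * ∫⁻ z, ‖regBeurling ε f z‖ₑ ^ q) := by
        rw [← mul_assoc, h3, one_mul]
    _ ≤ ENNReal.ofReal (3 ^ q) * (ENNReal.ofReal q * ∫⁻ t in Ioi 0, ∫⁻ z, marcDensity q t ‖f z‖) := by
        rw [hcake]
        refine mul_le_mul_right (mul_le_mul_right ?_ _) _
        exact setLIntegral_mono' measurableSet_Ioi fun t ht =>
          meas_regBeurling_le (q := q) hε hfc hc (mem_Ioi.1 ht)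
    _ = ENNReal.ofReal (3 ^ q) * (ENNReal.ofReal q * ∫⁻ z, ∫⁻ t in Ioi 0, marcDensity q t ‖f z‖) := by
        rw [lintegral_lintegral_swap hm.aemeasurable]
    _ = ENNReal.ofReal (3 ^ q) * (ENNReal.ofReal q * (ENNReal.ofReal (116 / (q - 1) + 1 / q + 1 / (2 - q)) *
          ∫⁻ z, ‖f z‖ₑ ^ q)) := by
        simp only [lintegral_marcDensity hq1 hq2 (norm_nonneg _)]
        rw [lintegral_const_mul' _ _ (by finiteness)]
        congr 3
        congr 1 with z
        rw [← ofReal_norm, ENNReal.ofReal_rpow_of_nonneg (norm_nonneg _) hq0.le]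
    _ = _ := by
        rw [marcConst, ENNReal.ofReal_mul (by positivity), ENNReal.ofReal_mul (by positivity)]
        ring

end BukhgeimDisc


namespace BukhgeimDisc

/-! ### Duality and the Beurling transform of test functions -/

/-- The kernel is even, so the transform is its own transpose. -/
theorem integral_regBeurling_mul {ε : ℝ} (hε : 0 < ε) {f g : ℂ → ℂ} (hf : Integrable f) (hg : Integrable g) :
    ∫ z, regBeurling ε f z * g z = ∫ ξ, f ξ * regBeurling ε g ξ := by
  have hK := continuous_beurlingKer hε
  have hi : Integrable (fun x : ℂ × ℂ => beurlingKer ε (x.1 - x.2) * (g x.1 * f x.2)) (volume.prod volume) := by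
    refine (hg.mul_prod hf).bdd_mul (c := ε⁻¹ ^ 2) (Continuous.aestronglyMeasurable (by fun_prop))
      (Eventually.of_forall fun x => norm_beurlingKer_le hε _)
  have h := integral_integral_swap (f := fun z ξ => beurlingKer ε (z - ξ) * (g z * f ξ)) hi
  calc _ = ∫ z, ∫ ξ, beurlingKer ε (z - ξ) * (g z * f ξ) := by
        congr 1; ext z
        rw [regBeurling, ← integral_mul_const]
        congr 1; ext ξ; ring
    _ = _ := h
    _ = _ := by
        congr 1; ext ξ
        rw [regBeurling, ← integral_const_mul]
        congr 1; ext z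
        rw [← beurlingKer_neg, neg_sub]; ring

/-- Duality with the exponent `q < 2`, made explicit by testing `G` against its dual function
`|G|^(p-2) conj G`, cut off to have compact support. -/
theorem lintegral_rpow_regBeurling_le_of_two_lt {ε : ℝ} (hε : 0 < ε) {p q : ℝ} (hp : 2 < p)
    (hpq : p.HolderConjugate q) {f : ℂ → ℂ} (hfc : Continuous f) (hc : HasCompactSupport f) :
    ∫⁻ z, ‖regBeurling ε f z‖ₑ ^ p ≤ (ENNReal.ofReal (marcConst q) ^ (1 / q)) ^ p * ∫⁻ z, ‖f z‖ₑ ^ p := by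
  have hf : Integrable f := hfc.integrable_of_hasCompactSupport hc
  have hq2 := holderConjugate_lt_two hp hpq
  have hq1 : 1 < q := hpq.symm.lt
  have hp0 : 0 < p := hpq.pos
  have hq0 : 0 < q := hpq.symm.pos
  set G := regBeurling ε f with hG
  have hGc : Continuous G := continuous_regBeurling hε hf
  set A := ENNReal.ofReal (marcConst q) ^ (1 / q) with hA
  have hAfin : A ≠ ⊤ := by rw [hA]; finiteness
  set χ : ℕ → ℂ → ℝ := fun n z => max 0 (min 1 ((n : ℝ) + 1 - ‖z‖)) with hχ
  have χ0 : ∀ n z, 0 ≤ χ n z := fun n z => le_max_left _ _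
  have χ1 : ∀ n z, χ n z ≤ 1 := fun n z => max_le zero_le_one (min_le_left _ _)
  have χc : ∀ n, Continuous (χ n) := fun n => by simp only [hχ]; fun_prop
  have χs : ∀ n, HasCompactSupport (χ n) := by
    intro n
    refine HasCompactSupport.of_support_subset_isCompact (isCompact_closedBall (0 : ℂ) ((n : ℝ) + 1)) ?_
    intro z hz
    by_contra h
    rw [mem_closedBall_zero_iff, not_le] at h
    exact hz (max_eq_left ((min_le_right _ _).trans (by linarith)))
  have key : ∀ n, ∫⁻ z, ENNReal.ofReal (χ n z * ‖G z‖ ^ p) ≤ A ^ p * ∫⁻ z, ‖f z‖ₑ ^ p := by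
    intro n
    set ψ : ℂ → ℂ := fun z => ((χ n z * ‖G z‖ ^ (p - 2) : ℝ) : ℂ) * conj (G z) with hψ
    have gpc : ∀ r : ℝ, 0 < r → Continuous fun z => ‖G z‖ ^ r := fun r hr =>
      hGc.norm.rpow_const fun _ => Or.inr hr.le
    have ψc : Continuous ψ :=
      (Complex.continuous_ofReal.comp ((χc n).mul (gpc _ (by linarith)))).mul (Complex.continuous_conj.comp hGc)
    have ψs : HasCompactSupport ψ :=
      ((χs n).mul_right (f' := fun z => ‖G z‖ ^ (p - 2))).comp_left (g := Complex.ofReal) (by simp) |>.mul_right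
    have ψi : Integrable ψ := ψc.integrable_of_hasCompactSupport ψs
    have e1 : ∀ z, G z * ψ z = ((χ n z * ‖G z‖ ^ p : ℝ) : ℂ) := by
      intro z
      have h1 : G z * conj (G z) = ((‖G z‖ ^ 2 : ℝ) : ℂ) := by
        rw [Complex.mul_conj, Complex.normSq_eq_norm_sq]
      have h2 : ‖G z‖ ^ p = ‖G z‖ ^ (p - 2) * ‖G z‖ ^ 2 := by
        rcases eq_or_ne (‖G z‖) 0 with h | h
        · rw [h, Real.zero_rpow hp0.ne']; simp
        · rw [← Real.rpow_natCast, ← Real.rpow_add (lt_of_le_of_ne (norm_nonneg _) h.symm)]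
          congr 1; push_cast; ring
      rw [hψ]; dsimp only
      rw [mul_left_comm, h1, h2]; push_cast; ring
    -- `(p-1)q = p`, and `χ^q ≤ χ` because `0 ≤ χ ≤ 1`.
    have nψ : ∀ z, ‖ψ z‖ₑ ^ q ≤ ENNReal.ofReal (χ n z * ‖G z‖ ^ p) := by
      intro z
      have h1 : ‖ψ z‖ = χ n z * ‖G z‖ ^ (p - 1) := by
        rw [hψ]; dsimp only
        rw [norm_mul, Complex.norm_real, Complex.norm_conj,
          Real.norm_of_nonneg (mul_nonneg (χ0 n z) (by positivity)), mul_assoc]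
        congr 1
        rcases eq_or_ne (‖G z‖) 0 with h | h
        · rw [h, Real.zero_rpow (by linarith : p - 1 ≠ 0)]; simp
        · nth_rw 2 [← Real.rpow_one ‖G z‖]
          rw [← Real.rpow_add (lt_of_le_of_ne (norm_nonneg _) h.symm)]
          congr 1; ring
      rw [← ofReal_norm, ENNReal.ofReal_rpow_of_nonneg (norm_nonneg _) hq0.le, h1,
        Real.mul_rpow (χ0 n z) (by positivity), ← Real.rpow_mul (norm_nonneg _)]
      have h2 : (p - 1) * q = p := hpq.sub_one_mul_conj
      rw [h2]
      gcongr
      exact (Real.rpow_le_rpow_of_exponent_ge' (χ0 n z) (χ1 n z) zero_le_one hq1.le).trans_eq (Real.rpow_one _)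
    set J := ∫⁻ z, ENNReal.ofReal (χ n z * ‖G z‖ ^ p) with hJ
    have hi : Integrable fun z => χ n z * ‖G z‖ ^ p :=
      ((χc n).mul (gpc p hp0)).integrable_of_hasCompactSupport (χs n).mul_right
    have hJfin : J ≠ ⊤ := by
      have := hi.2
      rw [hasFiniteIntegral_iff_ofReal (Eventually.of_forall fun z => mul_nonneg (χ0 n z) (by positivity))] at this
      exact this.ne
    have hJle : J ≤ (∫⁻ z, ‖f z‖ₑ ^ p) ^ (1 / p) * (A * J ^ (1 / q)) := by
      calc J = ‖∫ z, G z * ψ z‖ₑ := by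
            simp only [e1]
            rw [integral_complex_ofReal, ← ofReal_norm, Complex.norm_real, Real.norm_of_nonneg,
              ofReal_integral_eq_lintegral_ofReal hi]
            · exact Eventually.of_forall fun z => mul_nonneg (χ0 n z) (by positivity)
            · exact integral_nonneg fun z => mul_nonneg (χ0 n z) (by positivity)
        _ = ‖∫ ξ, f ξ * regBeurling ε ψ ξ‖ₑ := by rw [integral_regBeurling_mul hε hf ψi]
        _ ≤ ∫⁻ ξ, ‖f ξ‖ₑ * ‖regBeurling ε ψ ξ‖ₑ := by
            refine (enorm_integral_le_lintegral_enorm _).trans_eq ?_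
            simp only [enorm_mul]
        _ ≤ (∫⁻ z, ‖f z‖ₑ ^ p) ^ (1 / p) * (∫⁻ z, ‖regBeurling ε ψ z‖ₑ ^ q) ^ (1 / q) :=
            ENNReal.lintegral_mul_le_Lp_mul_Lq volume hpq hfc.enorm.measurable.aemeasurable
              (continuous_regBeurling hε ψi).enorm.measurable.aemeasurable
        _ ≤ (∫⁻ z, ‖f z‖ₑ ^ p) ^ (1 / p) * (ENNReal.ofReal (marcConst q) * J) ^ (1 / q) := by
            gcongr
            refine (lintegral_rpow_regBeurling_le hε hq1 hq2 ψc ψs).trans ?_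
            gcongr
            exact lintegral_mono nψ
        _ = _ := by rw [ENNReal.mul_rpow_of_nonneg _ _ (by positivity)]
    -- `J` is finite thanks to the cutoff, so the factor `J^(1/q)` may be cancelled from both sides
    -- of `hJle`.
    rcases eq_or_ne J 0 with hJ0 | hJ0
    · rw [hJ0]; exact zero_le
    have hsplit : J = J ^ (1 / p) * J ^ (1 / q) := by
      rw [← ENNReal.rpow_add _ _ hJ0 hJfin, one_div, one_div, hpq.inv_add_inv_eq_one, ENNReal.rpow_one]
    have h1 : J ^ (1 / p) ≤ A * (∫⁻ z, ‖f z‖ₑ ^ p) ^ (1 / p) := by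
      have h2 : J ^ (1 / p) * J ^ (1 / q) ≤ (A * (∫⁻ z, ‖f z‖ₑ ^ p) ^ (1 / p)) * J ^ (1 / q) := by
        rw [← hsplit]; refine hJle.trans_eq ?_; ring
      rwa [ENNReal.mul_le_mul_iff_left] at h2
      · simp [ENNReal.rpow_eq_zero_iff, hJ0, hq0]
        finiteness
      · finiteness
    calc J = (J ^ (1 / p)) ^ p := by rw [← ENNReal.rpow_mul, one_div_mul_cancel hp0.ne', ENNReal.rpow_one]
      _ ≤ (A * (∫⁻ z, ‖f z‖ₑ ^ p) ^ (1 / p)) ^ p := by gcongr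
      _ = _ := by
        rw [ENNReal.mul_rpow_of_nonneg _ _ hp0.le, ← ENNReal.rpow_mul (∫⁻ z, ‖f z‖ₑ ^ p), one_div_mul_cancel hp0.ne', ENNReal.rpow_one]
  have hlim : ∀ z, Tendsto (fun n => ENNReal.ofReal (χ n z * ‖G z‖ ^ p)) atTop (𝓝 (‖G z‖ₑ ^ p)) := by
    intro z
    obtain ⟨N, hN⟩ := exists_nat_ge ‖z‖
    refine tendsto_const_nhds.congr' ?_
    filter_upwards [eventually_ge_atTop N] with n hn
    have : (N : ℝ) ≤ n := by exact_mod_cast hn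
    have h1 : χ n z = 1 := by
      simp only [hχ]
      rw [min_eq_left (by linarith), max_eq_right zero_le_one]
    rw [h1, one_mul, ← ofReal_norm, ENNReal.ofReal_rpow_of_nonneg (norm_nonneg _) hp0.le]
  calc ∫⁻ z, ‖G z‖ₑ ^ p = ∫⁻ z, liminf (fun n => ENNReal.ofReal (χ n z * ‖G z‖ ^ p)) atTop := by
        congr 1; ext z; rw [(hlim z).liminf_eq]
    _ ≤ liminf (fun n => ∫⁻ z, ENNReal.ofReal (χ n z * ‖G z‖ ^ p)) atTop := by
        refine lintegral_liminf_le fun n => ?_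
        have := (χc n).measurable
        have := hGc.measurable
        fun_prop
    _ ≤ _ := liminf_le_of_frequently_le' (Frequently.of_forall key)

/-- The Beurling transform of test functions. -/
noncomputable def testBeurling (φ : ℂ → ℂ) : ℂ → ℂ := planeCauchy (dz φ)

theorem continuous_testBeurling {φ : ℂ → ℂ} (hφ : IsTest φ) : Continuous (testBeurling φ) :=
  (contDiff_planeCauchy hφ.dz).continuous

theorem tendsto_regBeurling {φ : ℂ → ℂ} (hφ : IsTest φ) (z : ℂ) :
    Tendsto (fun ε => regBeurling ε φ z) (𝓝[>] 0) (𝓝 (testBeurling φ z)) := by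
  refine ((tendsto_kconv_regCauchy hφ.dz z).const_mul (1 / Real.pi : ℂ)).congr' ?_
  filter_upwards [self_mem_nhdsWithin] with ε hε
  rw [regBeurling_eq_kconv hφ hε]

theorem lintegral_testBeurling_le {r : ℝ} {M : ℝ≥0∞} {φ : ℂ → ℂ} (hφ : IsTest φ)
    (h : ∀ ε > 0, ∫⁻ z, ‖regBeurling ε φ z‖ₑ ^ r ≤ M * ∫⁻ z, ‖φ z‖ₑ ^ r) :
    ∫⁻ z, ‖testBeurling φ z‖ₑ ^ r ≤ M * ∫⁻ z, ‖φ z‖ₑ ^ r := by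
  have hseq : Tendsto (fun n : ℕ => 1 / ((n : ℝ) + 1)) atTop (𝓝[>] 0) :=
    tendsto_nhdsWithin_iff.2 ⟨tendsto_one_div_add_atTop_nhds_zero_nat,
      Eventually.of_forall fun n => by simp only [mem_Ioi]; positivity⟩
  have hlim : ∀ z, Tendsto (fun n : ℕ => ‖regBeurling (1 / ((n : ℝ) + 1)) φ z‖ₑ ^ r) atTop
      (𝓝 (‖testBeurling φ z‖ₑ ^ r)) := fun z =>
    (ENNReal.continuous_rpow_const.tendsto _).comp
      ((continuous_enorm.tendsto _).comp ((tendsto_regBeurling hφ z).comp hseq))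
  calc _ = ∫⁻ z, liminf (fun n : ℕ => ‖regBeurling (1 / ((n : ℝ) + 1)) φ z‖ₑ ^ r) atTop := by
        congr 1; ext z; rw [(hlim z).liminf_eq]
    _ ≤ liminf (fun n : ℕ => ∫⁻ z, ‖regBeurling (1 / ((n : ℝ) + 1)) φ z‖ₑ ^ r) atTop := by
        refine lintegral_liminf_le fun n => ?_
        have := (continuous_regBeurling (ε := 1 / ((n : ℝ) + 1)) (by positivity) hφ.integrable).measurable
        fun_prop
    _ ≤ _ := liminf_le_of_frequently_le' (Frequently.of_forall fun n => h _ (by positivity))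

theorem eLpNorm_testBeurling_le {p q : ℝ} (hp : 2 < p) (hpq : p.HolderConjugate q) {φ : ℂ → ℂ} (hφ : IsTest φ) :
    eLpNorm (testBeurling φ) (ENNReal.ofReal p) ≤
      ENNReal.ofReal (marcConst q) ^ (1 / q) * eLpNorm φ (ENNReal.ofReal p) := by
  have hp0 : 0 < p := hpq.pos
  have h := lintegral_testBeurling_le hφ fun ε hε =>
    lintegral_rpow_regBeurling_le_of_two_lt hε hp hpq hφ.continuous hφ.2
  rw [eLpNorm_eq_lintegral_rpow_enorm_toReal (by simpa using hp0) ENNReal.ofReal_ne_top,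
    eLpNorm_eq_lintegral_rpow_enorm_toReal (by simpa using hp0) ENNReal.ofReal_ne_top,
    ENNReal.toReal_ofReal hp0.le]
  calc _ ≤ ((ENNReal.ofReal (marcConst q) ^ (1 / q)) ^ p * ∫⁻ z, ‖φ z‖ₑ ^ p) ^ (1 / p) := by gcongr
    _ = _ := by
      rw [ENNReal.mul_rpow_of_nonneg _ _ (by positivity), ← ENNReal.rpow_mul _ p, mul_one_div_cancel hp0.ne',
        ENNReal.rpow_one]

/-- Used to pass to `L^p` limits in the pairing of a function with the transform of a test function.
-/
theorem memLp_testBeurling_conj {p q : ℝ} (hp : 2 < p) (hpq : p.HolderConjugate q) {φ : ℂ → ℂ} (hφ : IsTest φ) :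
    MemLp (testBeurling φ) (ENNReal.ofReal q) := by
  have hq0 : 0 < q := hpq.symm.pos
  refine ⟨(continuous_testBeurling hφ).aestronglyMeasurable, ?_⟩
  rw [eLpNorm_lt_top_iff_lintegral_rpow_enorm_lt_top (by simpa using hq0) ENNReal.ofReal_ne_top,
    ENNReal.toReal_ofReal hq0.le]
  refine (lintegral_testBeurling_le hφ fun ε hε =>
    lintegral_rpow_regBeurling_le hε hpq.symm.lt (holderConjugate_lt_two hp hpq) hφ.continuous hφ.2).trans_lt ?_
  refine ENNReal.mul_lt_top ENNReal.ofReal_lt_top ?_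
  have := (hφ.memLp (ENNReal.ofReal q)).2
  rwa [eLpNorm_lt_top_iff_lintegral_rpow_enorm_lt_top (by simpa using hq0) ENNReal.ofReal_ne_top,
    ENNReal.toReal_ofReal hq0.le] at this

end BukhgeimDisc


namespace BukhgeimDisc

/-! ### Integration by parts against Lipschitz functions -/

theorem integral_lipschitz_mul_fderiv_real {f f' g : ℂ → ℝ} {C : ℝ≥0} {v : ℂ} (hf : LipschitzWith C f)
    (h : ∀ᵐ z, HasLineDerivAt ℝ f (f' z) z v) (hg : ContDiff ℝ 1 g) (hc : HasCompactSupport g) :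
    ∫ z, f z * fderiv ℝ g z v = -∫ z, f' z * g z := by
  obtain ⟨D, hD⟩ := ContDiff.lipschitzWith_of_hasCompactSupport hc hg one_ne_zero
  have := hf.integral_lineDeriv_mul_eq (μ := volume) hD hc v
  have e1 : ∫ z, f' z * g z = ∫ x, lineDeriv ℝ f x v * g x := by
    refine integral_congr_ae ?_
    filter_upwards [h] with z hz
    rw [hz.lineDeriv]
  rw [e1, this, ← integral_neg]
  congr 1 with z
  have hd : DifferentiableAt ℝ g z := (hg.differentiable one_ne_zero) z
  rw [hd.lineDeriv_eq_fderiv, map_neg]; ring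

theorem integrable_lineDeriv_mul {f f' : ℂ → ℝ} {C : ℝ≥0} {v : ℂ} (hf : LipschitzWith C f)
    (h : ∀ᵐ z, HasLineDerivAt ℝ f (f' z) z v) {φ : ℂ → ℂ} (hφ : IsTest φ) :
    Integrable fun z => (f' z : ℂ) * φ z := by
  have h1 := hf.memLp_lineDeriv (μ := volume) v
  have h2 : MemLp f' ⊤ volume := by
    refine (memLp_congr_ae ?_).1 h1
    filter_upwards [h] with z hz using hz.lineDeriv
  have h3 : MemLp (fun z => (f' z : ℂ)) ⊤ volume := h2.ofReal
  exact memLp_one_iff_integrable.1 ((hφ.memLp 1).mul h3)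

theorem integral_lipschitz_mul_fderiv_ofReal {f f' : ℂ → ℝ} {C : ℝ≥0} {v : ℂ} (hf : LipschitzWith C f)
    (h : ∀ᵐ z, HasLineDerivAt ℝ f (f' z) z v) {φ : ℂ → ℂ} (hφ : IsTest φ) :
    ∫ z, (f z : ℂ) * fderiv ℝ φ z v = -∫ z, (f' z : ℂ) * φ z := by
  have i1 : Integrable fun z => (f z : ℂ) * fderiv ℝ φ z v :=
    integrable_mul_fderiv_test hφ (Complex.continuous_ofReal.comp hf.continuous) v
  have i2 := integrable_lineDeriv_mul hf h hφ
  have hd : Differentiable ℝ φ := hφ.differentiable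
  have hre : ∀ L : ℂ →L[ℝ] ℝ, ∀ z, fderiv ℝ (fun z => L (φ z)) z v = L (fderiv ℝ φ z v) := by
    intro L z
    exact congrArg (fun T => T v) (L.hasFDerivAt.comp z (hd z).hasFDerivAt).fderiv
  have key : ∀ L : ℂ →L[ℝ] ℝ, L (∫ z, (f z : ℂ) * fderiv ℝ φ z v) = L (-∫ z, (f' z : ℂ) * φ z) := by
    intro L
    rw [map_neg, ← L.integral_comp_comm i1, ← L.integral_comp_comm i2]
    have hs : ∀ (r : ℝ) (w : ℂ), L (r * w) = r * L w := by
      intro r w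
      rw [← Complex.real_smul, map_smul, smul_eq_mul]
    simp only [hs, ← hre]
    exact integral_lipschitz_mul_fderiv_real (g := fun z => L (φ z)) hf h
      (L.contDiff.comp (hφ.1.of_le (by simp))) (hφ.2.comp_left (map_zero L))
  exact Complex.ext (key Complex.reCLM) (key Complex.imCLM)

theorem integral_lipschitz_mul_fderiv {F F' : ℂ → ℂ} {C : ℝ≥0} {v : ℂ} (hF : LipschitzWith C F)
    (h : ∀ᵐ z, HasLineDerivAt ℝ F (F' z) z v) {φ : ℂ → ℂ} (hφ : IsTest φ) :
    (Integrable fun z => F' z * φ z) ∧ ∫ z, F z * fderiv ℝ φ z v = -∫ z, F' z * φ z := by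
  have hL : ∀ L : ℂ →L[ℝ] ℝ, (∃ D, LipschitzWith D fun z => L (F z)) ∧
      ∀ᵐ z, HasLineDerivAt ℝ (fun z => L (F z)) (L (F' z)) z v := by
    intro L
    refine ⟨⟨_, L.lipschitz.comp hF⟩, ?_⟩
    filter_upwards [h] with z hz
    exact L.hasFDerivAt.comp_hasDerivAt (0 : ℝ) hz
  obtain ⟨⟨D1, hD1⟩, h1⟩ := hL Complex.reCLM
  obtain ⟨⟨D2, hD2⟩, h2⟩ := hL Complex.imCLM
  have a1 := integral_lipschitz_mul_fderiv_ofReal hD1 h1 hφ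
  have a2 := integral_lipschitz_mul_fderiv_ofReal hD2 h2 hφ
  have b1 := integrable_lineDeriv_mul hD1 h1 hφ
  have b2 := integrable_lineDeriv_mul hD2 h2 hφ
  have c1 : Integrable fun z => ((Complex.reCLM (F z) : ℝ) : ℂ) * fderiv ℝ φ z v :=
    integrable_mul_fderiv_test hφ (Complex.continuous_ofReal.comp hD1.continuous) v
  have c2 : Integrable fun z => ((Complex.imCLM (F z) : ℝ) : ℂ) * fderiv ℝ φ z v :=
    integrable_mul_fderiv_test hφ (Complex.continuous_ofReal.comp hD2.continuous) v
  have e1 : ∀ z, F' z * φ z = ((Complex.reCLM (F' z) : ℝ) : ℂ) * φ z +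
      Complex.I * (((Complex.imCLM (F' z) : ℝ) : ℂ) * φ z) := by
    intro z
    conv_lhs => rw [← Complex.re_add_im (F' z)]
    simp only [Complex.reCLM_apply, Complex.imCLM_apply]; ring
  have e2 : ∀ z, F z * fderiv ℝ φ z v = ((Complex.reCLM (F z) : ℝ) : ℂ) * fderiv ℝ φ z v +
      Complex.I * (((Complex.imCLM (F z) : ℝ) : ℂ) * fderiv ℝ φ z v) := by
    intro z
    conv_lhs => rw [← Complex.re_add_im (F z)]
    simp only [Complex.reCLM_apply, Complex.imCLM_apply]; ring
  constructor
  · simp only [e1]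
    exact b1.add (b2.const_mul _)
  · simp only [e1, e2]
    rw [integral_add b1 (b2.const_mul _), integral_add c1 (c2.const_mul _), integral_const_mul,
      integral_const_mul, a1, a2]
    ring

/-- Intended for `truncCauchy`, whose derivative jumps across a circle: for Lipschitz functions the
almost everywhere derivative suffices for integration by parts. -/
theorem integral_lipschitz_mul_dz {F a b : ℂ → ℂ} {C : ℝ≥0} (hF : LipschitzWith C F)
    (h : ∀ᵐ z, HasWirtingerAt F (a z) (b z) z) {φ : ℂ → ℂ} (hφ : IsTest φ) :
    ∫ z, F z * dz φ z = -∫ z, a z * φ z := by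
  have hl : ∀ v, ∀ᵐ z, HasLineDerivAt ℝ F (wirtingerCLM (a z) (b z) v) z v := by
    intro v
    filter_upwards [h] with z hz
    exact HasFDerivAt.hasLineDerivAt hz v
  obtain ⟨i1, h1⟩ := integral_lipschitz_mul_fderiv hF (hl 1) hφ
  obtain ⟨i2, h2⟩ := integral_lipschitz_mul_fderiv hF (hl Complex.I) hφ
  have j1 := integrable_mul_fderiv_test hφ hF.continuous 1
  have j2 := integrable_mul_fderiv_test hφ hF.continuous Complex.I
  have e1 : ∀ z, F z * dz φ z = (1 / 2) * (F z * fderiv ℝ φ z 1) +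
      (-Complex.I / 2) * (F z * fderiv ℝ φ z Complex.I) := by intro z; unfold dz; ring
  have e2 : ∀ z, a z * φ z = (1 / 2) * (wirtingerCLM (a z) (b z) 1 * φ z) +
      (-Complex.I / 2) * (wirtingerCLM (a z) (b z) Complex.I * φ z) := by
    intro z
    simp only [wirtingerCLM_apply, map_one, Complex.conj_I]
    linear_combination ((a z * φ z) / 2 - b z * φ z / 2) * Complex.I_mul_I
  simp only [e1, e2]
  rw [integral_add (j1.const_mul _) (j2.const_mul _), integral_add (i1.const_mul _) (i2.const_mul _),
    integral_const_mul, integral_const_mul, integral_const_mul, integral_const_mul, h1, h2]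
  ring

/-! ### The ball average of the Cauchy kernel -/

/-- The average of the Cauchy kernel over the ball of radius `ε`. -/
noncomputable def truncCauchy (ε : ℝ) (w : ℂ) : ℂ := if ‖w‖ ≤ ε then conj w / (ε : ℂ) ^ 2 else w⁻¹

theorem truncCauchy_neg (ε : ℝ) (w : ℂ) : truncCauchy ε (-w) = -truncCauchy ε w := by
  unfold truncCauchy
  rw [norm_neg]
  split_ifs
  · rw [map_neg, neg_div]
  · rw [inv_neg]

/-- With `dθ = dw/(iw)` this is a contour integral of `1/(w(w-ζ))`, evaluated by partial fractions;
the two residues cancel when `ζ` is inside. -/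
theorem integral_circle_inv_sub {r : ℝ} (hr : 0 < r) {ζ : ℂ} (h : ‖ζ‖ ≠ r) :
    ∫ θ in (0 : ℝ)..2 * Real.pi, (circleMap 0 r θ - ζ)⁻¹ = if r < ‖ζ‖ then -(2 * Real.pi) * ζ⁻¹ else 0 := by
  have hpi : (Real.pi : ℂ) ≠ 0 := Complex.ofReal_ne_zero.2 Real.pi_ne_zero
  have e : ∫ θ in (0 : ℝ)..2 * Real.pi, (circleMap 0 r θ - ζ)⁻¹ =
      -Complex.I * ∮ w in C(0, r), w⁻¹ * (w - ζ)⁻¹ := by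
    rw [circleIntegral, ← intervalIntegral.integral_const_mul]
    congr 1 with θ
    have h0 : circleMap 0 r θ ≠ 0 := circleMap_ne_center hr.ne'
    rw [deriv_circleMap, smul_eq_mul]
    field_simp
    simp [neg_div]
  have c1 : ∮ w in C(0, r), w⁻¹ = 2 * Real.pi * Complex.I := by
    have := circleIntegral.integral_sub_inv_of_mem_ball (c := 0) (w := 0) (R := r) (by simpa using hr)
    simpa using this
  rw [e]
  rcases eq_or_ne ζ 0 with rfl | hζ
  · rw [if_neg (by simpa using hr.le)]
    have := circleIntegral.integral_sub_zpow_of_ne (n := -2) (by norm_num) 0 0 r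
    have e2 : ∀ w : ℂ, w⁻¹ * (w - 0)⁻¹ = (w - 0) ^ (-2 : ℤ) := by
      intro w
      rw [zpow_neg, sub_zero, ← mul_inv]; congr 1; norm_cast; ring
    simp only [e2, this, mul_zero]
  · have hcont : ∀ {ζ' : ℂ}, ‖ζ'‖ ≠ r → CircleIntegrable (fun w => (w - ζ')⁻¹) 0 r := by
      intro ζ' h'
      apply ContinuousOn.circleIntegrable hr.le
      intro w hw
      refine ContinuousAt.continuousWithinAt (ContinuousAt.inv₀ (by fun_prop) ?_)
      intro h0
      apply h'
      rw [← sub_eq_zero.1 h0]; simpa using hw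
    have e2 : ∮ w in C(0, r), w⁻¹ * (w - ζ)⁻¹ = ζ⁻¹ * ((∮ w in C(0, r), (w - ζ)⁻¹) - ∮ w in C(0, r), w⁻¹) := by
      have hz := hcont (ζ' := 0) (by simpa using hr.ne)
      simp only [sub_zero] at hz
      rw [← circleIntegral.integral_sub (hcont h) hz,
        ← circleIntegral.integral_const_mul]
      apply circleIntegral.integral_congr hr.le
      intro w hw
      have hw' : ‖w‖ = r := by simpa using hw
      have h1 : w ≠ 0 := by rintro rfl; simp at hw'; linarith
      have h2 : w - ζ ≠ 0 := by intro h0; rw [← sub_eq_zero.1 h0] at h; exact h hw'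
      dsimp only
      field_simp
      ring
    rw [e2, c1]
    split_ifs with hlt
    · have : ∮ w in C(0, r), (w - ζ)⁻¹ = 0 := by
        apply DiffContOnCl.circleIntegral_eq_zero hr.le
        have hne : ∀ w ∈ Metric.closedBall (0 : ℂ) r, w - ζ ≠ 0 := by
          intro w hw h0
          rw [sub_eq_zero.1 h0] at hw
          simp at hw; linarith
        refine DifferentiableOn.diffContOnCl ?_
        rw [closure_ball _ hr.ne']
        intro w hw
        exact (((differentiableAt_id.sub_const ζ).inv (hne w hw))).differentiableWithinAt
      rw [this]
      linear_combination (2 * Real.pi * ζ⁻¹ : ℂ) * Complex.I_mul_I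
    · have : ‖ζ‖ < r := lt_of_le_of_ne (not_lt.1 hlt) h
      rw [circleIntegral.integral_sub_inv_of_mem_ball (by simpa using this)]
      ring

/-- In polar coordinates only circles of radius below `|ζ|` contribute, each giving `-2π/ζ`.
Integrating up to `min ε |ζ|` produces the two cases of `truncCauchy`. -/
theorem integral_ball_inv_sub {ε : ℝ} (hε : 0 < ε) (ζ : ℂ) :
    ∫ w in Metric.ball 0 ε, (w - ζ)⁻¹ = -(Real.pi * ε ^ 2) * truncCauchy ε ζ := by
  set f : ℂ → ℂ := (Metric.ball 0 ε).indicator fun w => (w - ζ)⁻¹ with hf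
  have hfm : Measurable f := by
    rw [hf]; exact Measurable.indicator (by fun_prop) measurableSet_ball
  have hfi : Integrable f := by
    rw [hf, integrable_indicator_iff measurableSet_ball]
    have h1 : LocallyIntegrable fun w : ℂ => (w - ζ)⁻¹ := by
      rw [locallyIntegrable_iff]
      intro K hK
      have := locallyIntegrable_iff.1 locallyIntegrable_inv ((fun w => w - ζ) '' K) (hK.image (by fun_prop))
      exact ((measurePreserving_sub_right volume ζ).integrableOn_image
        (MeasurableEquiv.subRight ζ).measurableEmbedding).1 this
    exact (h1.integrableOn_isCompact (isCompact_closedBall 0 ε)).mono_set Metric.ball_subset_closedBall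
  have hpol : IntegrableOn (fun p : ℝ × ℝ => p.1 • f (Complex.polarCoord.symm p))
      (Ioi (0 : ℝ) ×ˢ Ioo (-Real.pi) Real.pi) := by
    refine ⟨?_, ?_⟩
    · refine Measurable.aestronglyMeasurable ?_
      refine measurable_fst.smul (hfm.comp ?_)
      have e : (fun p : ℝ × ℝ => Complex.polarCoord.symm p) =
        fun p => (p.1 : ℂ) * (Real.cos p.2 + Real.sin p.2 * Complex.I) := by
        ext p; exact Complex.polarCoord_symm_apply p
      change Measurable (fun p : ℝ × ℝ => Complex.polarCoord.symm p)
      rw [e]; fun_prop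
    · have h := Complex.lintegral_comp_polarCoord_symm fun w => ‖f w‖ₑ
      rw [hasFiniteIntegral_iff_enorm]
      refine lt_of_le_of_lt (le_of_eq ?_) hfi.2
      rw [← h, polarCoord_target]
      refine setLIntegral_congr_fun (measurableSet_Ioi.prod measurableSet_Ioo) ?_
      rintro p ⟨hp, -⟩
      have hp' : 0 < p.1 := hp
      simp only [enorm_smul, smul_eq_mul]
      rw [Real.enorm_eq_ofReal hp'.le]
  rw [← integral_indicator measurableSet_ball]
  change ∫ w, f w = _
  rw [← Complex.integral_comp_polarCoord_symm, polarCoord_target, Measure.volume_eq_prod,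
    setIntegral_prod _ (by rwa [← Measure.volume_eq_prod])]
  have inner : ∀ᵐ r : ℝ, r ∈ Ioi (0 : ℝ) → ∫ θ in Ioo (-Real.pi) Real.pi, r • f (Complex.polarCoord.symm (r, θ)) =
      (Ioc 0 (min ε ‖ζ‖)).indicator (fun r : ℝ => (r : ℂ) * (-(2 * Real.pi) * ζ⁻¹)) r := by
    have ae1 : ∀ᵐ r : ℝ, r ≠ ε := by simp [ae_iff]
    have ae2 : ∀ᵐ r : ℝ, r ≠ ‖ζ‖ := by simp [ae_iff]
    filter_upwards [ae1, ae2] with r h1 h2 hr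
    have hr0 : 0 < r := hr
    have hcm : ∀ θ : ℝ, Complex.polarCoord.symm (r, θ) = circleMap 0 r θ := by
      intro θ
      rw [Complex.polarCoord_symm_apply, circleMap_zero, Complex.exp_mul_I, Complex.ofReal_cos, Complex.ofReal_sin]
    by_cases hlt : r < ε
    · have e1 : ∀ θ : ℝ, r • f (Complex.polarCoord.symm (r, θ)) = (r : ℂ) * (circleMap 0 r θ - ζ)⁻¹ := by
        intro θ
        rw [hcm, hf, indicator_of_mem, Complex.real_smul]
        simpa [abs_of_pos hr0] using hlt
      simp only [e1]
      rw [integral_const_mul, ← integral_Ioc_eq_integral_Ioo,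
        ← intervalIntegral.integral_of_le (by linarith [Real.pi_pos])]
      have hper : Function.Periodic (fun θ : ℝ => (circleMap 0 r θ - ζ)⁻¹) (2 * Real.pi) := by
        intro θ
        simp only [periodic_circleMap 0 r θ]
      have := hper.intervalIntegral_add_eq (-Real.pi) 0
      rw [show -Real.pi + 2 * Real.pi = Real.pi by ring, zero_add] at this
      rw [this, integral_circle_inv_sub hr0 h2.symm]
      by_cases hz : r < ‖ζ‖
      · rw [if_pos hz, indicator_of_mem (show r ∈ Ioc 0 (min ε ‖ζ‖) from ⟨hr0, (lt_min hlt hz).le⟩)]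
      · rw [if_neg hz, indicator_of_notMem, mul_zero]
        rintro ⟨-, h⟩
        exact hz (lt_of_le_of_ne (h.trans (min_le_right _ _)) h2)
    · have e1 : ∀ θ : ℝ, r • f (Complex.polarCoord.symm (r, θ)) = 0 := by
        intro θ
        rw [hcm, hf, indicator_of_notMem, smul_zero]
        simpa [abs_of_pos hr0] using hlt
      simp only [e1]
      rw [indicator_of_notMem, integral_zero]
      rintro ⟨-, h⟩
      exact hlt (lt_of_le_of_ne (h.trans (min_le_left _ _)) h1)
  rw [setIntegral_congr_ae measurableSet_Ioi inner, setIntegral_indicator measurableSet_Ioc,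
    show Ioi (0 : ℝ) ∩ Ioc 0 (min ε ‖ζ‖) = Ioc 0 (min ε ‖ζ‖) from inter_eq_right.2 Ioc_subset_Ioi_self,
    ← intervalIntegral.integral_of_le (le_min hε.le (norm_nonneg _)), intervalIntegral.integral_mul_const]
  rw [intervalIntegral.integral_ofReal, integral_id]
  have hε' : (ε : ℂ) ≠ 0 := Complex.ofReal_ne_zero.2 hε.ne'
  unfold truncCauchy
  split_ifs with h
  · rw [min_eq_right h]
    rcases eq_or_ne ζ 0 with rfl | hz
    · simp
    · have : (‖ζ‖ : ℂ) ^ 2 = ζ * conj ζ := by rw [Complex.mul_conj, Complex.normSq_eq_norm_sq]; norm_cast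
      push_cast
      field_simp
      linear_combination (-1 : ℂ) * this
  · rw [min_eq_left (not_le.1 h).le]
    push_cast
    ring

end BukhgeimDisc


namespace BukhgeimDisc

/-! ### Truncated Beurling integrals as ball averages -/

theorem norm_truncCauchy_sub_le {ε : ℝ} (hε : 0 < ε) (z w : ℂ) :
    ‖truncCauchy ε z - truncCauchy ε w‖ ≤ 3 / ε ^ 2 * ‖z - w‖ := by
  have hε' : (ε : ℂ) ≠ 0 := Complex.ofReal_ne_zero.2 hε.ne'
  -- Points on opposite sides of the circle: `ε² - |z|²` is at most `2ε(|w|-|z|)`, which costs the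
  -- `2` in the constant `3`.
  have mixed : ∀ z w : ℂ, ‖z‖ ≤ ε → ε < ‖w‖ → ‖conj z / (ε : ℂ) ^ 2 - w⁻¹‖ ≤ 3 / ε ^ 2 * ‖z - w‖ := by
    intro z w hz hw
    have hw0 : w ≠ 0 := norm_pos_iff.1 (hε.trans hw)
    have e : conj z / (ε : ℂ) ^ 2 - w⁻¹ =
        (conj z * (w - z) + ((‖z‖ ^ 2 - ε ^ 2 : ℝ) : ℂ)) / ((ε : ℂ) ^ 2 * w) := by
      have : ((‖z‖ ^ 2 - ε ^ 2 : ℝ) : ℂ) = z * conj z - (ε : ℂ) ^ 2 := by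
        rw [Complex.mul_conj, Complex.normSq_eq_norm_sq]; push_cast; rfl
      rw [this]
      field_simp
      ring
    rw [e, norm_div, norm_mul, norm_pow, Complex.norm_real, Real.norm_of_nonneg hε.le,
      div_le_iff₀ (by positivity)]
    have h1 : ‖w‖ - ‖z‖ ≤ ‖z - w‖ := by rw [norm_sub_rev]; exact norm_sub_norm_le _ _
    have h2 : ‖((‖z‖ ^ 2 - ε ^ 2 : ℝ) : ℂ)‖ ≤ 2 * ε * ‖z - w‖ := by
      rw [Complex.norm_real, Real.norm_of_nonpos (by nlinarith [norm_nonneg z])]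
      nlinarith [norm_nonneg z]
    calc ‖conj z * (w - z) + ((‖z‖ ^ 2 - ε ^ 2 : ℝ) : ℂ)‖
        ≤ ‖z‖ * ‖z - w‖ + 2 * ε * ‖z - w‖ := by
          refine (norm_add_le _ _).trans (add_le_add ?_ h2)
          rw [norm_mul, Complex.norm_conj, norm_sub_rev]
      _ ≤ 3 * ‖w‖ * ‖z - w‖ := by nlinarith [norm_nonneg (z - w)]
      _ = 3 / ε ^ 2 * ‖z - w‖ * (ε ^ 2 * ‖w‖) := by field_simp
  unfold truncCauchy
  split_ifs with h1 h2 h2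
  · rw [← sub_div, ← map_sub, norm_div, Complex.norm_conj, norm_pow, Complex.norm_real,
      Real.norm_of_nonneg hε.le, div_mul_eq_mul_div]
    gcongr
    linarith [norm_nonneg (z - w)]
  · exact mixed z w h1 (not_le.1 h2)
  · rw [norm_sub_rev, norm_sub_rev z]
    exact mixed w z h2 (not_le.1 h1)
  · rw [not_le] at h1 h2
    have hz0 : z ≠ 0 := norm_pos_iff.1 (hε.trans h1)
    have hw0 : w ≠ 0 := norm_pos_iff.1 (hε.trans h2)
    rw [inv_sub_inv hz0 hw0, norm_div, norm_mul, norm_sub_rev, div_le_iff₀ (by positivity)]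
    have : ε ^ 2 ≤ ‖z‖ * ‖w‖ := by nlinarith
    calc ‖z - w‖ = 1 / ε ^ 2 * ‖z - w‖ * ε ^ 2 := by field_simp
      _ ≤ 3 / ε ^ 2 * ‖z - w‖ * (‖z‖ * ‖w‖) := by gcongr; norm_num

theorem lipschitzWith_truncCauchy {ε : ℝ} (hε : 0 < ε) (z : ℂ) :
    LipschitzWith (3 / ε ^ 2).toNNReal fun ξ => truncCauchy ε (z - ξ) := by
  refine LipschitzWith.of_dist_le_mul fun x y => ?_
  rw [dist_eq_norm, dist_eq_norm, Real.coe_toNNReal _ (by positivity)]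
  refine (norm_truncCauchy_sub_le hε _ _).trans_eq ?_
  rw [sub_sub_sub_cancel_left, norm_sub_rev]

theorem hasWirtingerAt_sub_left (z ξ : ℂ) : HasWirtingerAt (fun ξ => z - ξ) (-1) 0 ξ := by
  unfold HasWirtingerAt
  convert! (hasFDerivAt_id (𝕜 := ℝ) ξ).const_sub z using 1
  ext v; simp

/-- Inside the ball the function is antiholomorphic, so its `∂`-derivative vanishes there; outside
it is the Beurling kernel. Thus `∂` of the averaged Cauchy kernel is exactly the truncated Beurling
kernel, the circle being a null set. -/
theorem ae_hasWirtingerAt_truncCauchy {ε : ℝ} (hε : 0 < ε) (z : ℂ) :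
    ∀ᵐ ξ, HasWirtingerAt (fun ξ => truncCauchy ε (z - ξ))
      ((Metric.ball z ε)ᶜ.indicator (fun ξ => 1 / (z - ξ) ^ 2) ξ)
      ((Metric.ball z ε).indicator (fun _ => -1 / (ε : ℂ) ^ 2) ξ) ξ := by
  have hs : ∀ᵐ ξ : ℂ, ξ ∉ Metric.sphere z ε := by
    simp only [ae_iff, not_not]; exact Measure.addHaar_sphere volume z ε
  filter_upwards [hs] with ξ hξ
  have hne : dist ξ z ≠ ε := fun h => hξ h
  have hc : Continuous fun ξ : ℂ => ‖z - ξ‖ := by fun_prop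
  have hd : ∀ ξ : ℂ, dist ξ z = ‖z - ξ‖ := fun ξ => by rw [dist_eq_norm, norm_sub_rev]
  rw [hd] at hne
  rcases lt_or_gt_of_ne hne with h | h
  · have hmem : ξ ∈ Metric.ball z ε := by rw [Metric.mem_ball, hd]; exact h
    rw [indicator_of_notMem (by simpa using hmem), indicator_of_mem hmem]
    have h1 : HasWirtingerAt (fun ξ => conj (z - ξ) / (ε : ℂ) ^ 2) 0 (-1 / (ε : ℂ) ^ 2) ξ := by
      convert! ((hasWirtingerAt_sub_left z ξ).conj_comp).mul (HasWirtingerAt.const (((ε : ℂ) ^ 2)⁻¹) ξ) using 1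
      · simp
      · simp [neg_div]
    refine HasFDerivAt.congr_of_eventuallyEq h1 ?_
    filter_upwards [hc.continuousAt.eventually_lt_const h] with x hx
    rw [truncCauchy, if_pos hx.le]
  · have hmem : ξ ∉ Metric.ball z ε := by rw [Metric.mem_ball, hd]; exact not_lt.2 h.le
    have h0 : z - ξ ≠ 0 := norm_pos_iff.1 (hε.trans h)
    rw [indicator_of_mem (by simpa using hmem), indicator_of_notMem hmem]
    have h1 := HasWirtingerAt.comp_holo (hasDerivAt_inv h0) (hasWirtingerAt_sub_left z ξ)
    have h2 : HasWirtingerAt (fun ξ => (z - ξ)⁻¹) (1 / (z - ξ) ^ 2) 0 ξ := by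
      convert! h1 using 1 <;> simp
    refine HasFDerivAt.congr_of_eventuallyEq h2 ?_
    filter_upwards [hc.continuousAt.eventually_const_lt h] with x hx
    rw [truncCauchy, if_neg (not_le.2 hx)]

theorem integral_truncCauchy_mul_dz {ε : ℝ} (hε : 0 < ε) {φ : ℂ → ℂ} (hφ : IsTest φ) (z : ℂ) :
    ∫ ξ, truncCauchy ε (z - ξ) * dz φ ξ = -∫ ξ in (Metric.ball z ε)ᶜ, φ ξ / (z - ξ) ^ 2 := by
  rw [integral_lipschitz_mul_dz (lipschitzWith_truncCauchy hε z) (ae_hasWirtingerAt_truncCauchy hε z) hφ,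
    ← integral_indicator measurableSet_ball.compl]
  congr 2 with ξ
  by_cases h : ξ ∈ (Metric.ball z ε)ᶜ
  · rw [indicator_of_mem h, indicator_of_mem h]; ring
  · rw [indicator_of_notMem h, indicator_of_notMem h, zero_mul]

/-! ### Fubini for the Cauchy kernel -/

theorem lintegral_ball_inv_le (R : ℝ) (ξ : ℂ) :
    ∫⁻ z in Metric.ball 0 R, ‖(z - ξ)⁻¹‖ₑ ≤ ENNReal.ofReal (2 * Real.pi) + volume (Metric.ball (0 : ℂ) R) := by
  have h := lintegral_ball_rpow (s := 1) ξ (by norm_num) one_pos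
  have hpt : ∀ z, ‖(z - ξ)⁻¹‖ₑ ≤
      (Metric.ball ξ 1).indicator (fun z => ENNReal.ofReal (‖ξ - z‖ ^ (-1 : ℝ))) z + 1 := by
    intro z
    rw [← ofReal_norm, norm_inv, norm_sub_rev, ← Real.rpow_neg_one]
    by_cases hz : z ∈ Metric.ball ξ 1
    · rw [indicator_of_mem hz]; exact le_self_add
    · refine le_trans ?_ le_add_self
      rw [Metric.mem_ball, dist_eq_norm, norm_sub_rev, not_lt] at hz
      rw [Real.rpow_neg_one]
      exact ENNReal.ofReal_le_one.2 (inv_le_one_of_one_le₀ hz)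
  calc _ ≤ ∫⁻ z in Metric.ball 0 R,
        ((Metric.ball ξ 1).indicator (fun z => ENNReal.ofReal (‖ξ - z‖ ^ (-1 : ℝ))) z + 1) :=
        lintegral_mono hpt
    _ = (∫⁻ z in Metric.ball 0 R, (Metric.ball ξ 1).indicator (fun z => ENNReal.ofReal (‖ξ - z‖ ^ (-1 : ℝ))) z)
        + volume (Metric.ball (0 : ℂ) R) := by
        rw [lintegral_add_right _ measurable_const]; simp
    _ ≤ _ := by
        gcongr
        refine (setLIntegral_le_lintegral _ _).trans ?_
        rw [lintegral_indicator measurableSet_ball, h]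
        norm_num

theorem integrable_prod_cauchy {f ψ : ℂ → ℂ} {M R : ℝ} (hf : Integrable f)
    (hm : AEStronglyMeasurable ψ) (hb : ∀ z, ‖ψ z‖ ≤ M) (hs : ∀ z, z ∉ Metric.ball 0 R → ψ z = 0) :
    Integrable (fun x : ℂ × ℂ => ψ x.1 * (f x.2 * (x.1 - x.2)⁻¹)) (volume.prod volume) := by
  have hmeas : AEStronglyMeasurable (fun x : ℂ × ℂ => ψ x.1 * (f x.2 * (x.1 - x.2)⁻¹)) (volume.prod volume) :=
    hm.comp_fst.mul (hf.1.comp_snd.mul (by fun_prop))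
  refine ⟨hmeas, ?_⟩
  rw [hasFiniteIntegral_iff_enorm, lintegral_prod_symm _ hmeas.enorm]
  have hM : ∀ z, ‖ψ z‖ₑ ≤ (Metric.ball 0 R).indicator (fun _ => ENNReal.ofReal M) z := by
    intro z
    by_cases hz : z ∈ Metric.ball 0 R
    · rw [indicator_of_mem hz, ← ofReal_norm]; exact ENNReal.ofReal_le_ofReal (hb z)
    · rw [hs z hz, enorm_zero]; exact zero_le
  calc ∫⁻ y, ∫⁻ x, ‖ψ x * (f y * (x - y)⁻¹)‖ₑ
      ≤ ∫⁻ y, ‖f y‖ₑ * (ENNReal.ofReal M * (ENNReal.ofReal (2 * Real.pi) + volume (Metric.ball (0 : ℂ) R))) := by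
        refine lintegral_mono fun y => ?_
        calc _ ≤ ∫⁻ x, ‖f y‖ₑ * (ENNReal.ofReal M * (Metric.ball 0 R).indicator (fun x => ‖(x - y)⁻¹‖ₑ) x) := by
              refine lintegral_mono fun x => ?_
              rw [enorm_mul, enorm_mul, mul_left_comm]
              have := hM x
              by_cases hx : x ∈ Metric.ball 0 R
              · rw [indicator_of_mem hx] at this ⊢; gcongr
              · rw [indicator_of_notMem hx] at this ⊢; simp [nonpos_iff_eq_zero.1 this]
          _ ≤ _ := by
              have h1 : Measurable fun x : ℂ => (Metric.ball 0 R).indicator (fun x => ‖(x - y)⁻¹‖ₑ) x :=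
                Measurable.indicator (by fun_prop) measurableSet_ball
              rw [lintegral_const_mul _ (h1.const_mul _), lintegral_const_mul _ h1,
                lintegral_indicator measurableSet_ball]
              gcongr
              exact lintegral_ball_inv_le R y
    _ < ⊤ := by
        rw [lintegral_mul_const'']
        · refine ENNReal.mul_lt_top hf.2 ?_
          finiteness
        · exact hf.1.enorm

theorem integral_mul_cauchy_swap {f ψ : ℂ → ℂ} {M R : ℝ} (hf : Integrable f)
    (hm : AEStronglyMeasurable ψ) (hb : ∀ z, ‖ψ z‖ ≤ M) (hs : ∀ z, z ∉ Metric.ball 0 R → ψ z = 0) :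
    ∫ z, ψ z * ∫ ξ, f ξ * (z - ξ)⁻¹ = ∫ ξ, f ξ * ∫ z, ψ z * (z - ξ)⁻¹ := by
  have h := integral_integral_swap (f := fun z ξ => ψ z * (f ξ * (z - ξ)⁻¹))
    (integrable_prod_cauchy hf hm hb hs)
  simp only [integral_const_mul] at h
  rw [h]
  congr 1 with ξ
  rw [← integral_const_mul]
  congr 1 with z
  ring

theorem planeCauchy_eq (φ : ℂ → ℂ) (z : ℂ) :
    planeCauchy φ z = (1 / Real.pi : ℂ) * ∫ ξ, φ ξ * (z - ξ)⁻¹ := by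
  rw [planeCauchy, kconv_eq]
  simp only [mul_comm]

/-- Divided by `πε²`, this identifies the truncated Beurling integral with the mean of the full
transform over the ball. Fubini moves the averaging onto the Cauchy kernel, giving `truncCauchy`,
and an integration by parts gives the truncated kernel. No maximal truncation estimate is then
needed for principal values. -/
theorem integral_ball_testBeurling {ε : ℝ} (hε : 0 < ε) {φ : ℂ → ℂ} (hφ : IsTest φ) (z : ℂ) :
    ∫ w in Metric.ball z ε, testBeurling φ w = -(ε ^ 2 : ℂ) * ∫ ξ in (Metric.ball z ε)ᶜ, φ ξ / (z - ξ) ^ 2 := by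
  have hpi : (Real.pi : ℂ) ≠ 0 := Complex.ofReal_ne_zero.2 Real.pi_ne_zero
  have hsub : Metric.ball z ε ⊆ Metric.ball 0 (‖z‖ + ε) := by
    intro w hw
    rw [mem_ball_zero_iff]
    rw [Metric.mem_ball, dist_eq_norm] at hw
    calc ‖w‖ = ‖z + (w - z)‖ := by congr 1; ring
      _ ≤ ‖z‖ + ‖w - z‖ := norm_add_le _ _
      _ < _ := by linarith
  have hsw := integral_mul_cauchy_swap (ψ := (Metric.ball z ε).indicator fun _ => 1) (M := 1)
    (R := ‖z‖ + ε) hφ.dz.integrable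
    ((measurable_const.indicator measurableSet_ball).aestronglyMeasurable)
    (fun w => by
      refine (norm_indicator_le_norm_self _ _).trans ?_; simp)
    (fun w hw => indicator_of_notMem (fun h => hw (hsub h)) _)
  have e1 : ∀ (F : ℂ → ℂ), ∫ w, (Metric.ball z ε).indicator (fun _ => (1 : ℂ)) w * F w = ∫ w in Metric.ball z ε, F w := by
    intro F
    rw [← integral_indicator measurableSet_ball]
    congr 1 with w
    by_cases h : w ∈ Metric.ball z ε <;> simp [h]
  rw [e1] at hsw
  have e2 : ∀ ξ, ∫ w, (Metric.ball z ε).indicator (fun _ => (1 : ℂ)) w * (w - ξ)⁻¹ =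
      (Real.pi * ε ^ 2) * truncCauchy ε (z - ξ) := by
    intro ξ
    rw [e1]
    have := integral_ball_inv_sub hε (ξ - z)
    have e3 : ∫ w in Metric.ball z ε, (w - ξ)⁻¹ = ∫ w in Metric.ball 0 ε, (w - (ξ - z))⁻¹ := by
      rw [← integral_indicator measurableSet_ball, ← integral_indicator measurableSet_ball,
        ← integral_add_right_eq_self _ z]
      congr 1 with w
      by_cases h : w ∈ Metric.ball 0 ε
      · rw [indicator_of_mem h, indicator_of_mem (by simpa using h)]; congr 1; ring
      · rw [indicator_of_notMem h, indicator_of_notMem (by simpa using h)]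
    rw [e3, this, ← neg_sub z ξ, truncCauchy_neg]; ring
  simp only [e2] at hsw
  simp only [testBeurling, planeCauchy_eq]
  rw [integral_const_mul, hsw]
  have e4 : ∀ ξ, dz φ ξ * (Real.pi * ε ^ 2 * truncCauchy ε (z - ξ)) =
      (Real.pi * ε ^ 2) * (truncCauchy ε (z - ξ) * dz φ ξ) := fun ξ => by ring
  simp only [e4]
  rw [integral_const_mul, integral_truncCauchy_mul_dz hε hφ]
  field_simp

end BukhgeimDisc


namespace BukhgeimDisc

/-! ### The Beurling transform in `L^p` -/

theorem IsTest.sub {φ ψ : ℂ → ℂ} (hφ : IsTest φ) (hψ : IsTest ψ) : IsTest (φ - ψ) :=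
  ⟨hφ.1.sub hψ.1, hφ.2.sub hψ.2⟩

theorem planeCauchy_sub {φ ψ : ℂ → ℂ} (hφ : IsTest φ) (hψ : IsTest ψ) :
    planeCauchy (φ - ψ) = planeCauchy φ - planeCauchy ψ := by
  ext z
  simp only [planeCauchy, kconv, Pi.sub_apply, mul_sub]
  rw [integral_sub (integrable_kconv locallyIntegrable_inv hφ.continuous hφ.2 z)
    (integrable_kconv locallyIntegrable_inv hψ.continuous hψ.2 z), mul_sub]

theorem dz_sub {φ ψ : ℂ → ℂ} (hφ : Differentiable ℝ φ) (hψ : Differentiable ℝ ψ) :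
    dz (φ - ψ) = dz φ - dz ψ := by
  ext z
  simp only [dz, Pi.sub_apply, fderiv_sub (hφ z) (hψ z), sub_apply]
  ring

theorem testBeurling_sub {φ ψ : ℂ → ℂ} (hφ : IsTest φ) (hψ : IsTest ψ) :
    testBeurling (φ - ψ) = testBeurling φ - testBeurling ψ := by
  rw [testBeurling, dz_sub hφ.differentiable hψ.differentiable, planeCauchy_sub hφ.dz hψ.dz]; rfl

theorem tendsto_integral_mul_of_eLpNorm {α : Type*} [MeasurableSpace α] {μ : Measure α} {p q : ℝ}
    (hpq : p.HolderConjugate q) {u : ℕ → α → ℂ} {u₀ K : α → ℂ}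
    (hu : ∀ n, MemLp (u n) (ENNReal.ofReal p) μ) (hu₀ : MemLp u₀ (ENNReal.ofReal p) μ)
    (hK : MemLp K (ENNReal.ofReal q) μ)
    (h : Tendsto (fun n => eLpNorm (u₀ - u n) (ENNReal.ofReal p) μ) atTop (𝓝 0)) :
    Tendsto (fun n => ∫ x, u n x * K x ∂μ) atTop (𝓝 (∫ x, u₀ x * K x ∂μ)) := by
  have := hpq.ennrealOfReal
  rw [tendsto_iff_edist_tendsto_0]
  have hlim : Tendsto (fun n => eLpNorm (u₀ - u n) (ENNReal.ofReal p) μ * eLpNorm K (ENNReal.ofReal q) μ)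
      atTop (𝓝 0) := by
    simpa using ENNReal.Tendsto.mul_const h (Or.inr hK.2.ne)
  refine tendsto_of_tendsto_of_tendsto_of_le_of_le tendsto_const_nhds hlim (fun n => zero_le) fun n => ?_
  have i1 : Integrable (fun x => u n x * K x) μ := (hu n).integrable_mul hK
  have i2 : Integrable (fun x => u₀ x * K x) μ := hu₀.integrable_mul hK
  dsimp only
  rw [edist_comm, edist_eq_enorm_sub, ← integral_sub i2 i1]
  refine (enorm_integral_le_lintegral_enorm _).trans ?_
  have h1 := eLpNorm_smul_le_mul_eLpNorm (r := 1) hK.1 (hu₀.sub (hu n)).1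
    (p := ENNReal.ofReal p) (q := ENNReal.ofReal q)
  rw [eLpNorm_one_eq_lintegral_enorm] at h1
  refine le_trans (le_of_eq ?_) h1
  congr 1 with x
  simp [sub_mul]

theorem memLp_testBeurling {p q : ℝ} (hp : 2 < p) (hpq : p.HolderConjugate q) {φ : ℂ → ℂ} (hφ : IsTest φ) :
    MemLp (testBeurling φ) (ENNReal.ofReal p) :=
  ⟨(continuous_testBeurling hφ).aestronglyMeasurable,
    (eLpNorm_testBeurling_le hp hpq hφ).trans_lt
      (ENNReal.mul_lt_top (by have := hpq.symm.pos; finiteness) (hφ.memLp _).2)⟩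

/-- `g` is the `L^p` Beurling transform of `f`, obtained from test functions. -/
def IsLpBeurling (p : ℝ) (f g : ℂ → ℂ) : Prop :=
  MemLp g (ENNReal.ofReal p) ∧ ∃ φ : ℕ → ℂ → ℂ, (∀ n, IsTest (φ n)) ∧
    Tendsto (fun n => eLpNorm (f - φ n) (ENNReal.ofReal p)) atTop (𝓝 0) ∧
    Tendsto (fun n => eLpNorm (g - testBeurling (φ n)) (ENNReal.ofReal p)) atTop (𝓝 0)

theorem exists_fast_test_seq {p : ℝ≥0∞} (hp : p ≠ ⊤) (hp1 : 1 ≤ p) {f : ℂ → ℂ} (hf : MemLp f p) :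
    ∃ φ : ℕ → ℂ → ℂ, (∀ n, IsTest (φ n)) ∧ ∀ n, eLpNorm (f - φ n) p ≤ (2⁻¹ : ℝ≥0∞) ^ n := by
  choose φ h1 h2 h3 using fun n : ℕ => hf.exist_eLpNorm_sub_le hp hp1 (ε := (2⁻¹ : ℝ) ^ n) (by positivity)
  refine ⟨φ, fun n => ⟨h2 n, h1 n⟩, fun n => (h3 n).trans_eq ?_⟩
  rw [ENNReal.ofReal_pow (by norm_num), ENNReal.ofReal_inv_of_pos (by norm_num)]
  simp

theorem exists_isLpBeurling_of_bound {p : ℝ} (hp1 : 1 ≤ ENNReal.ofReal p) {A : ℝ≥0∞} (hA : A ≠ ⊤)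
    (hb : ∀ φ, IsTest φ → eLpNorm (testBeurling φ) (ENNReal.ofReal p) ≤ A * eLpNorm φ (ENNReal.ofReal p))
    {f : ℂ → ℂ} (hf : MemLp f (ENNReal.ofReal p)) :
    ∃ g, IsLpBeurling p f g ∧ eLpNorm g (ENNReal.ofReal p) ≤ A * eLpNorm f (ENNReal.ofReal p) := by
  obtain ⟨φ, hφ, h3⟩ := exists_fast_test_seq ENNReal.ofReal_ne_top hp1 hf
  have hlim : Tendsto (fun n => eLpNorm (f - φ n) (ENNReal.ofReal p)) atTop (𝓝 0) :=
    tendsto_of_tendsto_of_tendsto_of_le_of_le tendsto_const_nhds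
      (ENNReal.tendsto_pow_atTop_nhds_zero_of_lt_one (by norm_num)) (fun n => zero_le) h3
  have hB : ∀ n, MemLp (testBeurling (φ n)) (ENNReal.ofReal p) := fun n =>
    ⟨(continuous_testBeurling (hφ n)).aestronglyMeasurable,
      (hb _ (hφ n)).trans_lt (ENNReal.mul_lt_top hA.lt_top ((hφ n).memLp _).2)⟩
  have hdiff : ∀ n m, eLpNorm (testBeurling (φ n) - testBeurling (φ m)) (ENNReal.ofReal p) ≤
      A * (eLpNorm (f - φ n) (ENNReal.ofReal p) + eLpNorm (f - φ m) (ENNReal.ofReal p)) := by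
    intro n m
    rw [← testBeurling_sub (hφ n) (hφ m)]
    refine (hb _ ((hφ n).sub (hφ m))).trans ?_
    gcongr
    have e : φ n - φ m = (f - φ m) - (f - φ n) := by abel
    rw [e, add_comm]
    exact eLpNorm_sub_le (hf.sub ((hφ m).memLp _)).1 (hf.sub ((hφ n).memLp _)).1 hp1
  -- The factors `A + 1` and `4`, instead of `A` and `2`, make the Cauchy estimate below strict even
  -- when `A = 0`.
  have hsum : ∑' n : ℕ, (A + 1) * (4 * (2⁻¹ : ℝ≥0∞) ^ n) ≠ ⊤ := by
    rw [ENNReal.tsum_mul_left, ENNReal.tsum_mul_left, ENNReal.tsum_geometric_two]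
    finiteness
  have hcau : ∀ N n m : ℕ, N ≤ n → N ≤ m →
      eLpNorm (testBeurling (φ n) - testBeurling (φ m)) (ENNReal.ofReal p) < (A + 1) * (4 * (2⁻¹ : ℝ≥0∞) ^ N) := by
    intro N n m hn hm
    have hmono : ∀ k, N ≤ k → eLpNorm (f - φ k) (ENNReal.ofReal p) ≤ (2⁻¹ : ℝ≥0∞) ^ N := fun k hk =>
      (h3 k).trans (pow_le_pow_of_le_one zero_le (by norm_num) hk)
    have hpos : (2⁻¹ : ℝ≥0∞) ^ N ≠ 0 := pow_ne_zero _ (by simp)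
    have hfin : (2⁻¹ : ℝ≥0∞) ^ N ≠ ⊤ := by finiteness
    generalize (2⁻¹ : ℝ≥0∞) ^ N = c at *
    calc _ ≤ A * (c + c) := (hdiff n m).trans (by gcongr; exacts [hmono n hn, hmono m hm])
      _ ≤ (A + 1) * (2 * c) := by
          rw [two_mul]; gcongr; exact le_self_add
      _ < _ := by
          refine (ENNReal.mul_lt_mul_iff_right (by simp) (by finiteness)).2 ?_
          exact (ENNReal.mul_lt_mul_iff_left hpos hfin).2 (by norm_num)
  obtain ⟨g, hg, hglim⟩ := Lp.cauchy_complete_eLpNorm (μ := (volume : Measure ℂ)) hp1 hB hsum hcau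
  have hglim' : Tendsto (fun n => eLpNorm (g - testBeurling (φ n)) (ENNReal.ofReal p)) atTop (𝓝 0) := by
    simpa only [eLpNorm_sub_comm] using hglim
  refine ⟨g, ⟨hg, φ, hφ, hlim, hglim'⟩, ?_⟩
  have hr : Tendsto (fun n => A * (eLpNorm f (ENNReal.ofReal p) + eLpNorm (f - φ n) (ENNReal.ofReal p)) +
      eLpNorm (g - testBeurling (φ n)) (ENNReal.ofReal p)) atTop (𝓝 (A * eLpNorm f (ENNReal.ofReal p))) := by
    have := (ENNReal.Tendsto.const_mul (hlim.const_add (eLpNorm f (ENNReal.ofReal p))) (Or.inr hA)).add hglim'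
    simpa using this
  refine ge_of_tendsto' hr fun n => ?_
  have h1 : eLpNorm g (ENNReal.ofReal p) ≤
      eLpNorm (g - testBeurling (φ n)) (ENNReal.ofReal p) + eLpNorm (testBeurling (φ n)) (ENNReal.ofReal p) := by
    have := eLpNorm_add_le (hg.sub (hB n)).1 (hB n).1 hp1
    rwa [sub_add_cancel] at this
  have h2 : eLpNorm (φ n) (ENNReal.ofReal p) ≤
      eLpNorm f (ENNReal.ofReal p) + eLpNorm (f - φ n) (ENNReal.ofReal p) := by
    have := eLpNorm_sub_le hf.1 (hf.sub ((hφ n).memLp _)).1 hp1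
    rwa [sub_sub_cancel] at this
  calc _ ≤ _ := h1
    _ ≤ eLpNorm (g - testBeurling (φ n)) (ENNReal.ofReal p) + A * eLpNorm (φ n) (ENNReal.ofReal p) := by
        gcongr; exact hb _ (hφ n)
    _ ≤ _ := by rw [add_comm]; gcongr

theorem exists_isLpBeurling {p q : ℝ} (hp : 2 < p) (hpq : p.HolderConjugate q) {f : ℂ → ℂ}
    (hf : MemLp f (ENNReal.ofReal p)) :
    ∃ g, IsLpBeurling p f g ∧
      eLpNorm g (ENNReal.ofReal p) ≤ ENNReal.ofReal (marcConst q) ^ (1 / q) * eLpNorm f (ENNReal.ofReal p) :=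
  exists_isLpBeurling_of_bound (by rw [← ENNReal.ofReal_one]; exact ENNReal.ofReal_le_ofReal (by linarith))
    (by have := hpq.symm.pos; finiteness) (fun _ hφ => eLpNorm_testBeurling_le hp hpq hφ) hf

theorem memLp_trunc_kernel {q ε : ℝ} (hq : 1 < q) (hε : 0 < ε) (z : ℂ) :
    MemLp ((Metric.ball z ε)ᶜ.indicator fun ξ => 1 / (z - ξ) ^ 2) (ENNReal.ofReal q) := by
  have hq0 : 0 < q := by linarith
  refine ⟨(Measurable.indicator (by fun_prop) measurableSet_ball.compl).aestronglyMeasurable, ?_⟩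
  rw [eLpNorm_lt_top_iff_lintegral_rpow_enorm_lt_top (by simpa using hq0) ENNReal.ofReal_ne_top,
    ENNReal.toReal_ofReal hq0.le]
  have e : ∀ ξ, ‖(Metric.ball z ε)ᶜ.indicator (fun ξ => 1 / (z - ξ) ^ 2) ξ‖ₑ ^ q =
      (Metric.ball z ε)ᶜ.indicator (fun ξ => ENNReal.ofReal (‖z - ξ‖ ^ (-(2 * q)))) ξ := by
    intro ξ
    by_cases h : ξ ∈ (Metric.ball z ε)ᶜ
    · rw [indicator_of_mem h, indicator_of_mem h, enorm_one_div_rpow _ hq0, norm_pow,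
        ← Real.rpow_natCast, ← Real.rpow_mul (norm_nonneg _)]
      congr 2; push_cast; ring
    · rw [indicator_of_notMem h, indicator_of_notMem h, enorm_zero, ENNReal.zero_rpow_of_pos hq0]
  simp only [e]
  rw [lintegral_indicator measurableSet_ball.compl, lintegral_compl_ball_rpow z (by linarith) hε]
  exact ENNReal.ofReal_lt_top

/-- Both sides are continuous in `L^p`: the indicator of the ball and the kernel off the ball are in
`L^q`, the latter because `2q > 2`. -/
theorem IsLpBeurling.integral_ball {p q : ℝ} (hp : 2 < p) (hpq : p.HolderConjugate q) {f g : ℂ → ℂ}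
    (hf : MemLp f (ENNReal.ofReal p)) (h : IsLpBeurling p f g) {ε : ℝ} (hε : 0 < ε) (z : ℂ) :
    ∫ w in Metric.ball z ε, g w = -(ε ^ 2 : ℂ) * ∫ ξ in (Metric.ball z ε)ᶜ, f ξ / (z - ξ) ^ 2 := by
  obtain ⟨hg, φ, hφ, h1, h2⟩ := h
  have l1 := tendsto_integral_mul_of_eLpNorm hpq (fun n => (hφ n).memLp _) hf
    (memLp_trunc_kernel hpq.symm.lt hε z) h1
  have l2 := tendsto_integral_mul_of_eLpNorm hpq (fun n => memLp_testBeurling hp hpq (hφ n)) hg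
    (K := (Metric.ball z ε).indicator fun _ => (1 : ℂ))
    (memLp_indicator_const _ measurableSet_ball _ (Or.inr measure_ball_lt_top.ne)) h2
  have e1 : ∀ F : ℂ → ℂ, ∫ ξ, F ξ * (Metric.ball z ε)ᶜ.indicator (fun ξ => 1 / (z - ξ) ^ 2) ξ =
      ∫ ξ in (Metric.ball z ε)ᶜ, F ξ / (z - ξ) ^ 2 := by
    intro F
    rw [← integral_indicator measurableSet_ball.compl]
    congr 1 with ξ
    by_cases h : ξ ∈ (Metric.ball z ε)ᶜ
    · rw [indicator_of_mem h, indicator_of_mem h]; ring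
    · rw [indicator_of_notMem h, indicator_of_notMem h, mul_zero]
  have e2 : ∀ F : ℂ → ℂ, ∫ w, F w * (Metric.ball z ε).indicator (fun _ => (1 : ℂ)) w = ∫ w in Metric.ball z ε, F w := by
    intro F
    rw [← integral_indicator measurableSet_ball]
    congr 1 with w
    by_cases h : w ∈ Metric.ball z ε <;> simp [h]
  simp only [e1] at l1
  simp only [e2] at l2
  refine tendsto_nhds_unique l2 ?_
  simp only [integral_ball_testBeurling hε (hφ _)]
  exact l1.const_mul _

/-- The truncations are ball averages of `g`, so they converge at every Lebesgue point of `g`. -/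
theorem IsLpBeurling.ae_tendsto {p q : ℝ} (hp : 2 < p) (hpq : p.HolderConjugate q) {f g : ℂ → ℂ}
    (hf : MemLp f (ENNReal.ofReal p)) (h : IsLpBeurling p f g) :
    ∀ᵐ z, Tendsto (fun ε => -(1 / Real.pi : ℂ) * ∫ ξ in (Metric.ball z ε)ᶜ, f ξ / (z - ξ) ^ 2) (𝓝[>] 0)
      (𝓝 (g z)) := by
  have hp1 : 1 ≤ ENNReal.ofReal p := by rw [← ENNReal.ofReal_one]; exact ENNReal.ofReal_le_ofReal (by linarith)
  filter_upwards [IsUnifLocDoublingMeasure.ae_tendsto_average volume (h.1.locallyIntegrable hp1) 1] with z hz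
  refine (hz (fun _ => z) (fun ε => ε) tendsto_id ?_).congr' ?_
  · filter_upwards [self_mem_nhdsWithin] with ε hε
    have : (0 : ℝ) < ε := hε
    simpa using this.le
  · filter_upwards [self_mem_nhdsWithin] with ε hε
    have hε0 : (0 : ℝ) < ε := hε
    have hε' : (ε : ℂ) ≠ 0 := Complex.ofReal_ne_zero.2 hε0.ne'
    have hpi : (Real.pi : ℂ) ≠ 0 := Complex.ofReal_ne_zero.2 Real.pi_ne_zero
    have hae : (Metric.closedBall z ε : Set ℂ) =ᵐ[volume] Metric.ball z ε := by
      rw [← Metric.ball_union_sphere]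
      exact union_ae_eq_left_of_ae_eq_empty (ae_eq_empty.2 (Measure.addHaar_sphere volume z ε))
    rw [setAverage_eq, setIntegral_congr_set hae, h.integral_ball hp hpq hf hε0, measureReal_def,
      Complex.volume_closedBall, ENNReal.toReal_mul, ENNReal.toReal_pow, ENNReal.toReal_ofReal hε0.le,
      Complex.real_smul]
    simp only [ENNReal.coe_toReal, NNReal.coe_real_pi]
    push_cast
    field_simp

theorem exists_isBeurling {p q : ℝ} (hp : 2 < p) (hpq : p.HolderConjugate q) {f : ℂ → ℂ} (hf : MemLpDisc p f) :
    ∃ g, IsLpBeurling p (disc.indicator f) g ∧ IsBeurling f g ∧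
      lpNorm p g ≤ ENNReal.ofReal (marcConst q) ^ (1 / q) * lpNorm p f := by
  have hf' : MemLp (disc.indicator f) (ENNReal.ofReal p) := (memLp_indicator_iff_restrict measurableSet_disc).2 hf
  obtain ⟨g, hg, hle⟩ := exists_isLpBeurling hp hpq hf'
  refine ⟨g, hg, ?_, ?_⟩
  · refine ae_restrict_of_ae ?_
    filter_upwards [hg.ae_tendsto hp hpq hf'] with z hz
    refine hz.congr fun ε => ?_
    rw [beurlingTrunc, sdiff_eq, inter_comm, ← Measure.restrict_restrict measurableSet_ball.compl]
    congr 1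
    rw [← integral_indicator measurableSet_ball.compl, ← integral_indicator measurableSet_ball.compl,
      ← integral_indicator measurableSet_disc]
    congr 1 with ξ
    by_cases h1 : ξ ∈ disc <;> by_cases h2 : ξ ∈ (Metric.ball z ε)ᶜ <;>
      simp only [indicator_of_mem, indicator_of_notMem, h1, h2, not_false_eq_true, zero_div]
  · refine (eLpNorm_mono_measure _ Measure.restrict_le_self).trans (hle.trans_eq ?_)
    rw [eLpNorm_indicator_eq_eLpNorm_restrict measurableSet_disc]; rfl

theorem beurlingBarTrunc_eq (f : ℂ → ℂ) (z : ℂ) (ε : ℝ) :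
    beurlingBarTrunc f z ε = conj (beurlingTrunc (fun ξ => conj (f ξ)) z ε) := by
  rw [beurlingBarTrunc, beurlingTrunc, map_mul, ← integral_conj]
  simp

theorem exists_isBeurlingBound {p : ℝ} (hp : 2 < p) : ∃ B : ℝ≥0, IsBeurlingBound p B := by
  have hpq := Real.HolderConjugate.conjExponent (show 1 < p by linarith)
  set q := p.conjExponent
  have hAfin : ENNReal.ofReal (marcConst q) ^ (1 / q) ≠ ⊤ := by have := hpq.symm.pos; finiteness
  refine ⟨(ENNReal.ofReal (marcConst q) ^ (1 / q)).toNNReal, fun f hf => ?_⟩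
  rw [ENNReal.coe_toNNReal hAfin]
  constructor
  · obtain ⟨g, -, h⟩ := exists_isBeurling hp hpq hf
    exact ⟨g, h⟩
  · obtain ⟨g, -, h, hle⟩ := exists_isBeurling hp hpq hf.conj
    refine ⟨fun z => conj (g z), ?_, ?_⟩
    · filter_upwards [h] with z hz
      have := (Complex.continuous_conj.tendsto _).comp hz
      refine this.congr fun ε => ?_
      rw [beurlingBarTrunc_eq]; rfl
    · rwa [lpNorm_conj, ← lpNorm_conj p f]

end BukhgeimDisc


namespace BukhgeimDisc

/-! ### Hölder functions on the closed disc -/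

theorem isCompact_closedDisc : IsCompact closedDisc := isCompact_closedBall 0 1

theorem disc_subset_closedDisc : disc ⊆ closedDisc := Metric.ball_subset_closedBall

theorem enorm_le_holderNorm {α : ℝ} {f : ℂ → ℂ} {z : ℂ} (hz : z ∈ closedDisc) : ‖f z‖ₑ ≤ holderNorm α f :=
  (le_iSup₂ (f := fun z (_ : z ∈ closedDisc) => ‖f z‖ₑ) z hz).trans le_self_add

theorem MemHolderDisc.continuousOn {α : ℝ} (hα : 0 < α) {f : ℂ → ℂ} (hf : MemHolderDisc α f) :
    ContinuousOn f closedDisc := by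
  rw [continuousOn_iff_continuous_domRestrict]
  have h : eHolderNorm α.toNNReal (closedDisc.domRestrict f) < ⊤ := le_add_self.trans_lt hf
  obtain ⟨C, hC⟩ := eHolderNorm_lt_top.1 h
  exact hC.continuous (Real.toNNReal_pos.2 hα)

instance : IsFiniteMeasure discMeasure :=
  ⟨by rw [discMeasure, Measure.restrict_apply_univ]; exact measure_ball_lt_top⟩

theorem memLpDisc_of_continuousOn {p : ℝ} {f : ℂ → ℂ} (hf : ContinuousOn f closedDisc) : MemLpDisc p f := by
  obtain ⟨C, hC⟩ := isCompact_closedDisc.exists_bound_of_continuousOn hf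
  refine MemLp.of_bound ((hf.mono disc_subset_closedDisc).aestronglyMeasurable measurableSet_disc) C ?_
  filter_upwards [ae_restrict_mem measurableSet_disc] with z hz using hC z (disc_subset_closedDisc hz)

theorem MemLpDisc.continuousOn_mul {p : ℝ} {f s : ℂ → ℂ} (hf : MemLpDisc p f) (hs : ContinuousOn s closedDisc) :
    MemLpDisc p fun z => s z * f z := by
  obtain ⟨C, hC⟩ := isCompact_closedDisc.exists_bound_of_continuousOn hs
  refine MemLp.of_le_mul (c := C) hf
    (((hs.mono disc_subset_closedDisc).aestronglyMeasurable measurableSet_disc).mul hf.1) ?_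
  filter_upwards [ae_restrict_mem measurableSet_disc] with z hz
  rw [norm_mul]
  gcongr
  exact hC z (disc_subset_closedDisc hz)

theorem MemLpDisc.integrableOn {p : ℝ} (hp : 1 ≤ p) {f : ℂ → ℂ} (hf : MemLpDisc p f) : IntegrableOn f disc :=
  MemLp.integrable (μ := discMeasure) (q := ENNReal.ofReal p)
    (by rw [← ENNReal.ofReal_one]; exact ENNReal.ofReal_le_ofReal hp) hf

theorem one_sub_two_div_pos {p : ℝ} (hp : 2 < p) : 0 < 1 - 2 / p := by
  rw [sub_pos, div_lt_one (by linarith)]; exact hp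

theorem memHolderDisc_cauchy {p : ℝ} (hp : 2 < p) {f : ℂ → ℂ} (hf : MemLpDisc p f) :
    MemHolderDisc (1 - 2 / p) (cauchy f) := by
  obtain ⟨C, hC⟩ := exists_isCauchyBound hp
  exact (hC f hf).1.trans_lt (ENNReal.mul_lt_top ENNReal.coe_lt_top hf.2)

theorem memHolderDisc_cauchyBar {p : ℝ} (hp : 2 < p) {f : ℂ → ℂ} (hf : MemLpDisc p f) :
    MemHolderDisc (1 - 2 / p) (cauchyBar f) := by
  obtain ⟨C, hC⟩ := exists_isCauchyBound hp
  exact (hC f hf).2.trans_lt (ENNReal.mul_lt_top ENNReal.coe_lt_top hf.2)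

theorem continuousOn_cauchy {p : ℝ} (hp : 2 < p) {f : ℂ → ℂ} (hf : MemLpDisc p f) :
    ContinuousOn (cauchy f) closedDisc :=
  (memHolderDisc_cauchy hp hf).continuousOn (one_sub_two_div_pos hp)

theorem continuousOn_cauchyBar {p : ℝ} (hp : 2 < p) {f : ℂ → ℂ} (hf : MemLpDisc p f) :
    ContinuousOn (cauchyBar f) closedDisc :=
  (memHolderDisc_cauchyBar hp hf).continuousOn (one_sub_two_div_pos hp)

/-! ### Weak Wirtinger derivatives in the disc -/

/-- `g` is the weak `∂`-derivative of `f` in the disc. -/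
def HasDz (f g : ℂ → ℂ) : Prop :=
  ∀ φ, IsTest φ → tsupport φ ⊆ disc → ∫ z in disc, f z * dz φ z = -∫ z in disc, g z * φ z

/-- `g` is the weak `∂̄`-derivative of `f` in the disc. -/
def HasDzbar (f g : ℂ → ℂ) : Prop :=
  ∀ φ, IsTest φ → tsupport φ ⊆ disc → ∫ z in disc, f z * dzbar φ z = -∫ z in disc, g z * φ z

/-- `f` lies in `W^{1,p}` of the disc, with weak Wirtinger derivatives `a` and `b`. -/
structure IsSobolev (p : ℝ) (f a b : ℂ → ℂ) : Prop where
  memLp : MemLpDisc p f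
  memLp_dz : MemLpDisc p a
  memLp_dzbar : MemLpDisc p b
  hasDz : HasDz f a
  hasDzbar : HasDzbar f b

theorem integrableOn_mul_continuous {f ψ : ℂ → ℂ} (hf : IntegrableOn f disc) (hψ : Continuous ψ) :
    IntegrableOn (fun z => f z * ψ z) disc :=
  hf.mul_continuousOn_of_subset hψ.continuousOn measurableSet_disc isCompact_closedDisc disc_subset_closedDisc

theorem setIntegral_disc_congr {f g : ℂ → ℂ} (h : EqOn f g disc) : ∫ z in disc, f z = ∫ z in disc, g z :=
  setIntegral_congr_fun measurableSet_disc h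

theorem setIntegral_disc_of_tsupport {f φ : ℂ → ℂ} (h : tsupport φ ⊆ disc) :
    ∫ z in disc, f z * φ z = ∫ z, f z * φ z := by
  refine setIntegral_eq_integral_of_forall_compl_eq_zero fun z hz => ?_
  rw [image_eq_zero_of_notMem_tsupport fun hm => hz (h hm), mul_zero]

theorem cauchy_eq_planeCauchy (f : ℂ → ℂ) : cauchy f = planeCauchy (disc.indicator f) := by
  ext z
  rw [cauchy, planeCauchy_eq, ← integral_indicator measurableSet_disc]
  congr 2 with ξ
  by_cases h : ξ ∈ disc
  · rw [indicator_of_mem h, indicator_of_mem h, div_eq_mul_inv]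
  · rw [indicator_of_notMem h, indicator_of_notMem h, zero_mul]

/-- The Cauchy kernel is odd, so the transform is minus its transpose; this converts statements
about test functions into weak derivatives. -/
theorem integral_planeCauchy_mul {f ψ : ℂ → ℂ} (hf : Integrable f) (hψ : IsTest ψ) :
    ∫ z, planeCauchy f z * ψ z = -∫ ξ, f ξ * planeCauchy ψ ξ := by
  obtain ⟨M, hM⟩ := hψ.exists_bound
  obtain ⟨R, hR0, hR⟩ := hψ.2.isCompact.isBounded.subset_ball_lt 0 0
  have h := integral_mul_cauchy_swap hf hψ.continuous.aestronglyMeasurable hM (R := R)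
    fun z hz => image_eq_zero_of_notMem_tsupport fun hm => hz (hR hm)
  have e1 : ∀ z, planeCauchy f z * ψ z = (1 / Real.pi : ℂ) * (ψ z * ∫ ξ, f ξ * (z - ξ)⁻¹) := by
    intro z; rw [planeCauchy_eq]; ring
  have e2 : ∀ ξ, f ξ * planeCauchy ψ ξ = -(1 / Real.pi : ℂ) * (f ξ * ∫ z, ψ z * (z - ξ)⁻¹) := by
    intro ξ
    have : ∫ z, ψ z * (ξ - z)⁻¹ = -∫ z, ψ z * (z - ξ)⁻¹ := by
      rw [← integral_neg]
      congr 1 with z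
      rw [← neg_sub z ξ, inv_neg, mul_neg]
    rw [planeCauchy_eq, this]; ring
  simp only [e1, e2]
  rw [integral_const_mul, integral_const_mul, h]; ring

theorem integral_cauchy_mul {g ψ : ℂ → ℂ} (hg : IntegrableOn g disc) (hψ : IsTest ψ) (hs : tsupport ψ ⊆ disc) :
    ∫ z in disc, cauchy g z * ψ z = -∫ ξ in disc, g ξ * planeCauchy ψ ξ := by
  rw [setIntegral_disc_of_tsupport hs, cauchy_eq_planeCauchy,
    integral_planeCauchy_mul ((integrable_indicator_iff measurableSet_disc).2 hg) hψ,
    ← integral_indicator measurableSet_disc]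
  congr 2 with ξ
  by_cases h : ξ ∈ disc
  · rw [indicator_of_mem h, indicator_of_mem h]
  · rw [indicator_of_notMem h, indicator_of_notMem h, zero_mul]

theorem hasDzbar_cauchy {f : ℂ → ℂ} (hf : IntegrableOn f disc) : HasDzbar (cauchy f) f := by
  intro φ hφ hs
  rw [integral_cauchy_mul hf hφ.dzbar ((tsupport_dzbar_subset φ).trans hs), planeCauchy_dzbar hφ]

theorem integral_testBeurling_mul {φ ψ : ℂ → ℂ} (hφ : IsTest φ) (hψ : IsTest ψ) :
    ∫ z, testBeurling φ z * ψ z = ∫ z, φ z * testBeurling ψ z := by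
  rw [testBeurling, integral_planeCauchy_mul hφ.dz.integrable hψ]
  have := integral_mul_dz_test hφ ((contDiff_planeCauchy hψ).of_le (by simp))
  rw [dz_planeCauchy hψ] at this
  simp only [testBeurling, mul_comm (dz φ _), mul_comm (φ _)]
  rw [this, neg_neg]

/-- The Beurling transform on test functions is symmetric, so `∫ u·Bφ = ∫ Bu·φ` passes from
approximating test functions `u` to `f` and its `L^p` transform `g`. -/
theorem hasDz_cauchy {p q : ℝ} (hp : 2 < p) (hpq : p.HolderConjugate q) {f g : ℂ → ℂ} (hf : MemLpDisc p f)
    (hg : IsLpBeurling p (disc.indicator f) g) : HasDz (cauchy f) g := by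
  intro φ hφ hs
  have hf' : MemLp (disc.indicator f) (ENNReal.ofReal p) := (memLp_indicator_iff_restrict measurableSet_disc).2 hf
  rw [integral_cauchy_mul (hf.integrableOn (by linarith)) hφ.dz ((tsupport_dz_subset φ).trans hs),
    setIntegral_disc_of_tsupport hs]
  obtain ⟨hgm, u, hu, h1, h2⟩ := hg
  have l1 := tendsto_integral_mul_of_eLpNorm hpq (fun n => (hu n).memLp _) hf' (memLp_testBeurling_conj hp hpq hφ) h1
  have l2 := tendsto_integral_mul_of_eLpNorm hpq (fun n => memLp_testBeurling hp hpq (hu n)) hgm (hφ.memLp _) h2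
  simp only [integral_testBeurling_mul (hu _) hφ] at l2
  rw [← tendsto_nhds_unique l1 l2, ← integral_indicator measurableSet_disc]
  congr 2 with ξ
  by_cases h : ξ ∈ disc
  · rw [indicator_of_mem h, indicator_of_mem h]; rfl
  · rw [indicator_of_notMem h, indicator_of_notMem h, zero_mul]

theorem exists_isSobolev_cauchy {p : ℝ} (hp : 2 < p) {f : ℂ → ℂ} (hf : MemLpDisc p f) :
    ∃ g, IsSobolev p (cauchy f) g f := by
  have hpq := Real.HolderConjugate.conjExponent (show 1 < p by linarith)
  obtain ⟨g, hg, -, -⟩ := exists_isBeurling hp hpq hf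
  exact ⟨g, memLpDisc_of_continuousOn (continuousOn_cauchy hp hf), hg.1.restrict _, hf,
    hasDz_cauchy hp hpq hf hg, hasDzbar_cauchy (hf.integrableOn (by linarith))⟩

namespace IsSobolev

variable {p : ℝ} {f a b g c d : ℂ → ℂ}

theorem add (hp : 1 ≤ p) (hf : IsSobolev p f a b) (hg : IsSobolev p g c d) :
    IsSobolev p (fun z => f z + g z) (fun z => a z + c z) (fun z => b z + d z) := by
  refine ⟨hf.1.add hg.1, hf.2.add hg.2, hf.3.add hg.3, fun φ hφ hs => ?_, fun φ hφ hs => ?_⟩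
  · simp only [add_mul]
    rw [integral_add (integrableOn_mul_continuous (hf.1.integrableOn hp) hφ.dz.continuous)
      (integrableOn_mul_continuous (hg.1.integrableOn hp) hφ.dz.continuous),
      integral_add (integrableOn_mul_continuous (hf.2.integrableOn hp) hφ.continuous)
      (integrableOn_mul_continuous (hg.2.integrableOn hp) hφ.continuous), hf.4 φ hφ hs, hg.4 φ hφ hs]
    ring
  · simp only [add_mul]
    rw [integral_add (integrableOn_mul_continuous (hf.1.integrableOn hp) hφ.dzbar.continuous)
      (integrableOn_mul_continuous (hg.1.integrableOn hp) hφ.dzbar.continuous),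
      integral_add (integrableOn_mul_continuous (hf.3.integrableOn hp) hφ.continuous)
      (integrableOn_mul_continuous (hg.3.integrableOn hp) hφ.continuous), hf.5 φ hφ hs, hg.5 φ hφ hs]
    ring

theorem congr (hf : IsSobolev p f a b) (h : EqOn f g disc) : IsSobolev p g a b := by
  refine ⟨(memLp_congr_ae ?_).1 hf.1, hf.2, hf.3, fun φ hφ hs => ?_, fun φ hφ hs => ?_⟩
  · filter_upwards [ae_restrict_mem measurableSet_disc] with z hz using h hz
  · rw [← hf.4 φ hφ hs]
    exact setIntegral_disc_congr fun z hz => by simp only [h hz]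
  · rw [← hf.5 φ hφ hs]
    exact setIntegral_disc_congr fun z hz => by simp only [h hz]

theorem smooth_mul (hp : 1 ≤ p) {s : ℂ → ℂ} (hs : ContDiff ℝ ((⊤ : ℕ∞) : WithTop ℕ∞) s) (hf : IsSobolev p f a b) :
    IsSobolev p (fun z => s z * f z) (fun z => dz s z * f z + s z * a z)
      (fun z => dzbar s z * f z + s z * b z) := by
  have cs := hs.continuous
  have c1 := (contDiff_dz hs).continuous
  have c2 := (contDiff_dzbar hs).continuous
  have hd : Differentiable ℝ s := hs.differentiable (by simp)
  refine ⟨hf.1.continuousOn_mul cs.continuousOn,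
    (hf.1.continuousOn_mul c1.continuousOn).add (hf.2.continuousOn_mul cs.continuousOn),
    (hf.1.continuousOn_mul c2.continuousOn).add (hf.3.continuousOn_mul cs.continuousOn),
    fun φ hφ hsup => ?_, fun φ hφ hsup => ?_⟩
  · have ht := hφ.mul_left hs
    have hd2 := hφ.differentiable
    have key := hf.4 _ ht ((tsupport_mul_subset_right).trans hsup)
    have e : ∀ z, f z * dz (fun z => s z * φ z) z = f z * (dz s z * φ z) + s z * f z * dz φ z := by
      intro z
      rw [((HasWirtingerAt.of_differentiableAt (hd z)).mul (HasWirtingerAt.of_differentiableAt (hd2 z))).dz_eq]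
      ring
    have i1 : IntegrableOn (fun z => f z * (dz s z * φ z)) disc :=
      integrableOn_mul_continuous (hf.1.integrableOn hp) (c1.mul hφ.continuous)
    have i2 := integrableOn_mul_continuous ((hf.1.continuousOn_mul cs.continuousOn).integrableOn hp) hφ.dz.continuous
    have i3 : IntegrableOn (fun z => a z * (s z * φ z)) disc :=
      integrableOn_mul_continuous (hf.2.integrableOn hp) (cs.mul hφ.continuous)
    simp only [e] at key
    rw [integral_add i1 i2] at key
    have e2 : ∀ z, (dz s z * f z + s z * a z) * φ z = f z * (dz s z * φ z) + a z * (s z * φ z) := fun z => by ring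
    simp only [e2]
    rw [integral_add i1 i3]
    linear_combination key
  · have ht := hφ.mul_left hs
    have hd2 := hφ.differentiable
    have key := hf.5 _ ht ((tsupport_mul_subset_right).trans hsup)
    have e : ∀ z, f z * dzbar (fun z => s z * φ z) z = f z * (dzbar s z * φ z) + s z * f z * dzbar φ z := by
      intro z
      rw [((HasWirtingerAt.of_differentiableAt (hd z)).mul (HasWirtingerAt.of_differentiableAt (hd2 z))).dzbar_eq]
      ring
    have i1 : IntegrableOn (fun z => f z * (dzbar s z * φ z)) disc :=
      integrableOn_mul_continuous (hf.1.integrableOn hp) (c2.mul hφ.continuous)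
    have i2 := integrableOn_mul_continuous ((hf.1.continuousOn_mul cs.continuousOn).integrableOn hp) hφ.dzbar.continuous
    have i3 : IntegrableOn (fun z => b z * (s z * φ z)) disc :=
      integrableOn_mul_continuous (hf.3.integrableOn hp) (cs.mul hφ.continuous)
    simp only [e] at key
    rw [integral_add i1 i2] at key
    have e2 : ∀ z, (dzbar s z * f z + s z * b z) * φ z = f z * (dzbar s z * φ z) + b z * (s z * φ z) := fun z => by ring
    simp only [e2]
    rw [integral_add i1 i3]
    linear_combination key

theorem one : IsSobolev p (fun _ => 1) (fun _ => 0) fun _ => 0 := by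
  have h1 : MemLpDisc p fun _ => (1 : ℂ) := memLpDisc_of_continuousOn continuousOn_const
  have h0 : MemLpDisc p fun _ => (0 : ℂ) := memLpDisc_of_continuousOn continuousOn_const
  refine ⟨h1, h0, h0, fun φ hφ hs => ?_, fun φ hφ hs => ?_⟩
  · rw [setIntegral_disc_of_tsupport ((tsupport_dz_subset φ).trans hs),
      integral_mul_dz_test hφ (ψ := fun _ => (1 : ℂ)) contDiff_const]
    simp [(HasWirtingerAt.const 1 _).dz_eq]
  · rw [setIntegral_disc_of_tsupport ((tsupport_dzbar_subset φ).trans hs),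
      integral_mul_dzbar_test hφ (ψ := fun _ => (1 : ℂ)) contDiff_const]
    simp [(HasWirtingerAt.const 1 _).dzbar_eq]

theorem const_mul (hp : 1 ≤ p) (k : ℂ) (hf : IsSobolev p f a b) :
    IsSobolev p (fun z => k * f z) (fun z => k * a z) (fun z => k * b z) := by
  have := hf.smooth_mul hp (s := fun _ => k) contDiff_const
  simpa only [(HasWirtingerAt.const k _).dz_eq, (HasWirtingerAt.const k _).dzbar_eq, zero_mul, zero_add] using this

theorem conj_comp (hf : IsSobolev p f a b) :
    IsSobolev p (fun z => conj (f z)) (fun z => conj (b z)) (fun z => conj (a z)) := by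
  refine ⟨hf.1.conj, hf.3.conj, hf.2.conj, fun φ hφ hs => ?_, fun φ hφ hs => ?_⟩
  · have hs' : tsupport (fun z => conj (φ z)) ⊆ disc :=
      (closure_mono (by intro z hz h; exact hz (by simp [h]))).trans hs
    have := congrArg conj (hf.5 _ hφ.conj_comp hs')
    rw [map_neg, ← integral_conj, ← integral_conj] at this
    simpa only [map_mul, dzbar_conj hφ.differentiable, Complex.conj_conj] using this
  · have hs' : tsupport (fun z => conj (φ z)) ⊆ disc :=
      (closure_mono (by intro z hz h; exact hz (by simp [h]))).trans hs
    have := congrArg conj (hf.4 _ hφ.conj_comp hs')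
    rw [map_neg, ← integral_conj, ← integral_conj] at this
    simpa only [map_mul, dz_conj hφ.differentiable, Complex.conj_conj] using this

theorem memSobolevDisc_one (hp : 1 ≤ p) (hf : IsSobolev p f a b) :
    MemLpDisc p f ∧ HasWeakDeriv 1 f (fun z => a z + b z) ∧
      HasWeakDeriv Complex.I f (fun z => Complex.I * (a z - b z)) := by
  refine ⟨hf.1, fun φ h1 h2 hs => ?_, fun φ h1 h2 hs => ?_⟩
  all_goals
    have hφ : IsTest φ := ⟨h1, h2⟩
    have i1 := integrableOn_mul_continuous (hf.1.integrableOn hp) hφ.dz.continuous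
    have i2 := integrableOn_mul_continuous (hf.1.integrableOn hp) hφ.dzbar.continuous
    have i3 := integrableOn_mul_continuous (hf.2.integrableOn hp) hφ.continuous
    have i4 := integrableOn_mul_continuous (hf.3.integrableOn hp) hφ.continuous
    have e1 := hf.4 φ hφ hs
    have e2 := hf.5 φ hφ hs
  · have e : ∀ z, f z * fderiv ℝ φ z 1 = f z * dz φ z + f z * dzbar φ z := by
      intro z; simp only [dz, dzbar]; ring
    simp only [e, add_mul]
    rw [integral_add i1 i2, integral_add i3 i4, e1, e2]; ring
  · have e : ∀ z, f z * fderiv ℝ φ z Complex.I = Complex.I * (f z * dz φ z - f z * dzbar φ z) := by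
      intro z; simp only [dz, dzbar]
      linear_combination (f z * fderiv ℝ φ z Complex.I) * Complex.I_mul_I
    have e' : ∀ z, Complex.I * (a z - b z) * φ z = Complex.I * (a z * φ z - b z * φ z) := fun z => by ring
    simp only [e, e']
    rw [integral_const_mul, integral_const_mul, integral_sub i1 i2, integral_sub i3 i4, e1, e2]; ring

theorem memSobolevDisc_two (hp : 1 ≤ p) {a₁ a₂ b₁ b₂ : ℂ → ℂ} (hf : IsSobolev p f a b) (ha : IsSobolev p a a₁ a₂)
    (hb : IsSobolev p b b₁ b₂) : MemSobolevDisc 2 p f := by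
  have key : ∀ {u u₁ u₂ : ℂ → ℂ}, IsSobolev p u u₁ u₂ → MemSobolevDisc 1 p u := by
    intro u u₁ u₂ hu
    obtain ⟨h0, h1, h2⟩ := hu.memSobolevDisc_one hp
    refine ⟨h0, ?_⟩
    rintro v (rfl | rfl)
    · exact ⟨_, h1, hu.2.add hu.3⟩
    · exact ⟨_, h2, (hu.2.sub hu.3).const_mul _⟩
  obtain ⟨h0, h1, h2⟩ := hf.memSobolevDisc_one hp
  refine ⟨h0, ?_⟩
  rintro v (rfl | rfl)
  · exact ⟨_, h1, key (ha.add hp hb)⟩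
  · have := (ha.add hp (hb.const_mul hp (-1))).const_mul hp Complex.I
    simp only [neg_one_mul, ← sub_eq_add_neg] at this
    exact ⟨_, h2, key this⟩

end IsSobolev

end BukhgeimDisc


namespace BukhgeimDisc

/-! ### The tangential derivative on the circle and second derivatives of the Cauchy transform -/

theorem deriv_smoothTransition_of_neg {t : ℝ} (ht : t < 0) : deriv Real.smoothTransition t = 0 := by
  have : Real.smoothTransition =ᶠ[𝓝 t] fun _ => 0 := by
    filter_upwards [Iio_mem_nhds ht] with s hs using Real.smoothTransition.zero_of_nonpos (le_of_lt hs)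
  rw [this.deriv_eq, deriv_const]

theorem deriv_smoothTransition_of_one_lt {t : ℝ} (ht : 1 < t) : deriv Real.smoothTransition t = 0 := by
  have : Real.smoothTransition =ᶠ[𝓝 t] fun _ => 1 := by
    filter_upwards [Ioi_mem_nhds ht] with s hs using Real.smoothTransition.one_of_one_le (le_of_lt hs)
  rw [this.deriv_eq, deriv_const]

/-- With `t = k(1-|z|²) - 1` this bounds the combination of derivatives in `tangential_radialCutoff`
independently of `k`. -/
theorem exists_bound_deriv_smoothTransition :
    ∃ K, ∀ t : ℝ, |deriv Real.smoothTransition t * (t + 1)| ≤ K := by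
  have hc : Continuous fun t : ℝ => deriv Real.smoothTransition t * (t + 1) :=
    ((Real.smoothTransition.contDiff (n := 1)).continuous_deriv le_rfl).mul (by fun_prop)
  have hs : HasCompactSupport fun t : ℝ => deriv Real.smoothTransition t * (t + 1) := by
    refine HasCompactSupport.of_support_subset_isCompact (isCompact_Icc (a := 0) (b := 1)) fun t ht => ?_
    by_contra h
    rw [mem_Icc, not_and_or, not_le, not_le] at h
    apply ht
    rcases h with h | h
    · simp [deriv_smoothTransition_of_neg h]
    · simp [deriv_smoothTransition_of_one_lt h]
  exact hs.exists_bound_of_continuous hc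

/-- A smooth radial cutoff of the disc. -/
noncomputable def radialCutoff (k : ℝ) (z : ℂ) : ℂ := (Real.smoothTransition (k * (1 - ‖z‖ ^ 2) - 1) : ℝ)

theorem contDiff_radialCutoff (k : ℝ) : ContDiff ℝ ((⊤ : ℕ∞) : WithTop ℕ∞) (radialCutoff k) := by
  unfold radialCutoff
  refine Complex.ofRealCLM.contDiff.comp (Real.smoothTransition.contDiff.comp ?_)
  exact (contDiff_const.mul (contDiff_const.sub (contDiff_norm_sq ℝ))).sub contDiff_const

theorem hasWirtingerAt_radialCutoff (k : ℝ) (z : ℂ) :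
    HasWirtingerAt (radialCutoff k)
      ((deriv Real.smoothTransition (k * (1 - ‖z‖ ^ 2) - 1) : ℝ) * (-k * conj z))
      ((deriv Real.smoothTransition (k * (1 - ‖z‖ ^ 2) - 1) : ℝ) * (-k * z)) z := by
  have h2 := ((((hasStrictFDerivAt_norm_sq z).hasFDerivAt).const_sub 1).const_mul k).sub_const 1
  have hd : DifferentiableAt ℝ Real.smoothTransition (k * (1 - ‖z‖ ^ 2) - 1) :=
    (Real.smoothTransition.contDiff (n := 1)).differentiable one_ne_zero _
  have h3 := Complex.ofRealCLM.hasFDerivAt.comp z (hd.hasDerivAt.hasFDerivAt.comp z h2)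
  unfold HasWirtingerAt
  convert! h3 using 1
  ext v
  have e : conj z * v + z * conj v = 2 * (v.re * z.re + v.im * z.im) := by
    apply Complex.ext <;> simp <;> ring
  simp [Complex.inner]
  linear_combination (-((deriv Real.smoothTransition (k * (1 - ‖z‖ ^ 2) - 1) : ℝ) : ℂ) * k) * e

theorem tsupport_radialCutoff_subset {k : ℝ} (hk : 0 < k) : tsupport (radialCutoff k) ⊆ disc := by
  have hcl : IsClosed {z : ℂ | 1 ≤ k * (1 - ‖z‖ ^ 2)} := isClosed_le continuous_const (by fun_prop)
  refine (closure_minimal (fun z hz => ?_) hcl).trans fun z hz => ?_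
  · by_contra h
    simp only [mem_ofPred_eq, not_le] at h
    apply hz
    rw [radialCutoff, Real.smoothTransition.zero_of_nonpos (by linarith), Complex.ofReal_zero]
  · simp only [mem_ofPred_eq] at hz
    rw [disc, mem_ball_zero_iff]
    by_contra h
    rw [not_lt] at h
    nlinarith [mul_nonneg hk.le (show 0 ≤ ‖z‖ ^ 2 - 1 by nlinarith)]

theorem isTest_radialCutoff {k : ℝ} (hk : 0 < k) : IsTest (radialCutoff k) :=
  ⟨contDiff_radialCutoff k, HasCompactSupport.of_support_subset_isCompact isCompact_closedDisc
    ((subset_tsupport _).trans ((tsupport_radialCutoff_subset hk).trans disc_subset_closedDisc))⟩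

theorem norm_radialCutoff_le (k : ℝ) (z : ℂ) : ‖radialCutoff k z‖ ≤ 1 := by
  rw [radialCutoff, Complex.norm_real, Real.norm_of_nonneg (Real.smoothTransition.nonneg _)]
  exact Real.smoothTransition.le_one _

/-- The operator `∂ - z̄²∂̄` is tangential on the unit circle: on `|z|²` it gives `z̄(1-|z|²)`. The
gain `1-|z|²` compensates the factor `k` coming from the steep cutoff. -/
theorem tangential_radialCutoff (k : ℝ) (z : ℂ) :
    dz (radialCutoff k) z - conj z ^ 2 * dzbar (radialCutoff k) z =
      -((deriv Real.smoothTransition (k * (1 - ‖z‖ ^ 2) - 1) * (k * (1 - ‖z‖ ^ 2)) : ℝ) : ℂ) * conj z := by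
  rw [(hasWirtingerAt_radialCutoff k z).dz_eq, (hasWirtingerAt_radialCutoff k z).dzbar_eq]
  have : (‖z‖ : ℂ) ^ 2 = z * conj z := by rw [Complex.mul_conj, Complex.normSq_eq_norm_sq]; norm_cast
  push_cast
  rw [this]; ring

theorem contDiff_conj_sq : ContDiff ℝ ((⊤ : ℕ∞) : WithTop ℕ∞) fun z : ℂ => conj z ^ 2 :=
  (Complex.conjCLE : ℂ →L[ℝ] ℂ).contDiff.pow 2

theorem hasWirtingerAt_conj_sq (z : ℂ) : HasWirtingerAt (fun z => conj z ^ 2) 0 (2 * conj z) z := by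
  have := (HasWirtingerAt.conj_id z).mul (HasWirtingerAt.conj_id z)
  convert! this using 1
  · ext w; ring
  · ring
  · ring

theorem eventually_radial_gt {z : ℂ} (hz : z ∈ disc) : ∀ᶠ n : ℕ in atTop, 2 < ((n : ℝ) + 1) * (1 - ‖z‖ ^ 2) := by
  rw [disc, mem_ball_zero_iff] at hz
  have h : 0 < 1 - ‖z‖ ^ 2 := by nlinarith [norm_nonneg z]
  have ht : Tendsto (fun n : ℕ => ((n : ℝ) + 1) * (1 - ‖z‖ ^ 2)) atTop atTop :=
    (tendsto_atTop_add_const_right _ _ tendsto_natCast_atTop_atTop).atTop_mul_const h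
  exact ht.eventually_gt_atTop 2

/-- By the divergence theorem `∂u` and `∂̄(z̄²u)` have boundary terms with densities `z̄u/2` and `z
z̄²u/2`, which agree where `z z̄ = 1`. Testing with radial cutoffs avoids traces: the integrals
containing derivatives of the cutoffs are dominated uniformly and tend to `0`. -/
theorem IsSobolev.integral_tangential {p : ℝ} (hp : 1 ≤ p) {u a b : ℂ → ℂ} (hu : IsSobolev p u a b) :
    ∫ z in disc, (a z - (2 * conj z * u z + conj z ^ 2 * b z)) = 0 := by
  have hV := hu.smooth_mul hp contDiff_conj_sq
  simp only [(hasWirtingerAt_conj_sq _).dzbar_eq] at hV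
  obtain ⟨K, hK⟩ := exists_bound_deriv_smoothTransition
  have hu1 := hu.1.integrableOn hp
  have ha1 := hu.2.integrableOn hp
  have hB1 := hV.3.integrableOn hp
  set χ : ℕ → ℂ → ℂ := fun n => radialCutoff ((n : ℝ) + 1) with hχ
  have hχt : ∀ n, IsTest (χ n) := fun n => isTest_radialCutoff (by positivity)
  have key : ∀ n, ∫ z in disc, u z * (dz (χ n) z - conj z ^ 2 * dzbar (χ n) z) =
      -∫ z in disc, (a z - (2 * conj z * u z + conj z ^ 2 * b z)) * χ n z := by
    intro n
    have hs : tsupport (χ n) ⊆ disc := tsupport_radialCutoff_subset (by positivity)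
    have e1 := hu.4 _ (hχt n) hs
    have e2 := hV.5 _ (hχt n) hs
    have i1 := integrableOn_mul_continuous hu1 (hχt n).dz.continuous
    have i2 := integrableOn_mul_continuous (hV.1.integrableOn hp) (hχt n).dzbar.continuous
    have i3 := integrableOn_mul_continuous ha1 (hχt n).continuous
    have i4 := integrableOn_mul_continuous hB1 (hχt n).continuous
    have f1 : ∀ z, u z * (dz (χ n) z - conj z ^ 2 * dzbar (χ n) z) =
        u z * dz (χ n) z - conj z ^ 2 * u z * dzbar (χ n) z := fun z => by ring
    simp only [f1, sub_mul]
    rw [integral_sub i1 i2, integral_sub i3 i4, e1, e2]; ring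
  have hcont : ∀ n, Continuous fun z => dz (χ n) z - conj z ^ 2 * dzbar (χ n) z := fun n =>
    (hχt n).dz.continuous.sub (contDiff_conj_sq.continuous.mul (hχt n).dzbar.continuous)
  have l1 : Tendsto (fun n => ∫ z in disc, u z * (dz (χ n) z - conj z ^ 2 * dzbar (χ n) z)) atTop
      (𝓝 (∫ z in disc, (0 : ℂ))) := by
    refine tendsto_integral_of_dominated_convergence (fun z => ‖u z‖ * K)
      (fun n => hu1.1.mul (hcont n).aestronglyMeasurable) (hu1.norm.mul_const K) ?_ ?_
    · intro n
      filter_upwards [ae_restrict_mem measurableSet_disc] with z hz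
      rw [norm_mul, hχ, tangential_radialCutoff, norm_mul, norm_neg, Complex.norm_real, Complex.norm_conj]
      rw [disc, mem_ball_zero_iff] at hz
      gcongr
      have := hK (((n : ℝ) + 1) * (1 - ‖z‖ ^ 2) - 1)
      rw [sub_add_cancel] at this
      exact (mul_le_of_le_one_right (norm_nonneg _) hz.le).trans this
    · filter_upwards [ae_restrict_mem measurableSet_disc] with z hz
      refine tendsto_const_nhds.congr' ?_
      filter_upwards [eventually_radial_gt hz] with n hn
      rw [hχ, tangential_radialCutoff, deriv_smoothTransition_of_one_lt (by linarith)]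
      simp
  have l2 : Tendsto (fun n => ∫ z in disc, (a z - (2 * conj z * u z + conj z ^ 2 * b z)) * χ n z) atTop
      (𝓝 (∫ z in disc, (a z - (2 * conj z * u z + conj z ^ 2 * b z)))) := by
    have hi : IntegrableOn (fun z => a z - (2 * conj z * u z + conj z ^ 2 * b z)) disc := ha1.sub hB1
    refine tendsto_integral_of_dominated_convergence (fun z => ‖a z - (2 * conj z * u z + conj z ^ 2 * b z)‖)
      (fun n => hi.1.mul (hχt n).continuous.aestronglyMeasurable) hi.norm ?_ ?_
    · intro n
      refine Eventually.of_forall fun z => ?_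
      rw [norm_mul]
      exact mul_le_of_le_one_right (norm_nonneg _) (norm_radialCutoff_le _ _)
    · filter_upwards [ae_restrict_mem measurableSet_disc] with z hz
      refine tendsto_const_nhds.congr' ?_
      filter_upwards [eventually_radial_gt hz] with n hn
      rw [hχ]
      simp only [radialCutoff]
      rw [Real.smoothTransition.one_of_one_le (by linarith), Complex.ofReal_one, mul_one]
  simp only [key] at l1
  have := tendsto_nhds_unique l1 l2.neg
  rw [integral_zero, eq_comm, neg_eq_zero] at this
  exact this

/-- The tangential identity is applied to `u` times the plane Cauchy transform of the test function,
which does not vanish on the circle. The formula writes `∂ C u` through Cauchy transforms of `L^p`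
functions and a multiple of `u`, so it has one more derivative in `L^p`. -/
theorem IsSobolev.hasDz_cauchy {p : ℝ} (hp : 2 < p) {u a b : ℂ → ℂ} (hu : IsSobolev p u a b) :
    HasDz (cauchy u) fun z => cauchy a z + conj z ^ 2 * u z +
      -1 * cauchy (fun z => 2 * conj z * u z + conj z ^ 2 * b z) z := by
  have hp1 : 1 ≤ p := by linarith
  have hV := hu.smooth_mul hp1 contDiff_conj_sq
  simp only [(hasWirtingerAt_conj_sq _).dzbar_eq] at hV
  intro φ hφ hs
  have hΦ := contDiff_planeCauchy hφ
  have key := (hu.smooth_mul hp1 hΦ).integral_tangential hp1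
  rw [dzbar_planeCauchy hφ, dz_planeCauchy hφ] at key
  have hu1 := hu.1.integrableOn hp1
  have ha1 := hu.2.integrableOn hp1
  have hc1 := hV.3.integrableOn hp1
  have c0 := (contDiff_planeCauchy hφ).continuous
  have c1 := (contDiff_planeCauchy hφ.dz).continuous
  have j1 := integrableOn_mul_continuous hu1 c1
  have j2 := integrableOn_mul_continuous ha1 c0
  have j3 := integrableOn_mul_continuous hc1 c0
  have j4 := integrableOn_mul_continuous (hV.1.integrableOn hp1) hφ.continuous
  have k1 := integrableOn_mul_continuous ((memLpDisc_of_continuousOn (p := p)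
    (continuousOn_cauchy hp hu.2)).integrableOn hp1) hφ.continuous
  have k2 := integrableOn_mul_continuous ((memLpDisc_of_continuousOn (p := p)
    (continuousOn_cauchy hp hV.3)).integrableOn hp1) hφ.continuous
  have e : ∀ z, planeCauchy (dz φ) z * u z + planeCauchy φ z * a z -
      (2 * conj z * (planeCauchy φ z * u z) + conj z ^ 2 * (φ z * u z + planeCauchy φ z * b z)) =
      (u z * planeCauchy (dz φ) z + a z * planeCauchy φ z) -
        ((2 * conj z * u z + conj z ^ 2 * b z) * planeCauchy φ z + conj z ^ 2 * u z * φ z) := fun z => by ring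
  simp only [e] at key
  have j12 : IntegrableOn (fun z => u z * planeCauchy (dz φ) z + a z * planeCauchy φ z) disc := j1.add j2
  have j34 : IntegrableOn (fun z => (2 * conj z * u z + conj z ^ 2 * b z) * planeCauchy φ z +
    conj z ^ 2 * u z * φ z) disc := j3.add j4
  rw [integral_sub j12 j34, integral_add j1 j2, integral_add j3 j4] at key
  have e' : ∀ z, (cauchy a z + conj z ^ 2 * u z +
      -1 * cauchy (fun z => 2 * conj z * u z + conj z ^ 2 * b z) z) * φ z =
      (cauchy a z * φ z + conj z ^ 2 * u z * φ z) -
        cauchy (fun z => 2 * conj z * u z + conj z ^ 2 * b z) z * φ z := fun z => by ring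
  have k14 : IntegrableOn (fun z => cauchy a z * φ z + conj z ^ 2 * u z * φ z) disc := k1.add j4
  simp only [e']
  rw [integral_sub k14 k2, integral_add k1 j4, integral_cauchy_mul hu1 hφ.dz ((tsupport_dz_subset φ).trans hs),
    integral_cauchy_mul ha1 hφ hs, integral_cauchy_mul hc1 hφ hs]
  linear_combination -key

/-- The inner function `u = s·C̄h` is in `W^{1,p}`; then `∂̄ C u = u` and the formula for `∂ C u`
are both in `W^{1,p}`. -/
theorem memSobolevDisc_two_of_eqOn {p : ℝ} (hp : 2 < p) {s h f : ℂ → ℂ}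
    (hs : ContDiff ℝ ((⊤ : ℕ∞) : WithTop ℕ∞) s) (hh : MemLpDisc p h)
    (hf : EqOn f (fun z => 1 + -(1 / 4) * cauchy (fun ξ => s ξ * cauchyBar h ξ) z) disc) :
    MemSobolevDisc 2 p f := by
  have hp1 : 1 ≤ p := by linarith
  obtain ⟨g, hg⟩ := exists_isSobolev_cauchy hp hh.conj
  have h1 := hg.conj_comp
  rw [← funext (cauchyBar_eq h)] at h1
  have hu := h1.smooth_mul hp1 hs
  generalize (fun z => s z * cauchyBar h z) = u at hu hf
  set a := fun z => dz s z * cauchyBar h z + s z * conj (conj (h z))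
  set b := fun z => dzbar s z * cauchyBar h z + s z * conj (g z)
  have hV := hu.smooth_mul hp1 contDiff_conj_sq
  simp only [(hasWirtingerAt_conj_sq _).dzbar_eq] at hV
  obtain ⟨g1, hg1⟩ := exists_isSobolev_cauchy hp hu.2
  obtain ⟨g2, hg2⟩ := exists_isSobolev_cauchy hp hV.3
  obtain ⟨g3, hg3⟩ := exists_isSobolev_cauchy hp hu.1
  have hG := (hg1.add hp1 hV).add hp1 (hg2.const_mul hp1 (-1))
  -- The Beurling representative of the `∂`-derivative is replaced by the one from the tangential
  -- formula, since `hG` shows the latter to be in `W^{1,p}`.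
  have hC : IsSobolev p (cauchy u) _ u := ⟨hg3.1, hG.1, hu.1, hu.hasDz_cauchy hp, hg3.5⟩
  have hF := (IsSobolev.one.add hp1 (hC.const_mul hp1 (-(1 / 4)))).congr hf.symm
  simp only [zero_add] at hF
  exact hF.memSobolevDisc_two hp1 (hG.const_mul hp1 _) (hu.const_mul hp1 _)

end BukhgeimDisc


namespace BukhgeimDisc

/-! ### Oscillatory integrals with quadratic phase -/

theorem integrable_inv_sq_add_sq (a : ℝ) {u : ℝ} (hu : 0 < u) :
    Integrable (fun x : ℝ => ((x - a) ^ 2 + u ^ 2)⁻¹) ∧ ∫ x : ℝ, ((x - a) ^ 2 + u ^ 2)⁻¹ = Real.pi / u := by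
  have e : (fun x : ℝ => ((x - a) ^ 2 + u ^ 2)⁻¹) = fun x => (u ^ 2)⁻¹ * (1 + ((x - a) / u) ^ 2)⁻¹ := by
    ext x
    rw [← mul_inv]
    congr 1
    field_simp
    ring
  rw [e]
  have h0 : Integrable fun x : ℝ => (1 + (x / u) ^ 2)⁻¹ :=
    integrable_inv_one_add_sq.comp_div hu.ne'
  constructor
  · exact (h0.comp_sub_right a).const_mul _
  · rw [integral_const_mul, integral_sub_right_eq_self (fun x : ℝ => (1 + (x / u) ^ 2)⁻¹) a,
      Measure.integral_comp_div (fun x : ℝ => (1 + x ^ 2)⁻¹) u, integral_univ_inv_one_add_sq,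
      abs_of_pos hu, smul_eq_mul]
    field_simp

theorem intervalIntegral_inv_sq_add_sq_le (a : ℝ) {u α β : ℝ} (hu : 0 < u) (hαβ : α ≤ β) :
    ∫ x in α..β, ((x - a) ^ 2 + u ^ 2)⁻¹ ≤ Real.pi / u := by
  rw [← (integrable_inv_sq_add_sq a hu).2, intervalIntegral.integral_of_le hαβ]
  exact setIntegral_le_integral (integrable_inv_sq_add_sq a hu).1 (Eventually.of_forall fun x => by positivity)

/-- Stationary phase without splitting at the critical point. With `D = 1 + 2iμ(x-x₀)²`, the
function `g = (x-x₀)E/D` is an approximate primitive of `E`: `g' = E - w`, where `|g| ≤ 1/(2√|μ|)`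
and `w` has `L¹` norm at most `2π/√|μ|`. Integration by parts yields `S` from the endpoints, `2πS`
from `w` and `V/2` from `A'`. -/
theorem norm_integral_oscillatory_le {A A' : ℝ → ℂ} {μ x₀ S V α β : ℝ} (hμ : μ ≠ 0) (hαβ : α ≤ β)
    (hA : ∀ x, HasDerivAt A (A' x) x) (hA' : Continuous A') (hS : ∀ x, ‖A x‖ ≤ S)
    (hV : ∫ x in α..β, ‖A' x‖ ≤ V) :
    ‖∫ x in α..β, Complex.exp (Complex.I * μ * (x - x₀ : ℂ) ^ 2) * A x‖ ≤
      ((1 + 2 * Real.pi) * S + V / 2) / √|μ| := by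
  have hS0 : 0 ≤ S := (norm_nonneg _).trans (hS 0)
  have hm : 0 < |μ| := abs_pos.2 hμ
  have hsq : 0 < √|μ| := Real.sqrt_pos.2 hm
  have hsq2 : √|μ| ^ 2 = |μ| := Real.sq_sqrt hm.le
  set E : ℝ → ℂ := fun x => Complex.exp (Complex.I * μ * (x - x₀ : ℂ) ^ 2) with hE
  set D : ℝ → ℂ := fun x => 1 + 2 * Complex.I * μ * (x - x₀ : ℂ) ^ 2 with hD
  have nE : ∀ x, ‖E x‖ = 1 := by
    intro x
    have : Complex.I * μ * (x - x₀ : ℂ) ^ 2 = ((μ * (x - x₀) ^ 2 : ℝ) : ℂ) * Complex.I := by push_cast; ring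
    simp only [hE, this, Complex.norm_exp_ofReal_mul_I]
  have nD : ∀ x, ‖D x‖ ^ 2 = 1 + 4 * μ ^ 2 * (x - x₀) ^ 4 := by
    intro x
    have : D x = ((1 : ℝ) : ℂ) + ((2 * μ * (x - x₀) ^ 2 : ℝ) : ℂ) * Complex.I := by
      simp only [hD]; push_cast; ring
    rw [this, ← Complex.normSq_eq_norm_sq, Complex.normSq_add_mul_I]; ring
  have nD0 : ∀ x, 0 < ‖D x‖ := by
    intro x
    have := nD x
    by_contra h
    have h0 : ‖D x‖ = 0 := le_antisymm (not_lt.1 h) (norm_nonneg _)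
    rw [h0] at this
    nlinarith [sq_nonneg (μ * (x - x₀) ^ 2)]
  have D0 : ∀ x, D x ≠ 0 := fun x => norm_pos_iff.1 (nD0 x)
  have dt : ∀ x : ℝ, HasDerivAt (fun x : ℝ => (x - x₀ : ℂ)) 1 x := fun x =>
    (Complex.ofRealCLM.hasDerivAt (x := x)).sub_const (x₀ : ℂ)
  have dE : ∀ x : ℝ, HasDerivAt E (E x * (2 * Complex.I * μ * (x - x₀))) x := by
    intro x
    have := (((dt x).pow 2).const_mul (Complex.I * μ)).cexp
    convert! this using 1
    simp only [hE, Pi.pow_apply]; push_cast; ring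
  have dD : ∀ x : ℝ, HasDerivAt D (4 * Complex.I * μ * (x - x₀)) x := by
    intro x
    have := (((dt x).pow 2).const_mul (2 * Complex.I * μ)).const_add 1
    convert! this using 1
    push_cast; ring
  set g : ℝ → ℂ := fun x => (x - x₀) * E x / D x with hg
  set w : ℝ → ℂ := fun x => 4 * Complex.I * μ * (x - x₀) ^ 2 * E x / D x ^ 2 with hw
  have dg : ∀ x, HasDerivAt g (E x - w x) x := by
    intro x
    have := ((dt x).mul (dE x)).div (dD x) (D0 x)
    convert! this using 1
    simp only [hw, Pi.mul_apply]
    have h0 := D0 x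
    field_simp
    simp only [hD]; ring
  have cE : Continuous E := by simp only [hE]; fun_prop
  have cD : Continuous D := by simp only [hD]; fun_prop
  have cA : Continuous A := continuous_iff_continuousAt.2 fun x => (hA x).continuousAt
  have cg : Continuous g := by
    simp only [hg]
    exact ((by fun_prop : Continuous fun x : ℝ => (x - x₀ : ℂ)).mul cE).div cD D0
  have cw : Continuous w := by
    simp only [hw]
    refine Continuous.div (by fun_prop) (cD.pow 2) fun x => pow_ne_zero _ (D0 x)
  have ng : ∀ x, ‖g x‖ ≤ 1 / (2 * √|μ|) := by
    intro x
    simp only [hg]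
    rw [norm_div, norm_mul, nE, mul_one, div_le_div_iff₀ (nD0 x) (by positivity), one_mul,
      ← Complex.ofReal_sub, Complex.norm_real, Real.norm_eq_abs]
    refine le_of_sq_le_sq ?_ (norm_nonneg _)
    rw [nD, mul_pow, mul_pow, hsq2, sq_abs]
    have : μ ^ 2 = |μ| ^ 2 := (sq_abs μ).symm
    rw [this]
    nlinarith [sq_nonneg (2 * |μ| * (x - x₀) ^ 2 - 1)]
  have nw : ∀ x, ‖w x‖ ≤ 2 / |μ| * ((x - x₀) ^ 2 + (√|μ|)⁻¹ ^ 2)⁻¹ := by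
    intro x
    simp only [hw]
    rw [norm_div, norm_mul, nE, mul_one, norm_pow, nD]
    have e1 : ‖4 * Complex.I * μ * (x - x₀ : ℂ) ^ 2‖ = 4 * |μ| * (x - x₀) ^ 2 := by
      rw [← Complex.ofReal_sub, norm_mul, norm_pow, Complex.norm_real, Real.norm_eq_abs, sq_abs]
      simp
    have : μ ^ 2 = |μ| ^ 2 := (sq_abs μ).symm
    rw [e1, inv_pow, hsq2, ← div_eq_mul_inv, div_div, this,
      div_le_div_iff₀ (by positivity) (by positivity)]
    have e2 : |μ| * ((x - x₀) ^ 2 + |μ|⁻¹) = |μ| * (x - x₀) ^ 2 + 1 := by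
      rw [mul_add, mul_inv_cancel₀ hm.ne']
    rw [e2]
    nlinarith [sq_nonneg (2 * (|μ| * (x - x₀) ^ 2) - 1), mul_nonneg hm.le (sq_nonneg (x - x₀))]
  have key : ∫ x in α..β, E x * A x = g β * A β - g α * A α - ∫ x in α..β, (g x * A' x - w x * A x) := by
    have h1 : ∫ x in α..β, ((E x - w x) * A x + g x * A' x) = g β * A β - g α * A α :=
      intervalIntegral.integral_eq_sub_of_hasDerivAt (fun x _ => (dg x).mul (hA x))
        (Continuous.intervalIntegrable (by fun_prop) _ _)
    rw [← h1, ← intervalIntegral.integral_sub (Continuous.intervalIntegrable (by fun_prop) _ _)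
      (Continuous.intervalIntegrable (by fun_prop) _ _)]
    congr 1 with x
    ring
  have hrest : ‖∫ x in α..β, (g x * A' x - w x * A x)‖ ≤ V / 2 / √|μ| + 2 * Real.pi * S / √|μ| := by
    have hint := (integrable_inv_sq_add_sq x₀ (inv_pos.2 hsq)).1
    calc _ ≤ ∫ x in α..β, (1 / (2 * √|μ|) * ‖A' x‖ + S * (2 / |μ|) * ((x - x₀) ^ 2 + (√|μ|)⁻¹ ^ 2)⁻¹) := by
          refine intervalIntegral.norm_integral_le_of_norm_le hαβ (Eventually.of_forall fun x _ => ?_) ?_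
          · refine (norm_sub_le _ _).trans ?_
            rw [norm_mul, norm_mul, mul_comm ‖w x‖, mul_assoc S]
            gcongr
            exacts [ng x, hS x, nw x]
          · exact (Continuous.intervalIntegrable (by fun_prop) _ _).add (hint.intervalIntegrable.const_mul _)
      _ = 1 / (2 * √|μ|) * (∫ x in α..β, ‖A' x‖) +
            S * (2 / |μ|) * ∫ x in α..β, ((x - x₀) ^ 2 + (√|μ|)⁻¹ ^ 2)⁻¹ := by
          rw [intervalIntegral.integral_add (Continuous.intervalIntegrable (by fun_prop) _ _)
            (hint.intervalIntegrable.const_mul _), intervalIntegral.integral_const_mul,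
            intervalIntegral.integral_const_mul]
      _ ≤ 1 / (2 * √|μ|) * V + S * (2 / |μ|) * (Real.pi / (√|μ|)⁻¹) := by
          gcongr
          exact intervalIntegral_inv_sq_add_sq_le x₀ (inv_pos.2 hsq) hαβ
      _ = _ := by
          generalize √|μ| = m at hsq hsq2 ⊢
          rw [← hsq2]; field_simp
  have hb : ∀ x, ‖g x * A x‖ ≤ S / (2 * √|μ|) := by
    intro x
    rw [norm_mul, div_eq_mul_one_div S, mul_comm S]
    gcongr
    exacts [ng x, hS x]
  change ‖∫ x in α..β, E x * A x‖ ≤ _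
  rw [key]
  calc _ ≤ S / (2 * √|μ|) + S / (2 * √|μ|) + (V / 2 / √|μ| + 2 * Real.pi * S / √|μ|) :=
        (norm_sub_le _ _).trans (add_le_add ((norm_sub_le _ _).trans (add_le_add (hb β) (hb α))) hrest)
    _ = _ := by field_simp; ring

theorem norm_sq_horizontal (z : ℂ) (x y : ℝ) :
    ‖z - (x + y * Complex.I)‖ ^ 2 = (x - z.re) ^ 2 + |y - z.im| ^ 2 := by
  rw [← Complex.normSq_eq_norm_sq, Complex.normSq_apply, sq_abs]
  simp; ring

theorem abs_sub_im_le_norm (z : ℂ) (x y : ℝ) : |y - z.im| ≤ ‖z - (x + y * Complex.I)‖ := by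
  refine le_of_sq_le_sq ?_ (norm_nonneg _)
  rw [norm_sq_horizontal]
  nlinarith [sq_nonneg (x - z.re)]

/-- On a line at distances `u`, `v` from the poles the amplitude is at most `1/(uv)` and its
variation at most `2π/(uv)`, since `|z-ξ|⁻²` integrates to `π/u`. Hence `(1+2π) + π`. -/
theorem norm_slice_integral_le_of_phase {z η : ℂ} {y μ x₀ α β : ℝ} (hμ : μ ≠ 0) (hαβ : α ≤ β)
    (hz : 0 < |y - z.im|) (hη : 0 < |y - η.im|) :
    ‖∫ x in α..β, Complex.exp (Complex.I * μ * (x - x₀ : ℂ) ^ 2) *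
      ((z - (x + y * Complex.I))⁻¹ * (conj (x + y * Complex.I) - conj η)⁻¹)‖ ≤
      (1 + 3 * Real.pi) / √|μ| * (|y - z.im| * |y - η.im|)⁻¹ := by
  set u := |y - z.im|
  set v := |y - η.im|
  have nz : ∀ x : ℝ, u ≤ ‖z - (x + y * Complex.I)‖ := fun x => abs_sub_im_le_norm z x y
  have hc : ∀ x : ℝ, conj (x + y * Complex.I) - conj η = -conj (η - (x + y * Complex.I)) := by
    intro x; rw [map_sub]; ring
  have nη : ∀ x : ℝ, v ≤ ‖conj (x + y * Complex.I) - conj η‖ := by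
    intro x
    rw [hc, norm_neg, Complex.norm_conj]
    exact abs_sub_im_le_norm η x y
  have z0 : ∀ x : ℝ, z - (x + y * Complex.I) ≠ 0 := fun x => norm_pos_iff.1 (hz.trans_le (nz x))
  have η0 : ∀ x : ℝ, conj (x + y * Complex.I) - conj η ≠ 0 := fun x => norm_pos_iff.1 (hη.trans_le (nη x))
  have d1 : ∀ x : ℝ, HasDerivAt (fun x : ℝ => (z - (x + y * Complex.I))⁻¹)
      (((z - (x + y * Complex.I)) ^ 2)⁻¹) x := by
    intro x
    have := (((Complex.ofRealCLM.hasDerivAt (x := x)).add_const (y * Complex.I)).const_sub z).inv (z0 x)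
    convert! this using 1
    simp [div_eq_mul_inv]
  have d2 : ∀ x : ℝ, HasDerivAt (fun x : ℝ => (conj (x + y * Complex.I) - conj η)⁻¹)
      (-((conj (x + y * Complex.I) - conj η) ^ 2)⁻¹) x := by
    intro x
    have e : ∀ x : ℝ, conj ((x : ℂ) + y * Complex.I) - conj η = x + (-(y * Complex.I) - conj η) := by
      intro x; simp; ring
    have h0 := η0 x
    simp only [e] at h0 ⊢
    have := ((Complex.ofRealCLM.hasDerivAt (x := x)).add_const (-(y * Complex.I) - conj η)).inv h0
    convert! this using 1
    simp [div_eq_mul_inv]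
  have c1 : Continuous fun x : ℝ => (z - (x + y * Complex.I))⁻¹ :=
    continuous_iff_continuousAt.2 fun x => (d1 x).continuousAt
  have c2 : Continuous fun x : ℝ => (conj ((x : ℂ) + y * Complex.I) - conj η)⁻¹ :=
    continuous_iff_continuousAt.2 fun x => (d2 x).continuousAt
  have i1 := (integrable_inv_sq_add_sq z.re hz).1
  have i2 := (integrable_inv_sq_add_sq η.re hη).1
  have b1 : ∀ x : ℝ, ‖(z - (x + y * Complex.I))⁻¹‖ ≤ u⁻¹ := fun x => by
    rw [norm_inv]; exact inv_anti₀ hz (nz x)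
  have b2 : ∀ x : ℝ, ‖(conj (x + y * Complex.I) - conj η)⁻¹‖ ≤ v⁻¹ := fun x => by
    rw [norm_inv]; exact inv_anti₀ hη (nη x)
  have hA' : Continuous fun x : ℝ => ((z - (x + y * Complex.I)) ^ 2)⁻¹ * (conj ((x : ℂ) + y * Complex.I) - conj η)⁻¹ +
      (z - (x + y * Complex.I))⁻¹ * -((conj ((x : ℂ) + y * Complex.I) - conj η) ^ 2)⁻¹ := by
    simp only [← inv_pow]
    fun_prop
  have hV : ∫ x in α..β, ‖((z - (x + y * Complex.I)) ^ 2)⁻¹ * (conj (x + y * Complex.I) - conj η)⁻¹ +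
      (z - (x + y * Complex.I))⁻¹ * -((conj (x + y * Complex.I) - conj η) ^ 2)⁻¹‖ ≤ 2 * Real.pi * (u * v)⁻¹ := by
    calc _ ≤ ∫ x in α..β, (v⁻¹ * ((x - z.re) ^ 2 + u ^ 2)⁻¹ + u⁻¹ * ((x - η.re) ^ 2 + v ^ 2)⁻¹) := by
          refine intervalIntegral.integral_mono_on hαβ (hA'.norm.intervalIntegrable _ _)
            ((i1.intervalIntegrable.const_mul _).add (i2.intervalIntegrable.const_mul _)) fun x _ => ?_
          refine (norm_add_le _ _).trans ?_
          rw [norm_mul, norm_mul, norm_neg, norm_inv (_ ^ 2), norm_inv (_ ^ 2), norm_pow, norm_pow,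
            norm_sq_horizontal, hc x, norm_neg (conj _), Complex.norm_conj, norm_sq_horizontal, ← hc x,
            mul_comm v⁻¹]
          gcongr
          exacts [b2 x, b1 x]
      _ = v⁻¹ * (∫ x in α..β, ((x - z.re) ^ 2 + u ^ 2)⁻¹) + u⁻¹ * ∫ x in α..β, ((x - η.re) ^ 2 + v ^ 2)⁻¹ := by
          rw [intervalIntegral.integral_add (i1.intervalIntegrable.const_mul _) (i2.intervalIntegrable.const_mul _),
            intervalIntegral.integral_const_mul, intervalIntegral.integral_const_mul]
      _ ≤ v⁻¹ * (Real.pi / u) + u⁻¹ * (Real.pi / v) := by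
          gcongr
          exacts [intervalIntegral_inv_sq_add_sq_le _ hz hαβ, intervalIntegral_inv_sq_add_sq_le _ hη hαβ]
      _ = _ := by field_simp; ring
  have := norm_integral_oscillatory_le (x₀ := x₀) (S := (u * v)⁻¹) hμ hαβ (fun x => (d1 x).mul (d2 x)) hA'
    (fun x => by
      simp only [Pi.mul_apply]
      rw [norm_mul, mul_inv]
      gcongr
      exacts [b1 x, b2 x]) hV
  refine this.trans_eq ?_
  field_simp
  ring

theorem norm_slice_integral_le_of_size {z η : ℂ} {y α β : ℝ} {E : ℝ → ℂ} (hE : ∀ x, ‖E x‖ = 1) (hαβ : α ≤ β)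
    (hz : 0 < |y - z.im|) (hη : 0 < |y - η.im|) :
    ‖∫ x in α..β, E x * ((z - (x + y * Complex.I))⁻¹ * (conj (x + y * Complex.I) - conj η)⁻¹)‖ ≤
      Real.pi / √(|y - z.im| * |y - η.im|) := by
  set u := |y - z.im|
  set v := |y - η.im|
  have i1 := (integrable_inv_sq_add_sq z.re hz).1
  have i2 := (integrable_inv_sq_add_sq η.re hη).1
  have hsu : 0 < √u := Real.sqrt_pos.2 hz
  have hsv : 0 < √v := Real.sqrt_pos.2 hη
  have hc : ∀ x : ℝ, conj (x + y * Complex.I) - conj η = -conj (η - (x + y * Complex.I)) := by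
    intro x; rw [map_sub]; ring
  have hu2 : √u ^ 2 = u := Real.sq_sqrt hz.le
  have hv2 : √v ^ 2 = v := Real.sq_sqrt hη.le
  -- Weight of the arithmetic–geometric mean inequality, chosen so that both squares contribute
  -- `π/(2√(uv))`.
  set k := √u / √v
  have hk : 0 < k := by positivity
  calc _ ≤ ∫ x in α..β, (k / 2 * ((x - z.re) ^ 2 + u ^ 2)⁻¹ + k⁻¹ / 2 * ((x - η.re) ^ 2 + v ^ 2)⁻¹) := by
        refine intervalIntegral.norm_integral_le_of_norm_le hαβ (Eventually.of_forall fun x _ => ?_)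
          ((i1.intervalIntegrable.const_mul _).add (i2.intervalIntegrable.const_mul _))
        rw [norm_mul, hE, one_mul, norm_mul, norm_inv, norm_inv, hc x, norm_neg (conj _), Complex.norm_conj,
          ← norm_sq_horizontal, ← norm_sq_horizontal, ← inv_pow, ← inv_pow]
        have : k * k⁻¹ = 1 := mul_inv_cancel₀ hk.ne'
        have e : k / 2 * ‖z - (x + y * Complex.I)‖⁻¹ ^ 2 + k⁻¹ / 2 * ‖η - (x + y * Complex.I)‖⁻¹ ^ 2 -
            ‖z - (x + y * Complex.I)‖⁻¹ * ‖η - (x + y * Complex.I)‖⁻¹ =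
            k⁻¹ / 2 * (k * ‖z - (x + y * Complex.I)‖⁻¹ - ‖η - (x + y * Complex.I)‖⁻¹) ^ 2 := by
          field_simp; ring
        have h2 : 0 ≤ k⁻¹ / 2 * (k * ‖z - (x + y * Complex.I)‖⁻¹ - ‖η - (x + y * Complex.I)‖⁻¹) ^ 2 := by positivity
        linarith
    _ = k / 2 * (∫ x in α..β, ((x - z.re) ^ 2 + u ^ 2)⁻¹) + k⁻¹ / 2 * ∫ x in α..β, ((x - η.re) ^ 2 + v ^ 2)⁻¹ := by
        rw [intervalIntegral.integral_add (i1.intervalIntegrable.const_mul _) (i2.intervalIntegrable.const_mul _),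
          intervalIntegral.integral_const_mul, intervalIntegral.integral_const_mul]
    _ ≤ k / 2 * (Real.pi / u) + k⁻¹ / 2 * (Real.pi / v) := by
        gcongr
        exacts [intervalIntegral_inv_sq_add_sq_le _ hz hαβ, intervalIntegral_inv_sq_add_sq_le _ hη hαβ]
    _ = _ := by
        rw [Real.sqrt_mul hz.le]
        simp only [k]
        generalize √u = c at hsu hu2 ⊢
        generalize √v = d at hsv hv2 ⊢
        rw [← hu2, ← hv2]
        field_simp
        ring

end BukhgeimDisc


namespace BukhgeimDisc

/-! ### One-dimensional singular integrals -/

theorem lintegral_abs_sub (G : ℝ → ℝ≥0∞) (c : ℝ) :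
    ∫⁻ y, G |y - c| = 2 * ∫⁻ t in Ioi 0, G t := by
  rw [lintegral_sub_right_eq_self (fun y => G |y|) c, ← lintegral_add_compl _ (measurableSet_Ioi (a := (0 : ℝ))),
    compl_Ioi, two_mul]
  congr 1
  · exact setLIntegral_congr_fun measurableSet_Ioi fun t ht => by simp only [abs_of_pos (mem_Ioi.1 ht)]
  · have h : MeasurePreserving (Neg.neg : ℝ → ℝ) := Measure.measurePreserving_neg volume
    rw [← h.setLIntegral_comp_preimage_emb (MeasurableEquiv.neg ℝ).measurableEmbedding, neg_preimage, neg_Iic, neg_zero,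
      setLIntegral_congr Ioi_ae_eq_Ici.symm]
    exact setLIntegral_congr_fun measurableSet_Ioi fun t ht => by simp only [abs_neg, abs_of_pos (mem_Ioi.1 ht)]

theorem lintegral_two_point_line_le {c c' : ℝ} (h : c ≠ c') :
    ∫⁻ y, ENNReal.ofReal ((|y - c| * |y - c'|) ^ (-(7 / 10) : ℝ)) ≤
      ENNReal.ofReal (47 * |c - c'| ^ (-(2 / 5) : ℝ)) := by
  set d := |c - c'|
  have hd : 0 < d := abs_pos.2 (sub_ne_zero.2 h)
  set F : ℝ → ℝ := fun a => if a < d / 2 then (d / 2) ^ (-(7 / 10) : ℝ) * a ^ (-(7 / 10) : ℝ) else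
    a ^ (-(2 * (7 / 10)) : ℝ) with hF
  have hF0 : ∀ a, 0 ≤ a → 0 ≤ F a := fun a ha => by simp only [hF]; split_ifs <;> positivity
  have hFm : Measurable F := Measurable.ite measurableSet_Iio (by fun_prop) (by fun_prop)
  have hpt : ∀ y, ENNReal.ofReal ((|y - c| * |y - c'|) ^ (-(7 / 10) : ℝ)) ≤
      ENNReal.ofReal (F |y - c|) + ENNReal.ofReal (F |y - c'|) := by
    intro y
    have hdy : d ≤ |y - c| + |y - c'| := by
      have := abs_sub_le c y c'
      rwa [abs_sub_comm c y] at this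
    rcases (abs_nonneg (y - c)).eq_or_lt with h0 | h1
    · rw [← h0, zero_mul, Real.zero_rpow (by norm_num)]; simp
    rcases (abs_nonneg (y - c')).eq_or_lt with h0 | h2
    · rw [← h0, mul_zero, Real.zero_rpow (by norm_num)]; simp
    rcases le_total |y - c| |y - c'| with hle | hle
    · exact le_add_right (ENNReal.ofReal_le_ofReal (mul_rpow_neg_le h1 hd hle hdy (by norm_num)))
    · rw [mul_comm]
      exact le_add_left (ENNReal.ofReal_le_ofReal (mul_rpow_neg_le h2 hd hle (by linarith) (by norm_num)))
  -- `35/6 = 10/3 + 5/2`, from exponents `-7/10` near the pole and `-7/5` away from it. Two poles,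
  -- two sides of each and `2^(2/5) ≤ 2` give `4·(35/6)·2 ≤ 47`.
  have hI : ∫⁻ t in Ioi 0, ENNReal.ofReal (F t) = ENNReal.ofReal (35 / 6 * (d / 2) ^ (-(2 / 5) : ℝ)) := by
    rw [← Ioo_union_Ici_eq_Ioi (half_pos hd), lintegral_union measurableSet_Ici
      (Set.disjoint_left.2 fun x hx hx' => absurd hx.2 (not_lt.2 hx'))]
    have h1 : ∫⁻ t in Ioo 0 (d / 2), ENNReal.ofReal (F t) =
        ENNReal.ofReal ((d / 2) ^ (-(7 / 10) : ℝ)) * ENNReal.ofReal ((d / 2) ^ (-(7 / 10) + 1 : ℝ) / (-(7 / 10) + 1)) := by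
      rw [← lintegral_Ioo_rpow (by norm_num) (half_pos hd), ← lintegral_const_mul _ (by fun_prop)]
      refine setLIntegral_congr_fun measurableSet_Ioo fun t ht => ?_
      simp only [hF, if_pos ht.2]
      rw [ENNReal.ofReal_mul (by positivity)]
    have h2 : ∫⁻ t in Ici (d / 2), ENNReal.ofReal (F t) =
        ENNReal.ofReal ((d / 2) ^ (-(2 * (7 / 10)) + 1 : ℝ) / (-(-(2 * (7 / 10))) - 1)) := by
      rw [← lintegral_Ici_rpow (by norm_num) (half_pos hd)]
      exact setLIntegral_congr_fun measurableSet_Ici fun t ht => by simp only [hF, if_neg (not_lt.2 (mem_Ici.1 ht))]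
    rw [h1, h2, ← ENNReal.ofReal_mul (by positivity), ← ENNReal.ofReal_add (by positivity)
      (div_nonneg (by positivity) (by norm_num)), mul_div_assoc', ← Real.rpow_add (half_pos hd)]
    congr 1
    norm_num
    ring
  calc _ ≤ ∫⁻ y, (ENNReal.ofReal (F |y - c|) + ENNReal.ofReal (F |y - c'|)) := lintegral_mono hpt
    _ = 4 * ENNReal.ofReal (35 / 6 * (d / 2) ^ (-(2 / 5) : ℝ)) := by
      rw [lintegral_add_left (by fun_prop), lintegral_abs_sub (fun t => ENNReal.ofReal (F t)),
        lintegral_abs_sub (fun t => ENNReal.ofReal (F t)), hI]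
      ring
    _ ≤ _ := by
      rw [show (4 : ℝ≥0∞) = ENNReal.ofReal 4 by simp, ← ENNReal.ofReal_mul (by norm_num)]
      apply ENNReal.ofReal_le_ofReal
      have e : (d / 2) ^ (-(2 / 5) : ℝ) ≤ 2 * d ^ (-(2 / 5) : ℝ) := by
        rw [Real.div_rpow hd.le (by norm_num), div_eq_mul_inv, ← Real.rpow_neg (by norm_num), mul_comm]
        gcongr
        calc (2 : ℝ) ^ (-(-(2 / 5)) : ℝ) ≤ 2 ^ (1 : ℝ) := Real.rpow_le_rpow_of_exponent_le (by norm_num) (by norm_num)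
          _ = 2 := Real.rpow_one 2
      have : 0 ≤ d ^ (-(2 / 5) : ℝ) := by positivity
      linarith

/-- The integral of a function of the imaginary part over the disc. -/
theorem lintegral_disc_im_le {G : ℝ → ℝ≥0∞} (hG : Measurable G) :
    ∫⁻ η in disc, G η.im ≤ 2 * ∫⁻ y in Ioo (-1) 1, G y := by
  have hsub : disc ⊆ Complex.measurableEquivRealProd ⁻¹' (Ioo (-1) 1 ×ˢ Ioo (-1) 1) := by
    intro η hη
    rw [disc, mem_ball_zero_iff] at hη
    simp only [mem_preimage, Complex.measurableEquivRealProd_apply, mem_prod, mem_Ioo, ← abs_lt]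
    exact ⟨(Complex.abs_re_le_norm η).trans_lt hη, (Complex.abs_im_le_norm η).trans_lt hη⟩
  calc _ ≤ ∫⁻ η in Complex.measurableEquivRealProd ⁻¹' (Ioo (-1) 1 ×ˢ Ioo (-1) 1), G η.im := lintegral_mono_set hsub
    _ = ∫⁻ x in Ioo (-1 : ℝ) 1 ×ˢ Ioo (-1 : ℝ) 1, G x.2 :=
      Complex.volume_preserving_equiv_real_prod.setLIntegral_comp_preimage
        (measurableSet_Ioo.prod measurableSet_Ioo) (hG.comp measurable_snd)
    _ = _ := by
      rw [Measure.volume_eq_prod, setLIntegral_prod _ (by fun_prop)]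
      simp [mul_comm]
      norm_num

/-- The one-sided integral over `(0,2)` is `2^(1-s)/(1-s) ≤ 10`; one factor `2` comes from the two
sides of `c`, another from the real direction. -/
theorem lintegral_disc_im_rpow_le {c s : ℝ} (hc : |c| ≤ 1) (hs0 : 0 < s) (hs : s ≤ 4 / 5) :
    ∫⁻ η in disc, ENNReal.ofReal (|c - η.im| ^ (-s)) ≤ 40 := by
  have hG : Measurable fun y : ℝ => ENNReal.ofReal (|c - y| ^ (-s)) := by fun_prop
  refine (lintegral_disc_im_le hG).trans ?_
  have h1 : ∫⁻ y in Ioo (-1) 1, ENNReal.ofReal (|c - y| ^ (-s)) ≤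
      ∫⁻ y, (Iio 2).indicator (fun t => ENNReal.ofReal (t ^ (-s))) |y - c| := by
    rw [← lintegral_indicator measurableSet_Ioo]
    refine lintegral_mono fun y => ?_
    by_cases hy : y ∈ Ioo (-1 : ℝ) 1
    swap
    · rw [indicator_of_notMem hy]; exact zero_le
    have : |y - c| < 2 := by
      have := abs_le.1 hc
      rw [abs_lt]
      constructor <;> linarith [hy.1, hy.2]
    rw [indicator_of_mem hy, indicator_of_mem (mem_Iio.2 this), abs_sub_comm]
  have h2 : ∫⁻ t in Ioi 0, (Iio 2).indicator (fun t : ℝ => ENNReal.ofReal (t ^ (-s))) t ≤ 10 := by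
    rw [lintegral_indicator measurableSet_Iio, Measure.restrict_restrict measurableSet_Iio, inter_comm, Ioi_inter_Iio,
      lintegral_Ioo_rpow (by linarith) (by norm_num), show (10 : ℝ≥0∞) = ENNReal.ofReal 10 by simp]
    apply ENNReal.ofReal_le_ofReal
    rw [div_le_iff₀ (by linarith)]
    calc (2 : ℝ) ^ (-s + 1) ≤ 2 ^ (1 : ℝ) := Real.rpow_le_rpow_of_exponent_le (by norm_num) (by linarith)
      _ ≤ 10 * (-s + 1) := by rw [Real.rpow_one]; linarith
  rw [lintegral_abs_sub] at h1
  calc _ ≤ (2 : ℝ≥0∞) * (2 * 10) := by gcongr; exact h1.trans (by gcongr)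
    _ = 40 := by norm_num

/-! ### Slices of area integrals -/

theorem enorm_setIntegral_disc_le (F : ℂ → ℂ) :
    ‖∫ ξ in disc, F ξ‖ₑ ≤ ∫⁻ y : ℝ, ‖∫ x in -√(1 - y ^ 2)..√(1 - y ^ 2), F (x + y * Complex.I)‖ₑ := by
  by_cases hi : IntegrableOn F disc
  swap
  · rw [integral_undef hi]; simp
  rw [← integral_indicator measurableSet_disc]
  have hmp := Complex.volume_preserving_equiv_real_prod.symm
  rw [← hmp.integral_comp (MeasurableEquiv.measurableEmbedding _), Measure.volume_eq_prod]
  have hi' : Integrable (fun x : ℝ × ℝ => disc.indicator F (Complex.measurableEquivRealProd.symm x))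
      (volume.prod volume) :=
    (hmp.integrable_comp_emb (MeasurableEquiv.measurableEmbedding _)).2 (hi.integrable_indicator measurableSet_disc)
  rw [integral_prod_symm _ hi']
  refine (enorm_integral_le_lintegral_enorm _).trans (lintegral_mono fun y => le_of_eq ?_)
  congr 1
  rw [intervalIntegral.integral_of_le (by linarith [Real.sqrt_nonneg (1 - y ^ 2)]), integral_Ioc_eq_integral_Ioo,
    ← integral_indicator measurableSet_Ioo]
  congr 1; ext x
  have e : Complex.measurableEquivRealProd.symm (x, y) = x + y * Complex.I := by
    apply Complex.ext <;> simp
  rw [e]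
  have hmem : (x + y * Complex.I ∈ disc) ↔ x ∈ Ioo (-√(1 - y ^ 2)) √(1 - y ^ 2) := by
    rw [disc, mem_ball_zero_iff, mem_Ioo, ← abs_lt, Real.lt_sqrt (abs_nonneg x), sq_abs, ← sq_lt_one_iff₀ (norm_nonneg _),
      ← Complex.normSq_eq_norm_sq, Complex.normSq_add_mul_I]
    constructor <;> intro h <;> linarith
  by_cases hx : x ∈ Ioo (-√(1 - y ^ 2)) √(1 - y ^ 2)
  · rw [indicator_of_mem hx, indicator_of_mem (hmem.2 hx)]
  · rw [indicator_of_notMem hx, indicator_of_notMem (mt hmem.1 hx)]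

end BukhgeimDisc


namespace BukhgeimDisc

/-! ### The oscillating factor -/

theorem phase_eq_ofReal (z₀ z : ℂ) : phase z₀ z = ((2 * ((z.re - z₀.re) ^ 2 - (z.im - z₀.im) ^ 2) : ℝ) : ℂ) := by
  unfold phase
  apply Complex.ext <;> simp [pow_two] <;> ring

theorem osc_eq (n : ℝ) (z₀ z : ℂ) :
    osc n z₀ z = Complex.exp ((n * (2 * ((z.re - z₀.re) ^ 2 - (z.im - z₀.im) ^ 2)) : ℝ) * Complex.I) := by
  rw [osc, phase_eq_ofReal, mul_comm Complex.I, mul_right_comm]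
  push_cast
  ring_nf

theorem norm_osc (n : ℝ) (z₀ z : ℂ) : ‖osc n z₀ z‖ = 1 := by
  rw [osc_eq, Complex.norm_exp_ofReal_mul_I]

theorem enorm_osc (n : ℝ) (z₀ z : ℂ) : ‖osc n z₀ z‖ₑ = 1 := by
  rw [← ofReal_norm, norm_osc, ENNReal.ofReal_one]

theorem conj_osc (n : ℝ) (z₀ z : ℂ) : conj (osc n z₀ z) = osc (-n) z₀ z := by
  rw [osc, osc, ← Complex.exp_conj, phase_eq_ofReal, map_mul, map_mul, Complex.conj_ofReal, Complex.conj_ofReal,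
    Complex.conj_I, Complex.ofReal_neg]
  ring_nf

theorem contDiff_osc (n : ℝ) (z₀ : ℂ) : ContDiff ℝ ((⊤ : ℕ∞) : WithTop ℕ∞) (osc n z₀) := by
  have hc : ContDiff ℝ ((⊤ : ℕ∞) : WithTop ℕ∞) fun z : ℂ => conj z := Complex.conjCLE.contDiff
  unfold osc phase
  fun_prop

theorem continuous_osc_prod (n : ℝ) : Continuous fun x : ℂ × ℂ => osc n x.1 x.2 := by
  unfold osc phase
  fun_prop

theorem osc_add_mul_I (n : ℝ) (z₀ : ℂ) (x y : ℝ) :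
    osc n z₀ (x + y * Complex.I) = Complex.exp (-(Complex.I * (2 * n : ℝ) * (y - z₀.im : ℂ) ^ 2)) *
      Complex.exp (Complex.I * (2 * n : ℝ) * (x - z₀.re : ℂ) ^ 2) := by
  rw [osc_eq, ← Complex.exp_add]
  congr 1
  simp
  ring

/-! ### Decay of the oscillatory kernel -/

/-- Weighted geometric mean of the stationary phase bound, whose `P⁻¹` is not integrable across the
poles, and the size bound, which has no decay. Weight `θ` gives `N^(-θ/2) P^(-(1+θ)/2)` and, after
integration over the lines, a singularity of order `θ` that must be in `L^q` for all `q < 2`. The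
choice `θ = 2/5` leaves room. -/
theorem le_of_le_of_le_interpolation {x N P : ℝ} (hx : 0 ≤ x) (hN : 0 < N) (hP : 0 < P)
    (h1 : x ≤ 8 / √N * P⁻¹) (h2 : x ≤ 8 / √P) :
    x ≤ 8 * N ^ (-(1 / 5) : ℝ) * P ^ (-(7 / 10) : ℝ) := by
  have e : x = x ^ (2 / 5 : ℝ) * x ^ (3 / 5 : ℝ) := by
    rw [← Real.rpow_add_of_nonneg hx (by norm_num) (by norm_num)]; norm_num
  have e1 : 8 / √N * P⁻¹ = 8 * (N ^ (-(1 / 2) : ℝ) * P ^ (-1 : ℝ)) := by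
    rw [Real.rpow_neg hN.le, ← Real.sqrt_eq_rpow, Real.rpow_neg_one]; ring
  have e2 : 8 / √P = 8 * P ^ (-(1 / 2) : ℝ) := by
    rw [Real.rpow_neg hP.le, ← Real.sqrt_eq_rpow]; ring
  rw [e1] at h1
  rw [e2] at h2
  have h8 : (8 : ℝ) ^ (2 / 5 : ℝ) * 8 ^ (3 / 5 : ℝ) = 8 := by
    rw [← Real.rpow_add (by norm_num)]; norm_num
  calc x = x ^ (2 / 5 : ℝ) * x ^ (3 / 5 : ℝ) := e
    _ ≤ (8 * (N ^ (-(1 / 2) : ℝ) * P ^ (-1 : ℝ))) ^ (2 / 5 : ℝ) * (8 * P ^ (-(1 / 2) : ℝ)) ^ (3 / 5 : ℝ) := by gcongr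
    _ = (8 ^ (2 / 5 : ℝ) * 8 ^ (3 / 5 : ℝ)) * N ^ (-(1 / 2) * (2 / 5) : ℝ) *
        (P ^ (-1 * (2 / 5) : ℝ) * P ^ (-(1 / 2) * (3 / 5) : ℝ)) := by
      rw [Real.mul_rpow (by norm_num) (by positivity), Real.mul_rpow (by positivity) (by positivity),
        Real.mul_rpow (by norm_num) (by positivity), ← Real.rpow_mul hN.le, ← Real.rpow_mul hP.le, ← Real.rpow_mul hP.le]
      ring
    _ = _ := by
      rw [h8, ← Real.rpow_add hP]; norm_num

theorem enorm_oscillatory_slice_le {n : ℝ} (hn : n ≠ 0) (z₀ : ℂ) {z η : ℂ} {y α β : ℝ} (hαβ : α ≤ β)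
    (hz : y ≠ z.im) (hη : y ≠ η.im) :
    ‖∫ x in α..β, osc n z₀ (x + y * Complex.I) *
      ((z - (x + y * Complex.I))⁻¹ * (conj (x + y * Complex.I) - conj η)⁻¹)‖ₑ ≤
    ENNReal.ofReal (8 * |n| ^ (-(1 / 5) : ℝ)) * ENNReal.ofReal ((|y - z.im| * |y - η.im|) ^ (-(7 / 10) : ℝ)) := by
  have hz' : 0 < |y - z.im| := abs_pos.2 (sub_ne_zero.2 hz)
  have hη' : 0 < |y - η.im| := abs_pos.2 (sub_ne_zero.2 hη)
  have hN : 0 < |n| := abs_pos.2 hn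
  rw [← ENNReal.ofReal_mul (by positivity), ← ofReal_norm]
  apply ENNReal.ofReal_le_ofReal
  apply le_of_le_of_le_interpolation (norm_nonneg _) hN (by positivity)
  -- On a horizontal line the vertical part of the phase is a constant unimodular factor, and the
  -- rest is quadratic with `μ = 2n`. The `√2` so gained brings `1 + 3π` below `8√2`.
  · simp only [osc_add_mul_I, mul_assoc _ (Complex.exp (Complex.I * _ * _)) _]
    rw [intervalIntegral.integral_const_mul, norm_mul]
    have e : ‖Complex.exp (-(Complex.I * (2 * n : ℝ) * (y - z₀.im : ℂ) ^ 2))‖ = 1 := by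
      rw [show -(Complex.I * (2 * n : ℝ) * (y - z₀.im : ℂ) ^ 2) = ((-(2 * n * (y - z₀.im) ^ 2) : ℝ) : ℂ) * Complex.I by
        push_cast; ring]
      exact Complex.norm_exp_ofReal_mul_I _
    rw [e, one_mul]
    refine (norm_slice_integral_le_of_phase (mul_ne_zero two_ne_zero hn) hαβ hz' hη').trans ?_
    gcongr ?_ * _
    rw [abs_mul, abs_two, Real.sqrt_mul (by norm_num), ← div_div]
    gcongr
    rw [div_le_iff₀ (by positivity)]
    have h2 : (1.4 : ℝ) ≤ √2 := by
      apply Real.le_sqrt_of_sq_le; norm_num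
    nlinarith [Real.pi_lt_d2]
  · refine (norm_slice_integral_le_of_size (fun x => norm_osc n z₀ _) hαβ hz' hη').trans ?_
    gcongr
    linarith [Real.pi_lt_d2]

theorem enorm_oscillatory_kernel_le {n : ℝ} (hn : n ≠ 0) (z₀ : ℂ) {z η : ℂ} (h : z.im ≠ η.im) :
    ‖∫ ξ in disc, osc n z₀ ξ * ((z - ξ)⁻¹ * (conj ξ - conj η)⁻¹)‖ₑ ≤
      ENNReal.ofReal (376 * |n| ^ (-(1 / 5) : ℝ)) * ENNReal.ofReal (|z.im - η.im| ^ (-(2 / 5) : ℝ)) := by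
  refine (enorm_setIntegral_disc_le _).trans ?_
  calc _ ≤ ∫⁻ y : ℝ, ENNReal.ofReal (8 * |n| ^ (-(1 / 5) : ℝ)) *
        ENNReal.ofReal ((|y - z.im| * |y - η.im|) ^ (-(7 / 10) : ℝ)) := by
        apply lintegral_mono_ae
        filter_upwards [Measure.ae_ne volume z.im, Measure.ae_ne volume η.im] with y h1 h2
        exact enorm_oscillatory_slice_le hn z₀ (by linarith [Real.sqrt_nonneg (1 - y ^ 2)]) h1 h2
    _ ≤ ENNReal.ofReal (8 * |n| ^ (-(1 / 5) : ℝ)) * ENNReal.ofReal (47 * |z.im - η.im| ^ (-(2 / 5) : ℝ)) := by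
        rw [lintegral_const_mul _ (by fun_prop)]
        gcongr
        exact lintegral_two_point_line_le h
    -- `376 = 8·47`.
    _ = _ := by
        rw [ENNReal.ofReal_mul (by norm_num), ENNReal.ofReal_mul (by norm_num), ENNReal.ofReal_mul (by norm_num),
          mul_mul_mul_comm, ← ENNReal.ofReal_mul (by norm_num), mul_assoc]
        norm_num

/-! ### The operator as a double integral -/

theorem integrable_double_cauchy {p : ℝ} (hp : 2 < p) {h s : ℂ → ℂ} (hh : MemLpDisc p h) (hs : Continuous s)
    (hs1 : ∀ ξ, ‖s ξ‖ₑ = 1) {z : ℂ} (hz : z ∈ closedDisc) :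
    Integrable (fun x : ℂ × ℂ => s x.1 * (h x.2 / (conj x.1 - conj x.2)) / (z - x.1))
      (discMeasure.prod discMeasure) := by
  have hpq := Real.HolderConjugate.conjExponent (show 1 < p by linarith)
  have hm : AEStronglyMeasurable (fun x : ℂ × ℂ => s x.1 * (h x.2 / (conj x.1 - conj x.2)) / (z - x.1))
      (discMeasure.prod discMeasure) := by
    have h1 : AEStronglyMeasurable (fun x : ℂ × ℂ => h x.2) (discMeasure.prod discMeasure) := hh.1.comp_snd
    have h2 : Measurable fun x : ℂ × ℂ => (conj x.1 - conj x.2)⁻¹ := by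
      have : Measurable fun z : ℂ => conj z := Complex.continuous_conj.measurable
      exact ((this.comp measurable_fst).sub (this.comp measurable_snd)).inv
    have h3 : Measurable fun x : ℂ × ℂ => (z - x.1)⁻¹ := by fun_prop
    have h4 : Continuous fun x : ℂ × ℂ => s x.1 := hs.comp continuous_fst
    exact (h4.aestronglyMeasurable.mul (h1.mul h2.aestronglyMeasurable)).mul h3.aestronglyMeasurable
  refine ⟨hm, ?_⟩
  rw [hasFiniteIntegral_iff_enorm, lintegral_prod _ hm.enorm]
  have hone : MemLpDisc p fun _ => (1 : ℂ) := memLpDisc_of_continuousOn continuousOn_const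
  calc _ ≤ ∫⁻ ξ in disc, (lpNorm p h * ENNReal.ofReal (cauchySupConst (p.conjExponent))) * ‖1 / (z - ξ)‖ₑ := by
        refine setLIntegral_mono' measurableSet_disc fun ξ hξ => ?_
        have : ∀ η, ‖s ξ * (h η / (conj ξ - conj η)) / (z - ξ)‖ₑ = ‖h η / (ξ - η)‖ₑ * ‖1 / (z - ξ)‖ₑ := by
          intro η
          rw [div_eq_mul_one_div, enorm_mul, enorm_mul, hs1, one_mul, div_eq_mul_inv, div_eq_mul_inv (h η), enorm_mul,
            enorm_mul, ← map_sub, ← map_inv₀]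
          congr 2
          rw [← ofReal_norm, ← ofReal_norm, RCLike.norm_conj]
        simp only [this]
        rw [lintegral_mul_const'' _ ?_]
        · gcongr
          exact lintegral_mul_kernel_le hp hpq hh (disc_subset_closedDisc hξ)
        · exact (hh.integrable_div hp (disc_subset_closedDisc hξ)).1.enorm
    _ < ⊤ := by
        rw [lintegral_const_mul _ (by fun_prop)]
        exact ENNReal.mul_lt_top (ENNReal.mul_lt_top hh.2 ENNReal.ofReal_lt_top)
          ((lintegral_mul_kernel_le hp hpq hone hz).trans_lt (ENNReal.mul_lt_top hone.2 ENNReal.ofReal_lt_top))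

theorem cauchy_mul_cauchyBar_eq {p : ℝ} (hp : 2 < p) {h s : ℂ → ℂ} (hh : MemLpDisc p h) (hs : Continuous s)
    (hs1 : ∀ ξ, ‖s ξ‖ₑ = 1) {z : ℂ} (hz : z ∈ closedDisc) :
    cauchy (fun ξ => s ξ * cauchyBar h ξ) z = (1 / Real.pi : ℂ) ^ 2 *
      ∫ η in disc, h η * ∫ ξ in disc, s ξ * ((z - ξ)⁻¹ * (conj ξ - conj η)⁻¹) := by
  have hsw := integral_integral_swap (μ := discMeasure) (ν := discMeasure)
    (f := fun ξ η => s ξ * (h η / (conj ξ - conj η)) / (z - ξ)) (integrable_double_cauchy hp hh hs hs1 hz)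
  have e1 : ∀ ξ, (∫ η in disc, s ξ * (h η / (conj ξ - conj η)) / (z - ξ)) =
      s ξ * (∫ η in disc, h η / (conj ξ - conj η)) / (z - ξ) := fun ξ => by
    rw [integral_div, integral_const_mul]
  have e2 : ∀ η, (∫ ξ in disc, s ξ * (h η / (conj ξ - conj η)) / (z - ξ)) =
      h η * ∫ ξ in disc, s ξ * ((z - ξ)⁻¹ * (conj ξ - conj η)⁻¹) := fun η => by
    rw [← integral_const_mul]
    congr 1
    funext ξ
    simp only [div_eq_mul_inv]
    ring
  simp only [discMeasure, e1, e2] at hsw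
  rw [← hsw, cauchy, pow_two, mul_assoc]
  congr 1
  rw [← integral_const_mul]
  congr 1
  funext ξ
  rw [cauchyBar]
  ring

/-- After Fubini, Hölder's inequality pairs `h` with `|Im z - Im η|^(-2/5)`, which is in `L^q` as
`2q/5 < 4/5`. The prefactor is `1/(4π²) ≤ 1/36`, and `376·40/36 ≤ 420`. The bound is independent of
`z₀`. -/
theorem enorm_cauchy_osc_mul_cauchyBar_le {p : ℝ} (hp : 2 < p) {n : ℝ} (hn : n ≠ 0) (z₀ : ℂ) {h : ℂ → ℂ} (hh : MemLpDisc p h)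
    {z : ℂ} (hz : z ∈ closedDisc) :
    ‖-(1 / 4) * cauchy (fun ξ => osc n z₀ ξ * cauchyBar h ξ) z‖ₑ ≤
      ENNReal.ofReal (420 * |n| ^ (-(1 / 5) : ℝ)) * lpNorm p h := by
  have hpq := Real.HolderConjugate.conjExponent (show 1 < p by linarith)
  set q := p.conjExponent
  have hq2 := holderConjugate_lt_two hp hpq
  have hq1 : 1 < q := hpq.symm.lt
  rw [cauchy_mul_cauchyBar_eq hp hh (contDiff_osc n z₀).continuous (enorm_osc n z₀) hz, ← mul_assoc, enorm_mul]
  have hK : (∫⁻ η in disc, ENNReal.ofReal (|z.im - η.im| ^ (-(2 / 5) : ℝ)) ^ q) ^ (1 / q) ≤ 40 := by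
    have e : ∀ η : ℂ, ENNReal.ofReal (|z.im - η.im| ^ (-(2 / 5) : ℝ)) ^ q =
        ENNReal.ofReal (|z.im - η.im| ^ (-(2 / 5 * q) : ℝ)) := fun η => by
      rw [ENNReal.ofReal_rpow_of_nonneg (by positivity) (by positivity), ← Real.rpow_mul (abs_nonneg _)]
      ring_nf
    simp only [e]
    have hzi : |z.im| ≤ 1 := (Complex.abs_im_le_norm z).trans (by simpa [closedDisc] using hz)
    calc _ ≤ (40 : ℝ≥0∞) ^ (1 / q) := by
          gcongr
          exact lintegral_disc_im_rpow_le hzi (by positivity) (by linarith)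
      _ ≤ (40 : ℝ≥0∞) ^ (1 : ℝ) := by
          apply ENNReal.rpow_le_rpow_of_exponent_le (by norm_num)
          rw [div_le_one (by linarith)]; linarith
      _ = 40 := ENNReal.rpow_one 40
  have hint : ‖∫ η in disc, h η * ∫ ξ in disc, osc n z₀ ξ * ((z - ξ)⁻¹ * (conj ξ - conj η)⁻¹)‖ₑ ≤
      ENNReal.ofReal (376 * |n| ^ (-(1 / 5) : ℝ)) * (lpNorm p h * 40) := by
    have hline : ∀ᵐ η ∂(volume : Measure ℂ), z.im ≠ η.im := by
      have := Complex.volume_preserving_equiv_real_prod.quasiMeasurePreserving.ae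
        ((Measure.quasiMeasurePreserving_snd (μ := (volume : Measure ℝ)) (ν := (volume : Measure ℝ))).ae
          (Measure.ae_ne volume z.im))
      filter_upwards [this] with η hη using fun h => hη h.symm
    calc _ ≤ ∫⁻ η in disc, ‖h η * ∫ ξ in disc, osc n z₀ ξ * ((z - ξ)⁻¹ * (conj ξ - conj η)⁻¹)‖ₑ :=
          enorm_integral_le_lintegral_enorm _
      _ ≤ ∫⁻ η in disc, ENNReal.ofReal (376 * |n| ^ (-(1 / 5) : ℝ)) *
          (‖h η‖ₑ * ENNReal.ofReal (|z.im - η.im| ^ (-(2 / 5) : ℝ))) := by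
          apply lintegral_mono_ae
          filter_upwards [ae_restrict_of_ae hline] with η hη
          rw [enorm_mul, mul_left_comm]
          gcongr
          exact enorm_oscillatory_kernel_le hn z₀ hη
      _ = ENNReal.ofReal (376 * |n| ^ (-(1 / 5) : ℝ)) * ∫⁻ η in disc, ‖h η‖ₑ * ENNReal.ofReal (|z.im - η.im| ^ (-(2 / 5) : ℝ)) :=
          lintegral_const_mul' _ _ ENNReal.ofReal_ne_top
      _ ≤ _ := by
          gcongr
          refine (lintegral_mul_le_lpNorm_mul hpq hh ?_).trans (by gcongr)
          have : Measurable fun η : ℂ => η.im := Complex.measurable_im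
          fun_prop
  have hc : ‖(-(1 / 4) * (1 / Real.pi : ℂ) ^ 2 : ℂ)‖ₑ ≤ ENNReal.ofReal (1 / 36) := by
    rw [← ofReal_norm]
    apply ENNReal.ofReal_le_ofReal
    rw [norm_mul, norm_pow, norm_div, norm_neg, norm_one, Complex.norm_real, Real.norm_of_nonneg Real.pi_pos.le]
    norm_num
    have : (9 : ℝ) ≤ Real.pi ^ 2 := by nlinarith [Real.pi_gt_three]
    have : (Real.pi ^ 2)⁻¹ ≤ 9⁻¹ := inv_anti₀ (by norm_num) this
    linarith
  calc _ ≤ ENNReal.ofReal (1 / 36) * (ENNReal.ofReal (376 * |n| ^ (-(1 / 5) : ℝ)) * (lpNorm p h * 40)) := by gcongr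
    _ = ENNReal.ofReal (1 / 36 * (376 * |n| ^ (-(1 / 5) : ℝ)) * 40) * lpNorm p h := by
        have : 0 ≤ 376 * |n| ^ (-(1 / 5) : ℝ) := mul_nonneg (by norm_num) (Real.rpow_nonneg (abs_nonneg n) _)
        generalize 376 * |n| ^ (-(1 / 5) : ℝ) = t at this
        rw [ENNReal.ofReal_mul (mul_nonneg (by norm_num) this), ENNReal.ofReal_mul (by norm_num),
          show ENNReal.ofReal 40 = 40 by simp]
        ring
    _ ≤ _ := by
        gcongr ?_ * _
        apply ENNReal.ofReal_le_ofReal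
        have : 0 ≤ |n| ^ (-(1 / 5) : ℝ) := Real.rpow_nonneg (abs_nonneg n) _
        linarith

end BukhgeimDisc


namespace BukhgeimDisc

/-! ### Suprema over the closed disc and Hölder norms -/

/-- The supremum of `‖f‖` over the closed disc. -/
noncomputable def supDisc (f : ℂ → ℂ) : ℝ≥0∞ := ⨆ z ∈ closedDisc, ‖f z‖ₑ

theorem enorm_le_supDisc (f : ℂ → ℂ) {z : ℂ} (hz : z ∈ closedDisc) : ‖f z‖ₑ ≤ supDisc f :=
  le_iSup₂ (f := fun z (_ : z ∈ closedDisc) => ‖f z‖ₑ) z hz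

theorem supDisc_le {f : ℂ → ℂ} {M : ℝ≥0∞} (h : ∀ z ∈ closedDisc, ‖f z‖ₑ ≤ M) : supDisc f ≤ M := iSup₂_le h

theorem supDisc_le_holderNorm (α : ℝ) (f : ℂ → ℂ) : supDisc f ≤ holderNorm α f := le_self_add

theorem supDisc_lt_top {f : ℂ → ℂ} (hf : ContinuousOn f closedDisc) : supDisc f < ⊤ := by
  obtain ⟨C, hC⟩ := isCompact_closedDisc.exists_bound_of_continuousOn hf
  refine (supDisc_le fun z hz => ?_).trans_lt (ENNReal.ofReal_lt_top (r := C))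
  rw [← ofReal_norm]
  exact ENNReal.ofReal_le_ofReal (hC z hz)

theorem holderNorm_congr {α : ℝ} {f g : ℂ → ℂ} (h : EqOn f g closedDisc) : holderNorm α f = holderNorm α g := by
  unfold holderNorm
  rw [Set.domRestrict_eq_domRestrict_iff.2 h]
  congr 1
  exact iSup_congr fun z => iSup_congr fun hz => by rw [h hz]

theorem holderNorm_add_le (α : ℝ) (f g : ℂ → ℂ) : holderNorm α (f + g) ≤ holderNorm α f + holderNorm α g := by
  unfold holderNorm
  rw [add_add_add_comm]
  gcongr
  · exact supDisc_le fun z hz => (enorm_add_le _ _).trans (add_le_add (enorm_le_supDisc f hz) (enorm_le_supDisc g hz))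
  · exact eHolderNorm_add_le

theorem holderNorm_one_lt_top (α : ℝ) : holderNorm α (fun _ => 1) < ⊤ := by
  refine ENNReal.add_lt_top.2 ⟨supDisc_lt_top continuousOn_const, ?_⟩
  have : closedDisc.domRestrict (fun _ : ℂ => (1 : ℂ)) = Function.const _ 1 := rfl
  rw [this, eHolderNorm_const]
  exact ENNReal.zero_lt_top

theorem lpNorm_mul_le {p : ℝ} {f q : ℂ → ℂ} (hq : MemLpDisc p q) :
    lpNorm p (fun z => f z * q z) ≤ supDisc f * lpNorm p q := by
  refine eLpNorm_le_mul_eLpNorm_of_ae_le_mul'' _ hq.1 ?_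
  filter_upwards [ae_restrict_mem measurableSet_disc] with z hz
  rw [enorm_mul]
  gcongr
  exact enorm_le_supDisc f (disc_subset_closedDisc hz)

theorem supDisc_mul_le (f g : ℂ → ℂ) : supDisc (fun z => f z * g z) ≤ supDisc f * supDisc g :=
  supDisc_le fun z hz => by
    rw [enorm_mul]
    exact mul_le_mul' (enorm_le_supDisc f hz) (enorm_le_supDisc g hz)

/-! ### The composition of the two Cauchy operators -/

/-- The function `-(1/4) C(s Cbar h)`. -/
noncomputable def doubleCauchy (s h : ℂ → ℂ) : ℂ → ℂ := cauchy fun ξ => -(1 / 4) * (s ξ * cauchyBar h ξ)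

theorem doubleCauchy_apply (s h : ℂ → ℂ) (z : ℂ) :
    doubleCauchy s h z = -(1 / 4) * cauchy (fun ξ => s ξ * cauchyBar h ξ) z := by
  rw [doubleCauchy, cauchy, cauchy, mul_left_comm, ← integral_const_mul (-(1 / 4) : ℂ)]
  simp only [mul_div_assoc]

theorem opS_eq (q : ℂ → ℂ) (n : ℝ) (z₀ : ℂ) (f : ℂ → ℂ) :
    opS q n z₀ f = doubleCauchy (osc (-n) z₀) fun η => osc n z₀ η * q η * f η := by
  funext z
  rw [doubleCauchy_apply, opS]

theorem cauchy_sub {p : ℝ} (hp : 2 < p) {f g : ℂ → ℂ} (hf : MemLpDisc p f) (hg : MemLpDisc p g) {z : ℂ}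
    (hz : z ∈ closedDisc) : cauchy (fun ξ => f ξ - g ξ) z = cauchy f z - cauchy g z := by
  unfold cauchy
  rw [← mul_sub, ← integral_sub (μ := volume.restrict disc) (hf.integrable_div hp hz) (hg.integrable_div hp hz)]
  simp only [sub_div]

theorem cauchyBar_sub {p : ℝ} (hp : 2 < p) {f g : ℂ → ℂ} (hf : MemLpDisc p f) (hg : MemLpDisc p g) {z : ℂ}
    (hz : z ∈ closedDisc) : cauchyBar (fun ξ => f ξ - g ξ) z = cauchyBar f z - cauchyBar g z := by
  simp only [cauchyBar_eq, map_sub]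
  rw [cauchy_sub hp hf.conj hg.conj hz, map_sub]

theorem cauchy_congr {f g : ℂ → ℂ} (h : EqOn f g disc) : cauchy f = cauchy g := by
  funext z
  unfold cauchy
  congr 1
  exact setIntegral_congr_fun measurableSet_disc fun ξ hξ => by simp only [h hξ]

theorem memLpDisc_mul_cauchyBar {p : ℝ} (hp : 2 < p) {s h : ℂ → ℂ} (hs : Continuous s) (hh : MemLpDisc p h) :
    MemLpDisc p fun ξ => -(1 / 4) * (s ξ * cauchyBar h ξ) :=
  memLpDisc_of_continuousOn (continuousOn_const.mul (hs.continuousOn.mul (continuousOn_cauchyBar hp hh)))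

theorem doubleCauchy_sub {p : ℝ} (hp : 2 < p) {s s' h h' : ℂ → ℂ} (hs : Continuous s) (hs' : Continuous s')
    (hh : MemLpDisc p h) (hh' : MemLpDisc p h') {z : ℂ} (hz : z ∈ closedDisc) :
    doubleCauchy s h z - doubleCauchy s' h' z =
      doubleCauchy s (fun η => h η - h' η) z + doubleCauchy (fun ξ => s ξ - s' ξ) h' z := by
  have key : doubleCauchy (fun ξ => s ξ - s' ξ) h' z = doubleCauchy s h' z - doubleCauchy s' h' z := by
    unfold doubleCauchy
    rw [← cauchy_sub hp (memLpDisc_mul_cauchyBar hp hs hh') (memLpDisc_mul_cauchyBar hp hs' hh') hz]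
    congr 1
    funext ξ
    ring
  have key' : doubleCauchy s (fun η => h η - h' η) z = doubleCauchy s h z - doubleCauchy s h' z := by
    unfold doubleCauchy
    rw [← cauchy_sub hp (memLpDisc_mul_cauchyBar hp hs hh) (memLpDisc_mul_cauchyBar hp hs hh') hz]
    refine congrFun (cauchy_congr fun ξ hξ => ?_) z
    rw [cauchyBar_sub hp hh hh' (disc_subset_closedDisc hξ)]
    ring
  rw [key, key']
  ring

/-- Smoothing without decay in `n`: it upgrades sup norm information to the Hölder norm, where no
contraction is claimed. -/
theorem exists_holderNorm_doubleCauchy_le {p : ℝ} (hp : 2 < p) :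
    ∃ K : ℝ≥0, ∀ s h : ℂ → ℂ, Continuous s → MemLpDisc p h →
      holderNorm (1 - 2 / p) (doubleCauchy s h) ≤ K * (supDisc s * lpNorm p h) := by
  obtain ⟨C, hC⟩ := exists_isCauchyBound hp
  have hone : MemLpDisc p fun _ => (1 : ℂ) := memLpDisc_of_continuousOn continuousOn_const
  obtain ⟨L, hL, -⟩ := ENNReal.lt_iff_exists_coe.1 (show lpNorm p (fun _ => 1) < ⊤ from hone.2)
  refine ⟨C * C * L, fun s h hs hh => ?_⟩
  have h1 := (hC _ (memLpDisc_mul_cauchyBar hp hs hh)).1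
  refine h1.trans ?_
  have h2 : lpNorm p (fun ξ => -(1 / 4) * (s ξ * cauchyBar h ξ)) ≤
      supDisc (fun ξ => -(1 / 4) * (s ξ * cauchyBar h ξ)) * lpNorm p (fun _ => 1) := by
    simpa using lpNorm_mul_le (f := fun ξ => -(1 / 4) * (s ξ * cauchyBar h ξ)) hone
  have h3 : supDisc (fun ξ => -(1 / 4) * (s ξ * cauchyBar h ξ)) ≤ supDisc s * (C * lpNorm p h) := by
    refine (supDisc_mul_le _ _).trans ?_
    have : supDisc (fun _ => (-(1 / 4) : ℂ)) ≤ 1 := by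
      refine supDisc_le fun z _ => ?_
      rw [← ofReal_norm, ← ENNReal.ofReal_one]
      apply ENNReal.ofReal_le_ofReal
      norm_num
    calc _ ≤ 1 * (supDisc s * supDisc (cauchyBar h)) := by gcongr; exact supDisc_mul_le _ _
      _ ≤ _ := by
        rw [one_mul]
        gcongr
        exact (supDisc_le_holderNorm _ _).trans (hC h hh).2
  calc _ ≤ (C : ℝ≥0∞) * ((supDisc s * (C * lpNorm p h)) * lpNorm p (fun _ => 1)) := by
        gcongr
        exact h2.trans (by gcongr)
    _ = _ := by
        rw [hL]
        push_cast
        ring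

/-! ### The contraction -/

theorem supDisc_osc_le (n : ℝ) (z₀ : ℂ) : supDisc (osc n z₀) ≤ 1 :=
  supDisc_le fun z _ => (enorm_osc n z₀ z).le

theorem continuous_osc (n : ℝ) (z₀ : ℂ) : Continuous (osc n z₀) := (contDiff_osc n z₀).continuous

theorem memLpDisc_osc_mul {p : ℝ} {q f : ℂ → ℂ} (hq : MemLpDisc p q) (n : ℝ) (z₀ : ℂ) (hf : ContinuousOn f closedDisc) :
    MemLpDisc p fun η => osc n z₀ η * q η * f η := by
  have := hq.continuousOn_mul ((continuous_osc n z₀).continuousOn.mul hf)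
  simpa only [mul_right_comm, Pi.mul_apply] using this

theorem lpNorm_mul_mul_le {p : ℝ} {s q f : ℂ → ℂ} (hq : MemLpDisc p q) :
    lpNorm p (fun η => s η * q η * f η) ≤ supDisc s * supDisc f * lpNorm p q := by
  have := lpNorm_mul_le (f := fun η => s η * f η) hq
  simp only [mul_right_comm (s _) (q _)]
  exact this.trans (by gcongr; exact supDisc_mul_le _ _)

theorem opS_sub {p : ℝ} (hp : 2 < p) {q f g : ℂ → ℂ} (hq : MemLpDisc p q) (n : ℝ) (z₀ : ℂ)
    (hf : ContinuousOn f closedDisc) (hg : ContinuousOn g closedDisc) {z : ℂ} (hz : z ∈ closedDisc) :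
    opS q n z₀ f z - opS q n z₀ g z = opS q n z₀ (f - g) z := by
  simp only [opS_eq]
  rw [doubleCauchy_sub hp (continuous_osc (-n) z₀) (continuous_osc (-n) z₀) (memLpDisc_osc_mul hq n z₀ hf)
    (memLpDisc_osc_mul hq n z₀ hg) hz]
  simp only [← mul_sub, sub_self, Pi.sub_apply, add_eq_left]
  simp [doubleCauchy, cauchy]

theorem memHolderDisc_one_add_opS {p : ℝ} (hp : 2 < p) {q f : ℂ → ℂ} (hq : MemLpDisc p q) (n : ℝ) (z₀ : ℂ)
    (hf : ContinuousOn f closedDisc) : MemHolderDisc (1 - 2 / p) fun z => 1 + opS q n z₀ f z := by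
  refine (holderNorm_add_le _ (fun _ => 1) (opS q n z₀ f)).trans_lt (ENNReal.add_lt_top.2 ⟨holderNorm_one_lt_top _, ?_⟩)
  rw [opS_eq]
  exact memHolderDisc_cauchy hp (memLpDisc_mul_cauchyBar hp (continuous_osc (-n) z₀) (memLpDisc_osc_mul hq n z₀ hf))

/-- The bound for the operators `S` in the space of continuous functions. -/
noncomputable def contractionConst (p n : ℝ) (q : ℂ → ℂ) : ℝ≥0∞ :=
  ENNReal.ofReal (420 * |n| ^ (-(1 / 5) : ℝ)) * lpNorm p q

theorem supDisc_opS_le {p : ℝ} (hp : 2 < p) {q f : ℂ → ℂ} (hq : MemLpDisc p q) {n : ℝ} (hn : n ≠ 0) (z₀ : ℂ)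
    (hf : ContinuousOn f closedDisc) : supDisc (opS q n z₀ f) ≤ contractionConst p n q * supDisc f := by
  refine supDisc_le fun z hz => ?_
  have := enorm_cauchy_osc_mul_cauchyBar_le hp (neg_ne_zero.2 hn) z₀ (memLpDisc_osc_mul hq n z₀ hf) hz
  rw [abs_neg] at this
  refine this.trans ?_
  rw [contractionConst, mul_assoc]
  gcongr
  refine (lpNorm_mul_mul_le hq).trans ?_
  rw [mul_comm (lpNorm p q)]
  gcongr
  calc _ ≤ 1 * supDisc f := by gcongr; exact supDisc_osc_le n z₀
    _ = _ := one_mul _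

/-- Absorption of the contracted term; finiteness of `x` is what permits the subtraction. -/
theorem le_mul_inv_of_le_mul_add {x κ b : ℝ≥0∞} (hx : x ≠ ⊤) (hκ : κ < 1) (h : x ≤ κ * x + b) :
    x ≤ b * (1 - κ)⁻¹ := by
  have h1 : 1 - κ ≠ 0 := (tsub_pos_of_lt hκ).ne'
  have h2 : 1 - κ ≠ ⊤ := ne_top_of_le_ne_top ENNReal.one_ne_top tsub_le_self
  rw [← div_eq_mul_inv, ENNReal.le_div_iff_mul_le (Or.inl h1) (Or.inl h2)]
  have h3 : κ * x ≠ ⊤ := ENNReal.mul_ne_top hκ.ne_top hx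
  rw [mul_comm, ENNReal.sub_mul fun _ _ => hx, one_mul, tsub_le_iff_left]
  exact h

theorem IsHolderSolution.eqOn {p : ℝ} (hp : 2 < p) {q f g : ℂ → ℂ} (hq : MemLpDisc p q) {n : ℝ} (hn : n ≠ 0) {z₀ : ℂ}
    (hκ : contractionConst p n q < 1) (hf : IsHolderSolution (1 - 2 / p) (opS q n z₀) f)
    (hg : IsHolderSolution (1 - 2 / p) (opS q n z₀) g) : EqOn f g closedDisc := by
  have hfc := hf.1.continuousOn (one_sub_two_div_pos hp)
  have hgc := hg.1.continuousOn (one_sub_two_div_pos hp)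
  have h : supDisc (f - g) ≤ contractionConst p n q * supDisc (f - g) + 0 := by
    rw [add_zero]
    refine le_trans (supDisc_le fun z hz => ?_) (supDisc_opS_le hp hq hn z₀ (hfc.sub hgc))
    rw [Pi.sub_apply, hf.2 z hz, hg.2 z hz, add_sub_add_left_eq_sub, opS_sub hp hq n z₀ hfc hgc hz]
    exact enorm_le_supDisc _ hz
  have h0 := le_mul_inv_of_le_mul_add (supDisc_lt_top (hfc.sub hgc)).ne hκ h
  rw [zero_mul] at h0
  intro z hz
  have := (enorm_le_supDisc (f - g) hz).trans h0
  rw [nonpos_iff_eq_zero, enorm_eq_zero] at this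
  exact sub_eq_zero.1 this

theorem continuousOn_extend (u : C(closedDisc, ℂ)) :
    ContinuousOn (Function.extend Subtype.val u 0) closedDisc := by
  rw [continuousOn_iff_continuous_domRestrict]
  have : closedDisc.domRestrict (Function.extend Subtype.val u 0) = u := by
    funext z
    exact Subtype.val_injective.extend_apply u 0 z
  rw [this]
  exact u.continuous

/-- The fixed point is found in the continuous functions, where the operator contracts; being `1`
plus a Cauchy transform of an `L^p` function, it is then Hölder continuous. -/
theorem exists_isHolderSolution {p : ℝ} (hp : 2 < p) {q : ℂ → ℂ} (hq : MemLpDisc p q) {n : ℝ} (hn : n ≠ 0) (z₀ : ℂ)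
    (hκ : contractionConst p n q < 1) : ∃ f, IsHolderSolution (1 - 2 / p) (opS q n z₀) f := by
  have : CompactSpace closedDisc := isCompact_iff_compactSpace.1 isCompact_closedDisc
  -- The values of the extension off the closed disc do not matter, since the operators integrate
  -- over the disc only.
  let E : C(closedDisc, ℂ) → ℂ → ℂ := fun u => Function.extend Subtype.val u 0
  have hE : ∀ u, ContinuousOn (E u) closedDisc := continuousOn_extend
  have hEv : ∀ u (z : closedDisc), E u z = u z := fun u z => Subtype.val_injective.extend_apply u 0 z
  have hα := one_sub_two_div_pos hp
  let Φ : C(closedDisc, ℂ) → C(closedDisc, ℂ) := fun u =>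
    ⟨closedDisc.domRestrict fun z => 1 + opS q n z₀ (E u) z,
      continuousOn_iff_continuous_domRestrict.1 ((memHolderDisc_one_add_opS hp hq n z₀ (hE u)).continuousOn hα)⟩
  obtain ⟨κ, hκ', -⟩ := ENNReal.lt_iff_exists_coe.1 (hκ.trans ENNReal.one_lt_top)
  have hΦ : ContractingWith κ Φ := by
    refine ⟨by rw [hκ'] at hκ; exact_mod_cast hκ, fun u v => ?_⟩
    rw [ContinuousMap.edist_eq_iSup, ContinuousMap.edist_eq_iSup]
    refine iSup_le fun z => ?_
    have e : edist (Φ u z) (Φ v z) = ‖opS q n z₀ (E u - E v) z‖ₑ := by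
      rw [edist_eq_enorm_sub]
      change ‖(1 + opS q n z₀ (E u) z) - (1 + opS q n z₀ (E v) z)‖ₑ = _
      rw [add_sub_add_left_eq_sub, opS_sub hp hq n z₀ (hE u) (hE v) z.2]
    rw [e]
    refine (enorm_le_supDisc _ z.2).trans ((supDisc_opS_le hp hq hn z₀ ((hE u).sub (hE v))).trans ?_)
    rw [hκ']
    gcongr
    refine supDisc_le fun w hw => ?_
    have := le_iSup (fun x => edist (u x) (v x)) ⟨w, hw⟩
    rwa [edist_eq_enorm_sub, ← hEv, ← hEv] at this
  set u := hΦ.fixedPoint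
  have hu : Φ u = u := hΦ.fixedPoint_isFixedPt
  have hs : EqOn (E u) (fun z => 1 + opS q n z₀ (E u) z) closedDisc := fun z hz => by
    have := congrArg (fun v : C(closedDisc, ℂ) => v ⟨z, hz⟩) hu
    exact (hEv u ⟨z, hz⟩).trans this.symm
  refine ⟨E u, ?_, hs⟩
  rw [MemHolderDisc, holderNorm_congr hs]
  exact memHolderDisc_one_add_opS hp hq n z₀ (hE u)

/-! ### Continuous dependence on the centre of the phase -/

theorem tendsto_supDisc_osc_sub (n : ℝ) (z₀ : ℂ) :
    Tendsto (fun z => supDisc fun w => osc n z w - osc n z₀ w) (𝓝 z₀) (𝓝 0) := by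
  rw [ENNReal.tendsto_nhds_zero]
  intro ε hε
  have := isCompact_closedDisc.eventually_forall_of_forall_eventually (x₀ := z₀)
    (P := fun z w => ‖osc n z w - osc n z₀ w‖ₑ < ε) fun w _ => by
      have hc : Continuous fun x : ℂ × ℂ => ‖osc n x.1 x.2 - osc n z₀ x.2‖ₑ :=
        ((continuous_osc_prod n).sub ((continuous_osc n z₀).comp continuous_snd)).enorm
      exact hc.continuousAt.eventually_lt continuousAt_const (by simpa using hε)
  filter_upwards [this] with z hz using supDisc_le fun w hw => (hz w hw).le

theorem supDisc_osc_neg_sub (n : ℝ) (z z₀ : ℂ) :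
    supDisc (fun w => osc (-n) z w - osc (-n) z₀ w) = supDisc fun w => osc n z w - osc n z₀ w := by
  unfold supDisc
  refine iSup_congr fun w => iSup_congr fun _ => ?_
  beta_reduce
  rw [← conj_osc, ← conj_osc, ← map_sub, ← ofReal_norm, ← ofReal_norm, RCLike.norm_conj]

/-- The difference `d = F z - F z₀` solves `d = S_z d + (S_z - S_{z₀}) F z₀`. The last term is
`O(δ)` in Hölder norm, `δ` being the sup distance of the oscillating factors, which tends to `0` by
compactness. Contraction then gives the sup norm of `d`, and the smoothing of `S_z` its Hölder norm.
-/
theorem tendsto_holderNorm_sub {p : ℝ} (hp : 2 < p) {q : ℂ → ℂ} (hq : MemLpDisc p q) {n : ℝ} (hn : n ≠ 0)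
    (hκ : contractionConst p n q < 1) {F : ℂ → ℂ → ℂ} (hF : ∀ z, IsHolderSolution (1 - 2 / p) (opS q n z) (F z)) (z₀ : ℂ) :
    Tendsto (fun z => holderNorm (1 - 2 / p) (F z - F z₀)) (𝓝 z₀) (𝓝 0) := by
  obtain ⟨K, hK⟩ := exists_holderNorm_doubleCauchy_le hp
  have hc : ∀ z, ContinuousOn (F z) closedDisc := fun z => (hF z).1.continuousOn (one_sub_two_div_pos hp)
  set δ := fun z => supDisc fun w => osc n z w - osc n z₀ w with hδ
  set κ := contractionConst p n q
  set A := K * (supDisc (F z₀) * lpNorm p q) * 2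
  set B := K * lpNorm p q * (1 - κ)⁻¹ + 1
  have hA : A ≠ ⊤ := ENNReal.mul_ne_top (ENNReal.mul_ne_top ENNReal.coe_ne_top
    (ENNReal.mul_ne_top (supDisc_lt_top (hc z₀)).ne hq.2.ne)) (by norm_num)
  have hB : B ≠ ⊤ := ENNReal.add_ne_top.2 ⟨ENNReal.mul_ne_top (ENNReal.mul_ne_top ENNReal.coe_ne_top hq.2.ne)
    (ENNReal.inv_ne_top.2 (tsub_pos_of_lt hκ).ne'), ENNReal.one_ne_top⟩
  have key : ∀ z, holderNorm (1 - 2 / p) (F z - F z₀) ≤ B * A * δ z := by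
    intro z
    -- The two oscillating factors of the operator are changed one at a time: the inner one in `E₁`,
    -- the outer one in `E₂`.
    set E₁ := doubleCauchy (osc (-n) z) fun η => (osc n z η - osc n z₀ η) * q η * F z₀ η
    set E₂ := doubleCauchy (fun ξ => osc (-n) z ξ - osc (-n) z₀ ξ) fun η => osc n z₀ η * q η * F z₀ η
    have hm₁ : MemLpDisc p fun η => (osc n z η - osc n z₀ η) * q η * F z₀ η := by
      have := hq.continuousOn_mul (((continuous_osc n z).sub (continuous_osc n z₀)).continuousOn.mul (hc z₀))
      simpa only [mul_right_comm, Pi.sub_apply, Pi.mul_apply] using this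
    have hm₂ := memLpDisc_osc_mul hq n z₀ (hc z₀)
    have hE : holderNorm (1 - 2 / p) (E₁ + E₂) ≤ A * δ z := by
      have h1 : holderNorm (1 - 2 / p) E₁ ≤ K * (1 * (δ z * supDisc (F z₀) * lpNorm p q)) := by
        refine (hK _ _ (continuous_osc (-n) z) hm₁).trans ?_
        gcongr
        · exact supDisc_osc_le (-n) z
        · exact lpNorm_mul_mul_le hq
      have h2 : holderNorm (1 - 2 / p) E₂ ≤ K * (δ z * (1 * supDisc (F z₀) * lpNorm p q)) := by
        refine (hK _ _ ((continuous_osc (-n) z).sub (continuous_osc (-n) z₀)) hm₂).trans ?_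
        gcongr
        · exact (supDisc_osc_neg_sub n z z₀).le
        · refine (lpNorm_mul_mul_le hq).trans ?_
          gcongr
          exact supDisc_osc_le n z₀
      refine (holderNorm_add_le _ _ _).trans ((add_le_add h1 h2).trans_eq ?_)
      simp only [A]
      ring
    have heq : EqOn (F z - F z₀) (opS q n z (F z - F z₀) + (E₁ + E₂)) closedDisc := by
      intro w hw
      have hs := doubleCauchy_sub hp (continuous_osc (-n) z) (continuous_osc (-n) z₀) (memLpDisc_osc_mul hq n z (hc z₀))
        hm₂ hw
      simp only [← sub_mul] at hs
      rw [Pi.sub_apply, Pi.add_apply, Pi.add_apply, (hF z).2 w hw, (hF z₀).2 w hw, ← opS_sub hp hq n z (hc z) (hc z₀) hw,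
        ← hs, opS_eq q n z (F z₀), opS_eq q n z₀]
      ring
    have hsup : supDisc (F z - F z₀) ≤ A * δ z * (1 - κ)⁻¹ := by
      refine le_mul_inv_of_le_mul_add (supDisc_lt_top ((hc z).sub (hc z₀))).ne hκ ?_
      refine supDisc_le fun w hw => ?_
      rw [heq hw]
      refine (enorm_add_le _ _).trans (add_le_add ?_ ?_)
      · exact (enorm_le_supDisc _ hw).trans (supDisc_opS_le hp hq hn z ((hc z).sub (hc z₀)))
      · exact (enorm_le_holderNorm hw).trans hE
    rw [holderNorm_congr heq]
    refine (holderNorm_add_le _ _ _).trans ?_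
    have h3 : holderNorm (1 - 2 / p) (opS q n z (F z - F z₀)) ≤ K * (1 * (1 * supDisc (F z - F z₀) * lpNorm p q)) := by
      rw [opS_eq]
      refine (hK _ _ (continuous_osc (-n) z) (memLpDisc_osc_mul hq n z ((hc z).sub (hc z₀)))).trans ?_
      gcongr
      · exact supDisc_osc_le (-n) z
      · refine (lpNorm_mul_mul_le hq).trans ?_
        gcongr
        exact supDisc_osc_le n z
    calc _ ≤ K * (1 * (1 * (A * δ z * (1 - κ)⁻¹) * lpNorm p q)) + A * δ z := by
          gcongr
          exact h3.trans (by gcongr)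
      _ = _ := by
          simp only [B]
          ring
  refine tendsto_of_tendsto_of_tendsto_of_le_of_le tendsto_const_nhds ?_ (fun _ => zero_le) key
  have := ENNReal.Tendsto.const_mul (tendsto_supDisc_osc_sub n z₀) (Or.inr (ENNReal.mul_ne_top hB hA))
  rwa [mul_zero] at this

theorem exists_solutions {p : ℝ} (hp : 2 < p) {q : ℂ → ℂ} (hq : MemLpDisc p q) {n : ℝ} (hn : n ≠ 0)
    (hκ : contractionConst p n q < 1) :
    ∃ F : ℂ → ℂ → ℂ, (∀ z₀, IsHolderSolution (1 - 2 / p) (opS q n z₀) (F z₀) ∧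
      (∀ f, IsHolderSolution (1 - 2 / p) (opS q n z₀) f → EqOn f (F z₀) closedDisc) ∧ MemSobolevDisc 2 p (F z₀)) ∧
      ∀ z₀, Tendsto (fun z => holderNorm (1 - 2 / p) (F z - F z₀)) (𝓝 z₀) (𝓝 0) := by
  choose F hF using fun z₀ => exists_isHolderSolution hp hq hn z₀ hκ
  refine ⟨F, fun z₀ => ⟨hF z₀, fun f hf => hf.eqOn hp hq hn hκ (hF z₀), ?_⟩, tendsto_holderNorm_sub hp hq hn hκ hF⟩
  exact memSobolevDisc_two_of_eqOn hp (contDiff_osc (-n) z₀)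
    (memLpDisc_osc_mul hq n z₀ ((hF z₀).1.continuousOn (one_sub_two_div_pos hp)))
    fun z hz => (hF z₀).2 z (disc_subset_closedDisc hz)

end BukhgeimDisc


namespace BukhgeimDisc

/-! ### Reduction of the conjugate equation -/

theorem conj_cauchy (f : ℂ → ℂ) (z : ℂ) : conj (cauchy f z) = cauchyBar (fun ξ => conj (f ξ)) z := by
  rw [cauchy_eq, Complex.conj_conj]

/-- Conjugation swaps the Cauchy operators and, the phase being real, reverses the sign of `n`; for
this reason the bounds for `opS` are stated with `|n|`. -/
theorem conj_opSBar (q : ℂ → ℂ) (n : ℝ) (z₀ : ℂ) (g : ℂ → ℂ) (z : ℂ) :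
    conj (opSBar q n z₀ g z) = opS (fun ξ => conj (q ξ)) (-n) z₀ (fun ξ => conj (g ξ)) z := by
  unfold opSBar opS
  rw [map_mul, cauchyBar_eq, Complex.conj_conj]
  simp only [map_mul, conj_osc, conj_cauchy, neg_neg, map_neg, map_div₀, map_one, map_ofNat]

theorem isHolderSolution_opSBar_iff {α n : ℝ} {q g : ℂ → ℂ} {z₀ : ℂ} :
    IsHolderSolution α (opSBar q n z₀) g ↔
      IsHolderSolution α (opS (fun ξ => conj (q ξ)) (-n) z₀) fun ξ => conj (g ξ) := by
  unfold IsHolderSolution MemHolderDisc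
  rw [holderNorm_conj]
  refine and_congr_right fun _ => forall₂_congr fun z _ => ?_
  rw [← conj_opSBar, ← (starRingEnd ℂ).injective.eq_iff, map_add, map_one]

theorem HasWeakDeriv.conj {v : ℂ} {f g : ℂ → ℂ} (h : HasWeakDeriv v f g) :
    HasWeakDeriv v (fun z => conj (f z)) fun z => conj (g z) := by
  intro φ hφ hc hs
  have hsupp : Function.support (fun z => conj (φ z)) = Function.support φ := by
    ext z; simp
  have hts : tsupport (fun z => conj (φ z)) = tsupport φ := by rw [tsupport, tsupport, hsupp]
  have hd : ∀ z, fderiv ℝ (fun z => conj (φ z)) z v = conj (fderiv ℝ φ z v) := fun z => by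
    have := Complex.conjCLE.comp_fderiv (f := φ) (x := z)
    exact congrArg (fun L : ℂ →L[ℝ] ℂ => L v) this
  have key := h (fun z => conj (φ z)) (Complex.conjCLE.contDiff.comp hφ)
    (by rw [HasCompactSupport, hts]; exact hc) (by rw [hts]; exact hs)
  simp only [hd] at key
  have := congrArg (starRingEnd ℂ) key
  rw [map_neg, ← integral_conj, ← integral_conj] at this
  simpa using this

theorem MemSobolevDisc.conj {p : ℝ} : ∀ {k : ℕ} {f : ℂ → ℂ}, MemSobolevDisc k p f →
    MemSobolevDisc k p fun z => conj (f z)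
  | 0, _, h => MemLpDisc.conj h
  | _ + 1, _, h => ⟨h.1.conj, fun v hv =>
      let ⟨_, hg, hk⟩ := h.2 v hv
      ⟨_, hg.conj, hk.conj⟩⟩

/-! ### Smallness above the threshold -/

theorem one_mem_closedDisc : (1 : ℂ) ∈ closedDisc := by simp [closedDisc]

/-- The map `ξ ↦ 1/(1-ξ)` sends the unit disc into the half-plane of real part greater than `1/2`,
and the disc has area `π`. -/
theorem half_le_norm_cauchy_one : (1 / 2 : ℝ) ≤ ‖cauchy (fun _ => 1) 1‖ := by
  have hone : MemLpDisc 3 fun _ => (1 : ℂ) := memLpDisc_of_continuousOn continuousOn_const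
  have hi : Integrable (fun ξ : ℂ => 1 / (1 - ξ)) (volume.restrict disc) :=
    hone.integrable_div (by norm_num) one_mem_closedDisc
  have hvol : (volume : Measure ℂ).real disc = Real.pi := by
    simp [disc, measureReal_def, Complex.volume_ball]
  have hre : Real.pi / 2 ≤ (∫ ξ in disc, 1 / (1 - ξ)).re := by
    have h1 : (∫ ξ in disc, 1 / (1 - ξ)).re = ∫ ξ in disc, (1 / (1 - ξ)).re :=
      (Complex.reCLM.integral_comp_comm hi).symm
    rw [h1]
    have h2 : ∫ _ in disc, (1 / 2 : ℝ) = Real.pi / 2 := by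
      rw [setIntegral_const, hvol, smul_eq_mul]; ring
    rw [← h2]
    refine setIntegral_mono_on (integrableOn_const (hs := measure_ball_lt_top.ne)) hi.re measurableSet_disc fun ξ hξ => ?_
    rw [disc, mem_ball_zero_iff] at hξ
    have hns : Complex.normSq ξ < 1 := by
      rw [Complex.normSq_eq_norm_sq, sq_lt_one_iff₀ (norm_nonneg _)]; exact hξ
    have hξ1 : (1 : ℂ) - ξ ≠ 0 := by
      intro h
      rw [← sub_eq_zero.1 h, norm_one] at hξ
      exact lt_irrefl _ hξ
    have hpos := Complex.normSq_pos.2 hξ1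
    rw [one_div (1 - ξ), Complex.inv_re, div_le_div_iff₀ two_pos hpos]
    rw [Complex.normSq_apply] at hns ⊢
    simp only [Complex.sub_re, Complex.one_re, Complex.sub_im, Complex.one_im]
    nlinarith
  rw [cauchy, norm_mul, norm_div, norm_one, Complex.norm_real, Real.norm_of_nonneg Real.pi_pos.le]
  have := hre.trans ((le_abs_self _).trans (Complex.abs_re_le_norm _))
  rw [one_div_mul_eq_div, le_div_iff₀ Real.pi_pos]
  linarith

theorem lpNorm_one_le {p : ℝ} (hp : 2 < p) : lpNorm p (fun _ => 1) ≤ 2 := by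
  have hp0 : 0 < p := by linarith
  rw [lpNorm, eLpNorm_const' _ (by simpa using hp0) ENNReal.ofReal_ne_top, enorm_one, one_mul,
    ENNReal.toReal_ofReal hp0.le, discMeasure, Measure.restrict_apply_univ, disc, Complex.volume_ball]
  have h4 : ENNReal.ofReal 1 ^ 2 * (NNReal.pi : ℝ≥0∞) ≤ ENNReal.ofReal 4 := by
    rw [ENNReal.ofReal_one, one_pow, one_mul, ← ENNReal.ofReal_coe_nnreal]
    exact ENNReal.ofReal_le_ofReal Real.pi_le_four
  calc _ ≤ ENNReal.ofReal 4 ^ (1 / p) := by gcongr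
    _ ≤ ENNReal.ofReal 4 ^ (1 / 2 : ℝ) := by
      apply ENNReal.rpow_le_rpow_of_exponent_le (by simp)
      exact one_div_le_one_div_of_le two_pos hp.le
    _ = 2 := by
      rw [ENNReal.ofReal_rpow_of_nonneg (by norm_num) (by norm_num), ← Real.sqrt_eq_rpow,
        show (4 : ℝ) = 2 ^ 2 by norm_num, Real.sqrt_sq (by norm_num)]
      simp

/-- The threshold is expressed through arbitrary admissible constants, so a lower bound for them is
needed. Testing on the constant `1`, of `L^p` norm at most `2`, provides it. -/
theorem IsCauchyBound.quarter_le {p : ℝ} (hp : 2 < p) {C : ℝ≥0} (hC : IsCauchyBound p C) : (1 / 4 : ℝ) ≤ C := by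
  have hone : MemLpDisc p fun _ => (1 : ℂ) := memLpDisc_of_continuousOn continuousOn_const
  have h1 : ‖cauchy (fun _ => 1) 1‖ₑ ≤ C * 2 :=
    (enorm_le_holderNorm one_mem_closedDisc).trans ((hC _ hone).1.trans (by gcongr; exact lpNorm_one_le hp))
  have h2 : ENNReal.ofReal ‖cauchy (fun _ => 1) 1‖ ≤ ENNReal.ofReal (C * 2) := by
    rw [ofReal_norm, ENNReal.ofReal_mul C.coe_nonneg, ENNReal.ofReal_coe_nnreal]
    simpa using h1
  have h3 := (ENNReal.ofReal_le_ofReal_iff (mul_nonneg C.coe_nonneg zero_le_two)).1 h2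
  linarith [half_le_norm_cauchy_one]

/-- From `Cα ≥ 1/4`, half of the constant `C` is at least `(400/2)·11·(1/4) M = 550M`, above the
required `420M`. The exponent `e` of the threshold is at least `5` for `p > 2`, so `|n|^(1/5) ≥
|n|^(1/e)`, which exceeds half of `C`. -/
theorem contractionConst_lt_one {p : ℝ} (hp : 2 < p) {Cα Bp : ℝ≥0} (hC : IsCauchyBound p Cα) {q₁ q₂ q : ℂ → ℂ}
    (hq : MemLpDisc p q) (hM : (lpNorm p q).toReal ≤ max (lpNorm p q₁).toReal (lpNorm p q₂).toReal) {n : ℝ}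
    (hn : threshold p Cα Bp q₁ q₂ < |n|) : contractionConst p n q < 1 := by
  obtain ⟨h1, h2⟩ := max_lt_iff.1 hn
  set M := max (lpNorm p q₁).toReal (lpNorm p q₂).toReal with hMdef
  have hM0 : 0 ≤ M := ENNReal.toReal_nonneg.trans hM
  have hn0 : 0 < |n| := by linarith
  set c := bigC p Cα Bp q₁ q₂ / 2 with hc
  have hcM : 550 * M ≤ c := by
    have h4 := hC.quarter_le hp
    have hB : (0 : ℝ) ≤ Bp := Bp.coe_nonneg
    have h5 : (11 : ℝ) * (1 / 4) ≤ (Cα + 11) * (Cα + Bp) := by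
      apply mul_le_mul <;> linarith
    have h6 := mul_le_mul_of_nonneg_right h5 hM0
    rw [hc, bigC, ← hMdef]
    linarith
  have hc0 : 0 ≤ c := by linarith
  set e := p * (2 * p + 1) / 2 with he
  have he5 : 5 ≤ e := by
    rw [he]; nlinarith
  have hlt : c < |n| ^ (1 / 5 : ℝ) := by
    calc c = (c ^ e) ^ (1 / e) := by
          rw [← Real.rpow_mul hc0, mul_one_div_cancel (by linarith), Real.rpow_one]
      _ < |n| ^ (1 / e) := Real.rpow_lt_rpow (by positivity) h2 (by positivity)
      _ ≤ |n| ^ (1 / 5 : ℝ) :=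
        Real.rpow_le_rpow_of_exponent_le h1.le (one_div_le_one_div_of_le (by norm_num) he5)
  have hpos : 0 < |n| ^ (1 / 5 : ℝ) := by positivity
  rw [contractionConst, ← ENNReal.ofReal_toReal (show lpNorm p q ≠ ⊤ from hq.2.ne), ← ENNReal.ofReal_mul (by positivity), ← ENNReal.ofReal_one]
  refine (ENNReal.ofReal_lt_ofReal_iff one_pos).2 ?_
  rw [Real.rpow_neg hn0.le, ← div_eq_mul_inv, div_mul_eq_mul_div, div_lt_one hpos]
  linarith

end BukhgeimDisc

/-! ### The theorem. -/

theorem lemma5p3p11 (p α : ℝ) (hp : 2 < p) (hα : α = 1 - 2 / p) :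
    (∃ Cα Bp : ℝ≥0, IsCauchyBound p Cα ∧ IsBeurlingBound p Bp) ∧
    ∀ Cα Bp : ℝ≥0, IsCauchyBound p Cα → IsBeurlingBound p Bp →
    ∀ q₁ q₂ : ℂ → ℂ, MemLpDisc p q₁ → MemLpDisc p q₂ →
    ∀ n : ℝ, threshold p Cα Bp q₁ q₂ < n →
      ∃ F G : ℂ → ℂ → ℂ,
        (∀ z₀ ∈ disc,
          (IsHolderSolution α (opS q₁ n z₀) (F z₀) ∧
            (∀ f, IsHolderSolution α (opS q₁ n z₀) f → EqOn f (F z₀) closedDisc) ∧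
            MemSobolevDisc 2 p (F z₀)) ∧
          (IsHolderSolution α (opSBar q₂ n z₀) (G z₀) ∧
            (∀ g, IsHolderSolution α (opSBar q₂ n z₀) g → EqOn g (G z₀) closedDisc) ∧
            MemSobolevDisc 2 p (G z₀))) ∧
        ∀ z₀ ∈ disc,
          Tendsto (fun z => holderNorm α (F z - F z₀)) (𝓝[disc] z₀) (𝓝 0) ∧
          Tendsto (fun z => holderNorm α (G z - G z₀)) (𝓝[disc] z₀) (𝓝 0) := by
  subst hα
  obtain ⟨C, hC⟩ := exists_isCauchyBound hp
  obtain ⟨B, hB⟩ := exists_isBeurlingBound hp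
  refine ⟨⟨C, B, hC, hB⟩, ?_⟩
  intro Cα Bp hCα _ q₁ q₂ hq₁ hq₂ n hn
  have hn0 : 0 < n := one_pos.trans ((le_max_left _ _).trans_lt hn)
  have hn' : threshold p Cα Bp q₁ q₂ < |n| := by rwa [abs_of_pos hn0]
  have hκ₁ := contractionConst_lt_one (Bp := Bp) (q₁ := q₁) (q₂ := q₂) hp hCα hq₁ (le_max_left _ _) hn'
  have hκ₂ : contractionConst p (-n) (fun ξ => conj (q₂ ξ)) < 1 :=
    contractionConst_lt_one (Bp := Bp) (q₁ := q₁) (q₂ := q₂) hp hCα hq₂.conj ((congrArg ENNReal.toReal (lpNorm_conj p q₂)).trans_le (le_max_right _ _)) (by rwa [abs_neg])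
  obtain ⟨F, hF, hFc⟩ := exists_solutions hp hq₁ hn0.ne' hκ₁
  obtain ⟨H, hH, hHc⟩ := exists_solutions hp hq₂.conj (neg_ne_zero.2 hn0.ne') hκ₂
  -- `H` solves the unbarred equation with `conj q₂` and `-n`, so its conjugate solves the barred
  -- one.
  refine ⟨F, fun z₀ z => conj (H z₀ z), fun z₀ _ => ⟨hF z₀, ?_, fun g hg z hz => ?_, (hH z₀).2.2.conj⟩,
    fun z₀ _ => ⟨(hFc z₀).mono_left nhdsWithin_le_nhds, ?_⟩⟩
  · rw [isHolderSolution_opSBar_iff]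
    simpa only [Complex.conj_conj] using (hH z₀).1
  · have := (hH z₀).2.1 _ (isHolderSolution_opSBar_iff.1 hg) hz
    simp only [← this, Complex.conj_conj]
  · refine ((hHc z₀).mono_left nhdsWithin_le_nhds).congr fun z => ?_
    rw [← holderNorm_conj]
    congr 1
    funext w
    simp
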